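/- **Theorem (Kernel estimation).** Let $\sigma:\mathbb R\to\mathbb R$ be a locally absolutely continuous activation function with $\mathbb E[\sigma(X)]=0$, $\mathbb E[\sigma(X)^2]=1$ and $\mathbb E[\sigma'(X)^2]<\infty$ for $X\sim\mathcal N(0,1)$. For $f\in\{\sigma,\sigma'\}$ and $\rho\in[-1,1]$ let $\hat f(\rho)=\mathbb E[f(U)f(V)]$, where $U,V$ are jointly Gaussian, standard normal, with correlation $\rho$. The neural tangent kernel of depth $L$ is $k(\mathbf x,\mathbf x')=\hat k(\mathbf x\cdot\mathbf x')$ for unit vectors $\mathbf x,\mathbf x'$, with $$\hat k(\rho)=\sum_{h=1}^{L+1}\hat\sigma^{(h-1)}(\rho)\prod_{h'=h}^{L}\widehat{\sigma'}\big(\hat\sigma^{(h')}(\rho)\big),$$ where $\hat\sigma^{(\ell)}$ is the $\ell$-fold composition of $\hat\sigma$. Depths $L=O(\log n)$ are considered, with a fixed implied constant. Let $\mathbf x_0,\dots,\mathbf x_{n-1},\mathbf x_*\in\mathbb R^d$ be unit vectors stored in a QRAM: the unitaries $|i\rangle|0\rangle\mapsto|i\rangle|\mathbf x_i\rangle$ (with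 $|i\rangle$ a preserved address register), $|0\rangle\mapsto n^{-1/2}\sum_i|i\rangle$ and $|0\rangle\mapsto|\mathbf x_*\rangle$ on amplitude-encoded vectors, and their inverses, are available, the data-loading ones also controlled on a qubit, at a cost of $O(\mathrm{polylog}(nd))$ time each. A quantum algorithm is a circuit of such queries and arbitrary two-qubit gates (unit time each) on the index register and work qubits that start in $|0\rangle$. The circuit may depend on $\sigma,L,n,d$ and the accuracy parameters, but not on the data. Constants in the bounds below may depend on $\sigma$, on the constant in $L=O(\log n)$ and on the polylogarithmic query cost. 1. (Kernel values in a register.) Let $p\in\mathbb N$, $\varepsilon>0$ and $0<\Delta<1/2$ be constants. For all $n,d\ge1$ and $L=O(\log n)$ there is a quantum algorithm of time $O(\mathrm{polylog}(nd))$ that maps $$\frac1{\sqrt n}\sum_{i}|i\rangle|0\rangle\ \mapsto\ \frac1{\sqrt n}\sum_i|i\rangle|\psi_i\rangle,\qquad \big\||\psi_i\rangle-|\phi_i\rangle\big\|\le\sqrt{2\Delta}\ \text{ for every } i,$$ where $|\phi_i\rangle$ is a unit vector of the work qubits in which a fixed-point register with $p$ fractional bits holds only values $v$ with $|v-\hat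 k(\rho)|\le2^{-p}$ for some $\rho\in[-1,1]$ with $|\rho-\mathbf x_*\cdot\mathbf x_i|\le\varepsilon$. For a fixed depth $L$ (and constants $p$, $\Delta$) there is likewise such an algorithm of time $O(\mathrm{polylog}(nd))$ for which the register holds only values $v$ with $|v-k(\mathbf x_*,\mathbf x_i)|\le2^{-p}$. 2. (Amplitude encoding.) Let $0\le\hat\delta<1$, $0<\varepsilon\le1$, $0<\Delta<1/2$, $0<p\le1$. For all $n,d\ge1$ and $L=O(\log n)$ there is a quantum algorithm $C$ which, including the preparation of $n^{-1/2}\sum_i|i\rangle|0\rangle$ from $|0\rangle|0\rangle$, takes time $$B=\tilde O\big(\mathrm{polylog}(nd)\,\log(1/\Delta)/\varepsilon\big)$$ with constants independent of $n,d,L,\hat\delta,\varepsilon,\Delta,p$, where $\tilde O(X)$ is $X$ times a polylogarithmic factor in $X/p$, such that for all data there are $\rho_i\in[-1,1]$ with $|\rho_i-\mathbf x_*\cdot\mathbf x_i|\le\varepsilon$ for which the following holds. Let $k_i$ be $\hat k(\rho_i)/\hat k(1-\hat\delta)$ clipped to $[-1,1]$, and $P=\sum_ik_i^2$. - On input $n^{-1/2}\sum_i|i\rangle|0\rangle$,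 the output of $C$ has amplitude $(k_i+e_i)/\sqrt n$ at $|i\rangle|0\rangle$ with $|e_i|^2\le2\Delta p$, for every $i$. - If $P/n\ge p$, then the state of the index register post-selected on all work qubits being $0$ has squared overlap at least $1-2\Delta$ with $|k_*\rangle=\frac1{\sqrt P}\sum_ik_i|i\rangle$, and repeating preparation and $C$ until this post-selection succeeds takes expected total time at most $B\cdot n/P$, i.e. $B$ times the inverse of the post-selection probability $P/n=\frac1n\sum_ik_i^2$ of the ideal state. -/

import Mathlib

open MeasureTheory ProbabilityTheory
open scoped ENNReal

noncomputable section

/-! ### The neural tangent kernel -/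

/-- Dual (conjugate) activation `f̂(ρ) = 𝔼[f(U) f(V)]`, where `(U, V)` are jointly Gaussian, each
standard normal, with correlation `ρ ∈ [-1, 1]`; i.e. `𝔼_{w ∼ N(0, I)} [f(w ⬝ x) f(w ⬝ x')]` for
unit vectors `x, x'` with `x ⬝ x' = ρ`. -/
def dualActivation (f : ℝ → ℝ) (ρ : ℝ) : ℝ :=
  ∫ w : ℝ × ℝ, f w.1 * f (ρ * w.1 + Real.sqrt (1 - ρ ^ 2) * w.2)
    ∂((gaussianReal 0 1).prod (gaussianReal 0 1))

/-- The neural tangent kernel of depth `L` as a function of the inner product: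
`k̂(ρ) = ∑_{h=1}^{L+1} σ̂^{(h-1)}(ρ) ∏_{h'=h}^{L} (σ')^(σ̂^{(h')}(ρ))`, with `σ̂^{(ℓ)}` the `ℓ`-fold
composition of the dual activation. -/
def kernelHat (σ : ℝ → ℝ) (L : ℕ) (ρ : ℝ) : ℝ :=
  ∑ h ∈ Finset.Icc 1 (L + 1), (dualActivation σ)^[h - 1] ρ *
    ∏ h' ∈ Finset.Icc h L, dualActivation (deriv σ) ((dualActivation σ)^[h'] ρ)

/-- The neural tangent kernel `k(x, x') = k̂(x ⬝ x')` of two unit vectors. -/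
def ntk (σ : ℝ → ℝ) (L : ℕ) {d : ℕ} (x x' : EuclideanSpace ℝ (Fin d)) : ℝ :=
  kernelHat σ L (inner ℝ x x')

/-- Normalized activation functions: `σ` is locally absolutely continuous (so that its derivative
exists almost everywhere and determines `σ` up to a constant), `σ'` is square integrable for the
standard Gaussian, and `σ` has Gaussian mean `0` and variance `1`. -/
structure IsNormalizedActivation (σ : ℝ → ℝ) : Prop where
  absolutelyContinuous : ∀ a b, AbsolutelyContinuousOnInterval σ a b
  memLp_deriv : MemLp (deriv σ) 2 (gaussianReal 0 1)
  mean_zero : ∫ u, σ u ∂(gaussianReal 0 1) = 0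
  variance_one : ∫ u, σ u ^ 2 ∂(gaussianReal 0 1) = 1

/-- The normalized kernel element `k̂(ρ) / k̂(1 - δ̂)` clipped to `[-1, 1]`. -/
def clippedKernel (σ : ℝ → ℝ) (L : ℕ) (δhat ρ : ℝ) : ℝ :=
  max (-1) (min 1 (kernelHat σ L ρ / kernelHat σ L (1 - δhat)))

/-! ### Quantum access to the data -/

/-- Computational basis labels of `q` qubits. -/
abbrev Bits (q : ℕ) : Type := Fin q → Bool

/-- The all-zero label. -/
def zeroBits (q : ℕ) : Bits q := fun _ => false

/-- The `b` lowest binary digits of `j`. -/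
def binary (b j : ℕ) : Bits b := fun t => j.testBit t

/-- Number of qubits that hold an amplitude encoding of a vector of `ℝ^d`. -/
abbrev dataQubits (d : ℕ) : ℕ := Nat.clog 2 d

/-- The amplitude encoding `|x⟩ = ‖x‖⁻¹ ∑_j x_j |j⟩`. -/
def amplitudeEncoding {d : ℕ} (x : EuclideanSpace ℝ (Fin d)) (y : Bits (dataQubits d)) : ℂ :=
  ∑ j : Fin d, if binary (dataQubits d) j = y then ((x j / ‖x‖ : ℝ) : ℂ) else 0

/-- Quantum access to a data matrix with rows `x i` and to a test vector `xs`: the unitaries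
`|i⟩|0⟩ ↦ |i⟩|x_i⟩` (with `|i⟩` the address, which is kept), `|0⟩ ↦ ‖S‖_F⁻¹ ∑_i ‖x_i‖ |i⟩`, and
`|0⟩ ↦ |x_*⟩`. What they do on other inputs is unspecified. -/
structure QuantumAccess {n d : ℕ} [NeZero n] (x : Fin n → EuclideanSpace ℝ (Fin d))
    (xs : EuclideanSpace ℝ (Fin d)) where
  row : Fin n → Matrix.unitaryGroup (Bits (dataQubits d)) ℂ
  row_spec : ∀ i y, (row i).1 y (zeroBits _) = amplitudeEncoding (x i) y
  load : Matrix.unitaryGroup (Fin n) ℂ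
  load_spec : ∀ i, load.1 i 0 = ((‖x i‖ / Real.sqrt (∑ j, ‖x j‖ ^ 2) : ℝ) : ℂ)
  test : Matrix.unitaryGroup (Bits (dataQubits d)) ℂ
  test_spec : ∀ y, test.1 y (zeroBits _) = amplitudeEncoding xs y

/-! ### Quantum circuits with QRAM queries -/

/-- Elementary operations on an index register and `q` work qubits (data dimension `d`):
an arbitrary two-qubit gate, and queries to the quantum access unitaries or (`inv = true`) their
inverses, placed on the work qubits `w` and controlled on a further work qubit `c`. -/
inductive Instr (d q : ℕ) : Type
  | gate (w : Fin 2 ↪ Fin q) (g : Matrix.unitaryGroup (Bits 2) ℂ)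
  | load (inv : Bool)
  | row (inv : Bool) (c : Fin q) (w : Fin (dataQubits d) ↪ Fin q) (hc : ∀ t, w t ≠ c)
  | test (inv : Bool) (c : Fin q) (w : Fin (dataQubits d) ↪ Fin q) (hc : ∀ t, w t ≠ c)

/-- Joint states of an `n`-valued index register and `q` work qubits. -/
abbrev QState (n q : ℕ) : Type := EuclideanSpace ℂ (Fin n × Bits q)

/-- `U` or its inverse. -/
def orInverse {ι : Type*} [Fintype ι] [DecidableEq ι] (inv : Bool)
    (U : Matrix.unitaryGroup ι ℂ) : Matrix ι ι ℂ :=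
  if inv then (U⁻¹).1 else U.1

/-- The matrix `M`, acting on the qubits `w` of the register. -/
def applyOn {b q : ℕ} (w : Fin b ↪ Fin q) (M : Matrix (Bits b) (Bits b) ℂ) (ψ : Bits q → ℂ) :
    Bits q → ℂ :=
  fun z => ∑ y : Bits b, M (z ∘ w) y * ψ (Function.extend w y z)

/-- The matrix `M` on the qubits `w`, controlled on the qubit `c`. -/
def applyControlled {b q : ℕ} (c : Fin q) (w : Fin b ↪ Fin q) (M : Matrix (Bits b) (Bits b) ℂ)
    (ψ : Bits q → ℂ) : Bits q → ℂ :=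
  fun z => if z c then applyOn w M ψ z else ψ z

variable {n d q : ℕ} [NeZero n] {x : Fin n → EuclideanSpace ℝ (Fin d)}
  {xs : EuclideanSpace ℝ (Fin d)}

/-- The action of one operation on the joint state. -/
def Instr.apply (Q : QuantumAccess x xs) : Instr d q → QState n q → QState n q
  | .gate w g, ψ => WithLp.toLp 2 fun p => applyOn w g.1 (fun z => ψ (p.1, z)) p.2
  | .load inv, ψ => WithLp.toLp 2 fun p => ∑ j, orInverse inv Q.load p.1 j * ψ (j, p.2)
  | .row inv c w _, ψ => WithLp.toLp 2 fun p =>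
      applyControlled c w (orInverse inv (Q.row p.1)) (fun z => ψ (p.1, z)) p.2
  | .test inv c w _, ψ => WithLp.toLp 2 fun p =>
      applyControlled c w (orInverse inv Q.test) (fun z => ψ (p.1, z)) p.2

/-- Execution of a circuit, first operation first. -/
def run (Q : QuantumAccess x xs) (C : List (Instr d q)) (ψ : QState n q) : QState n q :=
  C.foldl (fun φ g => g.apply Q φ) ψ

/-- Time of one operation, if a QRAM query takes time `T`. -/
def Instr.time (T : ℕ) : Instr d q → ℕ
  | .gate _ _ => 1
  | .load _ => T
  | .row _ _ _ _ => T
  | .test _ _ _ _ => T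

/-- Time of a circuit, if a QRAM query takes time `T`. -/
def circuitTime (T : ℕ) (C : List (Instr d q)) : ℕ := (C.map (Instr.time T)).sum

/-- The state `|0⟩|0…0⟩`. -/
def zeroState (n q : ℕ) [NeZero n] : QState n q :=
  WithLp.toLp 2 fun p => if p.1 = 0 ∧ p.2 = zeroBits q then 1 else 0

/-- The joint state `n^{-1/2} ∑_i |i⟩ ⊗ φ_i`. -/
def superpose (φ : Fin n → EuclideanSpace ℂ (Bits q)) : QState n q :=
  WithLp.toLp 2 fun p => (((Real.sqrt n)⁻¹ : ℝ) : ℂ) * φ p.1 p.2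

/-- The state `n^{-1/2} ∑_i |i⟩|0…0⟩`. -/
def uniformState (n q : ℕ) [NeZero n] : QState n q :=
  superpose fun _ => EuclideanSpace.single (zeroBits q) 1

/-- Two's complement fixed-point value of a register of `m + 1` bits with `p` fractional bits. -/
def fixedPoint (p : ℕ) {m : ℕ} (y : Bits (m + 1)) : ℝ :=
  ((∑ t : Fin m, if y t.castSucc then (2 : ℝ) ^ (t : ℕ) else 0) -
    (if y (Fin.last m) then (2 : ℝ) ^ m else 0)) / 2 ^ p

/-- The circuit `C` maps `n^{-1/2} ∑_i |i⟩|0…0⟩` to `n^{-1/2} ∑_i |i⟩|ψ_i⟩`, where `ψ_i` is within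
`√(2Δ)` of a state of the work qubits in which the fixed-point register on the qubits `out` holds
only values `v` with `good i v`. -/
def WritesValues (Q : QuantumAccess x xs) (C : List (Instr d q)) (p : ℕ) {m : ℕ}
    (out : Fin (m + 1) ↪ Fin q) (Δ : ℝ) (good : Fin n → ℝ → Prop) : Prop :=
  ∃ ψ φ : Fin n → EuclideanSpace ℂ (Bits q),
    run Q C (uniformState n q) = superpose ψ ∧
    ∀ i, ‖φ i‖ = 1 ∧ ‖ψ i - φ i‖ ≤ Real.sqrt (2 * Δ) ∧
      ∀ z, φ i z ≠ 0 → good i (fixedPoint p (z ∘ out))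

/-- The unnormalized state of the index register when all work qubits are measured as `0`. -/
def accepted (ψ : QState n q) : EuclideanSpace ℂ (Fin n) :=
  WithLp.toLp 2 fun i => ψ (i, zeroBits q)

/-- Probability that all work qubits of the state `ψ` are measured as `0`. -/
def acceptProb (ψ : QState n q) : ℝ := ‖accepted ψ‖ ^ 2

/-- The state of the index register after post-selection on all work qubits being `0`. -/
def postSelected (ψ : QState n q) : EuclideanSpace ℂ (Fin n) :=
  (((‖accepted ψ‖)⁻¹ : ℝ) : ℂ) • accepted ψ

/-- Expected total time of: run the circuit `C` on `|0⟩|0…0⟩`, measure the work qubits, and start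
again until all of them are `0`. The trial number `t + 1` takes place with probability
`(1 - acceptProb)^t`. -/
def expectedTime (T : ℕ) (Q : QuantumAccess x xs) (C : List (Instr d q)) : ℝ≥0∞ :=
  ∑' t : ℕ, ENNReal.ofReal ((1 - acceptProb (run Q C (zeroState n q))) ^ t) * circuitTime T C

/-- The amplitude-encoded state `(∑_i k_i²)^{-1/2} ∑_i k_i |i⟩`. -/
def kernelState (k : Fin n → ℝ) : EuclideanSpace ℂ (Fin n) :=
  WithLp.toLp 2 fun i => ((k i / Real.sqrt (∑ j, k j ^ 2) : ℝ) : ℂ)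

end

/-! The circuit may depend on σ and L, so the kernel is a known function on [-1, 1] and only the
inner product ρ of `xs` and `x i` is unknown. The task is to apply known functions to ρ coherently.
Since the address is preserved, everything can be done for one address at a time (`run_apply`).

The state s = 2^{-1/2} (|0⟩|x_*⟩ + |1⟩|x_i⟩) costs two queries, and its copy s' with flipped
selection qubit has overlap ρ with s. With X this flip, the walk W = (2|s⟩⟨s| - 1) X satisfies W s =
2ρ s - s' and W s' = s. So it acts on their span with eigenvalues e^{±iθ}, cos θ = ρ, and s has
spectral weight 1/2 at each (`inner_aeval_walk`).

Quantum signal processing replaces phase estimation. If |P| < 1 on the unit circle, Fejér–Riesz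
gives Q with |P|² + |Q|² = 1 (`exists_complementary`), and `exists_qspPair` realizes the pair with
one controlled step of W per degree, by stripping off one degree at a time with a 2×2 unitary.

The polynomials come from `exists_filter_polynomial`. For any K bounded by 1, the values of K at
equidistant angles are averaged against a nonnegative Chebyshev kernel that is exponentially
concentrated. The result lies, up to 3δ, between the bounds of K on the ε-neighbourhood of ρ, and a
degree of order ε⁻¹ log(1/(εδ)) suffices. No modulus of continuity of K enters, so nothing
deteriorates as the depth grows.

For the amplitude encoding, K is the clipped kernel. Its continuity, which follows from L²
approximation of the activation and its derivative, and the intermediate value theorem turn the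
amplitude into a value of K at some ρ_i within ε of ρ, up to a small error; post-selection is then
an elementary estimate.

For the register, K runs through indicators of half-lines. A constant number of thresholds is
compared with ρ, each with its own signal qubit but the same walk. The spacing makes all correct
outcomes thermometer codes, even if one comparison is undecided, and such a code selects an entry of
a precomputed table of rounded kernel values. These are at most exponential in L, so O(log n) bits
suffice. For fixed depth, uniform continuity replaces the nearby point by the true inner product. -/

/-! ### Polynomials on the unit circle -/

section Circle
open Polynomial ComplexConjugate

/-- The conjugate reversal `z^N conj (f (1 / conj z))` of a polynomial of degree at most `N`. -/
noncomputable def conjReflect (N : ℕ) (f : ℂ[X]) : ℂ[X] := reflect N (f.map (starRingEnd ℂ))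

theorem natDegree_conjReflect_le {N : ℕ} {f : ℂ[X]} (hf : f.natDegree ≤ N) :
    (conjReflect N f).natDegree ≤ N := by
  rw [natDegree_le_iff_coeff_eq_zero]
  intro k hk
  rw [conjReflect, coeff_reflect, revAt_eq_self_of_lt hk, coeff_map,
    coeff_eq_zero_of_natDegree_lt (by omega), map_zero]

theorem coeff_conjReflect {N k : ℕ} (f : ℂ[X]) (hk : k ≤ N) :
    (conjReflect N f).coeff k = conj (f.coeff (N - k)) := by
  rw [conjReflect, coeff_reflect, revAt_le hk, coeff_map]

theorem eval_conjReflect {N : ℕ} {f : ℂ[X]} (hf : f.natDegree ≤ N) {z : ℂ} (hz : z ≠ 0) :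
    (conjReflect N f).eval z = z ^ N * conj (f.eval (conj z)⁻¹) := by
  let _ : Invertible z⁻¹ := invertibleOfNonzero (inv_ne_zero hz)
  have h := eval₂_reflect_mul_pow (RingHom.id ℂ) z⁻¹ N (f.map (starRingEnd ℂ))
    ((natDegree_map_le).trans hf)
  simp only [invOf_eq_inv, inv_inv] at h
  have h2 : eval₂ (RingHom.id ℂ) z⁻¹ (f.map (starRingEnd ℂ)) = conj (f.eval (conj z)⁻¹) := by
    rw [eval₂_id, eval_map, eval, hom_eval₂]
    simp
  rw [h2, eval₂_id] at h
  rw [← h, conjReflect, mul_left_comm, ← mul_pow, mul_inv_cancel₀ hz, one_pow, mul_one]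

theorem conj_inv_of_norm_one {z : ℂ} (hz : ‖z‖ = 1) : (conj z)⁻¹ = z := by
  rw [← Complex.inv_eq_conj hz, inv_inv]

theorem ne_zero_of_norm_one {z : ℂ} (hz : ‖z‖ = 1) : z ≠ 0 := by
  rintro rfl; simp at hz

theorem infinite_unit_circle : {z : ℂ | ‖z‖ = 1}.Infinite := by
  have h : IsPreconnected (Metric.sphere (0 : ℂ) 1) :=
    isPreconnected_sphere (by rw [Complex.rank_real_complex]; exact Cardinal.one_lt_two) _ _
  have := h.infinite_of_nontrivial ⟨1, by simp, -1, by simp, by norm_num⟩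
  simpa [Metric.sphere, dist_zero_right] using this

theorem eq_of_eval_eq_on_circle {f g : ℂ[X]} (h : ∀ z : ℂ, ‖z‖ = 1 → f.eval z = g.eval z) :
    f = g :=
  eq_of_infinite_eval_eq f g (infinite_unit_circle.mono fun z hz => h z hz)

theorem norm_sub_sq_mul_self {z : ℂ} (hz : ‖z‖ = 1) (w : ℂ) :
    (z - w) * (1 - conj w * z) = z * (‖z - w‖ ^ 2 : ℝ) := by
  have h1 : z * conj z = 1 := by rw [Complex.mul_conj, Complex.normSq_eq_norm_sq, hz]; simp
  have h2 : ((‖z - w‖ ^ 2 : ℝ) : ℂ) = (z - w) * conj (z - w) := by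
    rw [Complex.mul_conj, Complex.normSq_eq_norm_sq]
  rw [h2, map_sub]
  linear_combination (w - z) * h1

/-- **Fejér–Riesz factorization** of a trigonometric polynomial that is positive on the circle. -/
theorem exists_fejer_riesz (N : ℕ) : ∀ T : ℂ[X], T.natDegree ≤ 2 * N →
    (∀ z : ℂ, ‖z‖ = 1 → ∃ r : ℝ, 0 < r ∧ T.eval z = z ^ N * r) →
    ∃ Q : ℂ[X], Q.natDegree ≤ N ∧ ∀ z : ℂ, ‖z‖ = 1 → T.eval z = z ^ N * (‖Q.eval z‖ ^ 2 : ℝ) := by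
  induction N with
  | zero =>
    intro T hT hpos
    obtain ⟨r, hr, h1⟩ := hpos 1 (by simp)
    have hTC := eq_C_of_natDegree_le_zero (by simpa using hT : T.natDegree ≤ 0)
    have h0 : T.coeff 0 = r := by
      rw [hTC] at h1; simpa using h1
    refine ⟨C (Real.sqrt r : ℂ), by simp, fun z _ => ?_⟩
    rw [hTC, h0]
    simp [abs_of_nonneg, Real.sqrt_nonneg, Real.sq_sqrt hr.le]
  | succ N ih =>
    intro T hT hpos
    -- Since z^{-(N+1)} T(z) is real on the circle, T is its own conjugate reversal. Hence its
    -- extreme coefficients vanish together, and its nonzero roots come in pairs z₀, 1 / conj z₀.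
    have hself : conjReflect (2 * (N + 1)) T = T := by
      apply eq_of_eval_eq_on_circle
      intro z hz
      obtain ⟨r, hr, h⟩ := hpos z hz
      have h1 : z * conj z = 1 := by rw [Complex.mul_conj, Complex.normSq_eq_norm_sq, hz]; simp
      rw [eval_conjReflect hT (ne_zero_of_norm_one hz), conj_inv_of_norm_one hz, h, map_mul, map_pow,
        Complex.conj_ofReal, two_mul, pow_add, mul_assoc, ← mul_assoc (z ^ (N + 1)) (conj z ^ _),
        ← mul_pow, h1, one_pow, one_mul]
    -- A root at the origin forces the top coefficient to vanish as well, so division by X lowers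
    -- the degree bound by two and the exponent of z by one.
    by_cases hc : T.coeff 0 = 0
    · have htop : T.coeff (2 * (N + 1)) = 0 := by
        rw [← hself, coeff_conjReflect _ le_rfl, Nat.sub_self, hc, map_zero]
      obtain ⟨T', rfl⟩ := X_dvd_iff.2 hc
      have hT' : T'.natDegree ≤ 2 * N := by
        rw [natDegree_le_iff_coeff_eq_zero] at hT ⊢
        intro k hk
        rcases (show 2 * N + 1 ≤ k from hk).eq_or_lt with rfl | hk
        · rwa [show 2 * (N + 1) = (2 * N + 1) + 1 by ring, coeff_X_mul] at htop
        · have := hT (k + 1) (by omega)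
          rwa [coeff_X_mul] at this
      obtain ⟨Q, hQ, hQz⟩ := ih T' hT' fun z hz => by
        obtain ⟨r, hr, h⟩ := hpos z hz
        refine ⟨r, hr, mul_left_cancel₀ (ne_zero_of_norm_one hz) ?_⟩
        rw [eval_mul, eval_X] at h
        rw [h]; ring
      refine ⟨Q, by omega, fun z hz => ?_⟩
      rw [eval_mul, eval_X, hQz z hz]; ring
    · have htop : T.coeff (2 * (N + 1)) ≠ 0 := by
        rw [← hself, coeff_conjReflect _ le_rfl, Nat.sub_self]
        simpa using hc
      have hdeg : T.degree ≠ 0 := by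
        intro h
        have := le_natDegree_of_ne_zero htop
        rw [natDegree_eq_zero_iff_degree_le_zero.2 h.le] at this
        omega
      obtain ⟨z₀, hz₀⟩ := IsAlgClosed.exists_root T hdeg
      have hz₀0 : z₀ ≠ 0 := by
        rintro rfl
        exact hc (by rwa [IsRoot, ← coeff_zero_eq_eval_zero] at hz₀)
      have hc0 : conj z₀ ≠ 0 := by simpa using hz₀0
      have hcirc : ‖z₀‖ ≠ 1 := fun h => by
        obtain ⟨r, hr, h'⟩ := hpos z₀ h
        rw [hz₀.eq_zero] at h'
        have := mul_ne_zero (pow_ne_zero (N + 1) hz₀0) (Complex.ofReal_ne_zero.2 hr.ne')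
        exact this h'.symm
      have hw : T.eval (conj z₀)⁻¹ = 0 := by
        rw [← hself, eval_conjReflect hT (inv_ne_zero hc0)]
        simp [hz₀.eq_zero]
      have hne : (conj z₀)⁻¹ - z₀ ≠ 0 := by
        intro h
        apply hcirc
        have h2 : z₀ * conj z₀ = 1 := by
          rw [sub_eq_zero] at h
          nth_rewrite 1 [← h]; exact inv_mul_cancel₀ hc0
        rw [Complex.mul_conj, Complex.normSq_eq_norm_sq] at h2
        have h3 : ‖z₀‖ ^ 2 = 1 := by exact_mod_cast h2
        exact (pow_eq_one_iff_of_nonneg (norm_nonneg _) two_ne_zero).1 h3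
      obtain ⟨T₁, hT₁⟩ := dvd_iff_isRoot.2 hz₀
      have hT₁w : T₁.IsRoot (conj z₀)⁻¹ := by
        rw [hT₁, eval_mul, eval_sub, eval_X, eval_C] at hw
        exact (mul_eq_zero.1 hw).resolve_left hne
      obtain ⟨T₂, hT₂⟩ := dvd_iff_isRoot.2 hT₁w
      have hT0 : T ≠ 0 := by rintro rfl; simp at hc
      have hT₂0 : T₂ ≠ 0 := by rintro rfl; simp [hT₂] at hT₁; exact hT0 hT₁
      have hTfac : T = (X - C z₀) * ((X - C (conj z₀)⁻¹) * T₂) := by rw [hT₁, hT₂]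
      have hd : T₂.natDegree ≤ 2 * N := by
        have : T.natDegree = 1 + (1 + T₂.natDegree) := by
          rw [hTfac, natDegree_mul (X_sub_C_ne_zero _) (mul_ne_zero (X_sub_C_ne_zero _) hT₂0),
            natDegree_mul (X_sub_C_ne_zero _) hT₂0, natDegree_X_sub_C, natDegree_X_sub_C]
        omega
      -- On the circle the two linear factors multiply to z |z - z₀|² times the constant -(conj
      -- z₀)⁻¹. With that constant moved into the cofactor, positivity is inherited.
      set T' : ℂ[X] := C (-(conj z₀)⁻¹) * T₂ with hT'
      have hev : ∀ z : ℂ, ‖z‖ = 1 → T.eval z = z * (‖z - z₀‖ ^ 2 : ℝ) * T'.eval z := fun z hz => by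
        rw [← norm_sub_sq_mul_self hz, hTfac, hT']
        simp only [eval_mul, eval_sub, eval_X, eval_C]
        field_simp
        ring
      have hnz : ∀ z : ℂ, ‖z‖ = 1 → 0 < ‖z - z₀‖ ^ 2 := fun z hz => by
        have : z - z₀ ≠ 0 := by
          intro h; rw [sub_eq_zero] at h; exact hcirc (h ▸ hz)
        positivity
      obtain ⟨Q, hQ, hQz⟩ := ih T' ((natDegree_C_mul_le _ _).trans hd) fun z hz => by
        obtain ⟨r, hr, h⟩ := hpos z hz
        refine ⟨r / ‖z - z₀‖ ^ 2, div_pos hr (hnz z hz), ?_⟩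
        have h1 := hev z hz
        rw [h] at h1
        have h2 : ((‖z - z₀‖ ^ 2 : ℝ) : ℂ) ≠ 0 := Complex.ofReal_ne_zero.2 (hnz z hz).ne'
        have h3 := ne_zero_of_norm_one hz
        rw [Complex.ofReal_div, mul_div_assoc', eq_div_iff h2]
        apply mul_left_cancel₀ h3
        rw [← mul_assoc, ← mul_assoc, mul_right_comm, ← h1, pow_succ']
      refine ⟨(X - C z₀) * Q, ?_, fun z hz => ?_⟩
      · refine natDegree_mul_le.trans ?_
        rw [natDegree_X_sub_C]; omega
      · rw [hev z hz, hQz z hz]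
        simp only [eval_mul, eval_sub, eval_X, eval_C, norm_mul]
        push_cast
        ring

/-- Fejér–Riesz for z^N (1 - |P|²), which on the circle is the polynomial X^N - P P* with P* the
conjugate reversal. The strict bound on P supplies the positivity. -/
theorem exists_complementary {N : ℕ} {P : ℂ[X]} (hP : P.natDegree ≤ N)
    (h1 : ∀ z : ℂ, ‖z‖ = 1 → ‖P.eval z‖ < 1) :
    ∃ Q : ℂ[X], Q.natDegree ≤ N ∧
      ∀ z : ℂ, ‖z‖ = 1 → ‖P.eval z‖ ^ 2 + ‖Q.eval z‖ ^ 2 = 1 := by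
  have key : ∀ z : ℂ, ‖z‖ = 1 → (X ^ N - P * conjReflect N P).eval z =
      z ^ N * (1 - ‖P.eval z‖ ^ 2 : ℝ) := fun z hz => by
    have h2 : ((‖P.eval z‖ ^ 2 : ℝ) : ℂ) = P.eval z * conj (P.eval z) := by
      rw [Complex.mul_conj, Complex.normSq_eq_norm_sq]
    rw [eval_sub, eval_pow, eval_X, eval_mul, eval_conjReflect hP (ne_zero_of_norm_one hz),
      conj_inv_of_norm_one hz, Complex.ofReal_sub, h2]
    push_cast
    ring
  obtain ⟨Q, hQ, hQz⟩ := exists_fejer_riesz N (X ^ N - P * conjReflect N P) (by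
    refine (natDegree_sub_le _ _).trans (max_le (by simp; omega) (natDegree_mul_le.trans ?_))
    have := natDegree_conjReflect_le hP
    omega) fun z hz => ⟨_, by
      have := h1 z hz
      have h0 := norm_nonneg (P.eval z)
      nlinarith, key z hz⟩
  refine ⟨Q, hQ, fun z hz => ?_⟩
  have h := (key z hz).symm.trans (hQz z hz)
  have h' := mul_left_cancel₀ (pow_ne_zero N (ne_zero_of_norm_one hz)) h
  have h'' : 1 - ‖P.eval z‖ ^ 2 = ‖Q.eval z‖ ^ 2 := by exact_mod_cast h'
  linarith

end Circle

/-! ### Quantum signal processing -/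

section SignalProcessing
open Polynomial ComplexConjugate

/-- The special unitary matrix with first row `(a, b)`. -/
def su2 (a b : ℂ) (h : ‖a‖ ^ 2 + ‖b‖ ^ 2 = 1) : Matrix.unitaryGroup Bool ℂ :=
  ⟨Matrix.of fun i j => if i then (if j then conj a else -conj b) else (if j then b else a), by
    have h' : a * conj a + b * conj b = 1 := by
      rw [Complex.mul_conj, Complex.mul_conj, Complex.normSq_eq_norm_sq, Complex.normSq_eq_norm_sq]
      exact_mod_cast h
    rw [Matrix.mem_unitaryGroup_iff]
    ext i j
    rw [Matrix.mul_apply, Fintype.sum_bool]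
    cases i <;> cases j <;> simp [Matrix.star_apply]
    · linear_combination h'
    · ring
    · ring
    · linear_combination h'⟩

theorem unitary_bool_star_mul (g : Matrix.unitaryGroup Bool ℂ) (i j : Bool) :
    conj (g.1 true i) * g.1 true j + conj (g.1 false i) * g.1 false j = if i = j then 1 else 0 := by
  have h := congrFun (congrFun (Matrix.mem_unitaryGroup_iff'.1 g.2) i) j
  rw [Matrix.mul_apply, Fintype.sum_bool, Matrix.one_apply] at h
  exact h

/-- Orthogonal vectors of `ℂ²` are mapped to the two coordinate axes by some unitary. -/
theorem exists_unitary_rows (u w : Bool → ℂ)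
    (h : u false * conj (w false) + u true * conj (w true) = 0) :
    ∃ g : Matrix.unitaryGroup Bool ℂ,
      g.1 false false * u false + g.1 false true * u true = 0 ∧
      g.1 true false * w false + g.1 true true * w true = 0 := by
  have norm_aux : ∀ a b : ℂ, (a ≠ 0 ∨ b ≠ 0) → ∃ r : ℝ, ‖(r : ℂ) * a‖ ^ 2 + ‖(r : ℂ) * b‖ ^ 2 = 1 := by
    intro a b hab
    have hp : 0 < ‖a‖ ^ 2 + ‖b‖ ^ 2 := by
      rcases hab with h | h
      · have := norm_pos_iff.2 h; positivity
      · have := norm_pos_iff.2 h; positivity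
    refine ⟨(Real.sqrt (‖a‖ ^ 2 + ‖b‖ ^ 2))⁻¹, ?_⟩
    rw [norm_mul, norm_mul, Complex.norm_real, mul_pow, mul_pow, ← mul_add, Real.norm_eq_abs, sq_abs,
      inv_pow, Real.sq_sqrt hp.le, inv_mul_cancel₀ hp.ne']
  by_cases hu : u true ≠ 0 ∨ u false ≠ 0
  -- The first row is chosen to annihilate u. The second row of `su2` is then proportional to conj
  -- u, so it annihilates w by orthogonality.
  · obtain ⟨r, hr⟩ := norm_aux (-u true) (u false) (by simpa using hu)
    refine ⟨su2 _ _ hr, ?_, ?_⟩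
    · simp [su2]; ring
    · have h' := congrArg conj h
      simp only [map_add, map_mul, Complex.conj_conj, map_zero] at h'
      simp [su2]; linear_combination (-(r : ℂ)) * h'
  · simp only [not_or, not_not] at hu
    by_cases hw : conj (w true) ≠ 0 ∨ conj (w false) ≠ 0
    · obtain ⟨r, hr⟩ := norm_aux (conj (w false)) (conj (w true)) hw.symm
      refine ⟨su2 _ _ hr, by simp [hu], ?_⟩
      simp [su2]; ring
    · simp only [not_or, not_not, map_eq_zero] at hw
      exact ⟨1, by simp [hu], by simp [hw]⟩

theorem norm_sq_unitary_bool (g : Matrix.unitaryGroup Bool ℂ) (a b : ℂ) :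
    ‖g.1 false false * a + g.1 false true * b‖ ^ 2 + ‖g.1 true false * a + g.1 true true * b‖ ^ 2 =
      ‖a‖ ^ 2 + ‖b‖ ^ 2 := by
  have e : ∀ z : ℂ, ((‖z‖ ^ 2 : ℝ) : ℂ) = z * conj z := fun z => by
    rw [Complex.mul_conj, Complex.normSq_eq_norm_sq]
  have h1 := unitary_bool_star_mul g true true
  have h2 := unitary_bool_star_mul g false false
  have h3 := unitary_bool_star_mul g true false
  have h4 := unitary_bool_star_mul g false true
  simp only [if_true, reduceCtorEq, if_false] at h1 h2 h3 h4
  apply Complex.ofReal_injective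
  rw [Complex.ofReal_add, Complex.ofReal_add, e, e, e, e]
  simp only [map_add, map_mul]
  linear_combination (b * conj b) * h1 + (a * conj a) * h2 + (a * conj b) * h3 + (b * conj a) * h4

variable {H : Type*} [AddCommGroup H] [Module ℂ H]

/-- A single-qubit gate on the signal qubit. -/
def rotPair (g : Matrix.unitaryGroup Bool ℂ) (φ : Bool → H) : Bool → H :=
  fun b => g.1 b false • φ false + g.1 b true • φ true

/-- The walk operator controlled on the signal qubit. -/
def ctrlPair (W : Module.End ℂ H) (φ : Bool → H) : Bool → H := fun b => if b then W (φ b) else φ b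

/-- Alternation of single-qubit gates (`g₀` first, then the list from its end) and controlled
walk operators. -/
def qspPair (W : Module.End ℂ H) (g₀ : Matrix.unitaryGroup Bool ℂ) :
    List (Matrix.unitaryGroup Bool ℂ) → (Bool → H) → (Bool → H)
  | [], φ => rotPair g₀ φ
  | g :: gs, φ => rotPair g (ctrlPair W (qspPair W g₀ gs φ))

/-- The coefficients of lowest and highest degree of a complementary pair are orthogonal. -/
theorem coeff_orthogonal_of_complementary {N : ℕ} {P Q : ℂ[X]} (hP : P.natDegree ≤ N + 1)
    (hQ : Q.natDegree ≤ N + 1) (h : ∀ z : ℂ, ‖z‖ = 1 → ‖P.eval z‖ ^ 2 + ‖Q.eval z‖ ^ 2 = 1) :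
    P.coeff 0 * conj (P.coeff (N + 1)) + Q.coeff 0 * conj (Q.coeff (N + 1)) = 0 := by
  have e : ∀ z : ℂ, ((‖z‖ ^ 2 : ℝ) : ℂ) = z * conj z := fun z => by
    rw [Complex.mul_conj, Complex.normSq_eq_norm_sq]
  have key : P * conjReflect (N + 1) P + Q * conjReflect (N + 1) Q = X ^ (N + 1) := by
    apply eq_of_eval_eq_on_circle
    intro z hz
    rw [eval_add, eval_mul, eval_mul, eval_conjReflect hP (ne_zero_of_norm_one hz),
      eval_conjReflect hQ (ne_zero_of_norm_one hz), conj_inv_of_norm_one hz, eval_pow, eval_X]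
    have h' : P.eval z * conj (P.eval z) + Q.eval z * conj (Q.eval z) = 1 := by
      rw [← e, ← e]; exact_mod_cast h z hz
    linear_combination z ^ (N + 1) * h'
  have h0 := congrArg (fun f => coeff f 0) key
  simpa [mul_coeff_zero, coeff_conjReflect, coeff_X_pow] using h0

/-- **Quantum signal processing**: every complementary pair of polynomials is realized. -/
theorem exists_qspPair (N : ℕ) : ∀ P Q : ℂ[X], P.natDegree ≤ N → Q.natDegree ≤ N →
    (∀ z : ℂ, ‖z‖ = 1 → ‖P.eval z‖ ^ 2 + ‖Q.eval z‖ ^ 2 = 1) →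
    ∃ (g₀ : Matrix.unitaryGroup Bool ℂ) (gs : List (Matrix.unitaryGroup Bool ℂ)), gs.length = N ∧
      ∀ (H : Type) [AddCommGroup H] [Module ℂ H] (W : Module.End ℂ H) (v : H),
        qspPair W g₀ gs (fun b => if b then 0 else v) =
          fun b => if b then aeval W Q v else aeval W P v := by
  induction N with
  | zero =>
    intro P Q hP hQ h
    have hPC := eq_C_of_natDegree_le_zero hP
    have hQC := eq_C_of_natDegree_le_zero hQ
    set p := P.coeff 0
    set r := Q.coeff 0
    have hpr : ‖p‖ ^ 2 + ‖-conj r‖ ^ 2 = 1 := by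
      have := h 1 (by simp)
      rw [hPC, hQC] at this
      simpa using this
    refine ⟨su2 p (-conj r) hpr, [], rfl, fun H _ _ W v => ?_⟩
    funext b
    rw [hPC, hQC]
    cases b <;> simp [qspPair, rotPair, su2, Module.algebraMap_end_apply]
  | succ N ih =>
    intro P Q hP hQ h
    have hcirc := coeff_orthogonal_of_complementary hP hQ h
    -- Because the extreme coefficient vectors are orthogonal, one unitary removes both the top
    -- coefficient of the first polynomial and the constant coefficient of the second. Dividing the
    -- second by X leaves a complementary pair of degree N; a controlled W followed by g⁻¹ reverses
    -- this.
    obtain ⟨g, hg1, hg2⟩ := exists_unitary_rows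
      (fun b => if b then Q.coeff (N + 1) else P.coeff (N + 1))
      (fun b => if b then Q.coeff 0 else P.coeff 0) (by
        have := congrArg conj hcirc
        simpa [mul_comm] using this)
    simp only [if_true, Bool.false_eq_true, if_false] at hg1 hg2
    set P' : ℂ[X] := C (g.1 false false) * P + C (g.1 false true) * Q with hP'
    set Q₁ : ℂ[X] := C (g.1 true false) * P + C (g.1 true true) * Q with hQ₁
    have deg : ∀ a b : ℂ, (C a * P + C b * Q).natDegree ≤ N + 1 := fun a b =>
      (natDegree_add_le _ _).trans (max_le ((natDegree_C_mul_le _ _).trans hP)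
        ((natDegree_C_mul_le _ _).trans hQ))
    have hP'deg : P'.natDegree ≤ N := by
      rw [natDegree_le_iff_coeff_eq_zero]
      intro k hk
      rcases (show N + 1 ≤ k from hk).eq_or_lt with rfl | hk
      · simpa [hP'] using hg1
      · exact coeff_eq_zero_of_natDegree_lt ((deg _ _).trans_lt hk)
    obtain ⟨Q', hQ'⟩ := X_dvd_iff.2 (show Q₁.coeff 0 = 0 by simpa [hQ₁] using hg2)
    have hQ'deg : Q'.natDegree ≤ N := by
      rw [natDegree_le_iff_coeff_eq_zero]
      intro k hk
      have : Q₁.coeff (k + 1) = 0 :=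
        coeff_eq_zero_of_natDegree_lt ((deg _ _).trans_lt (by omega))
      rwa [hQ', coeff_X_mul] at this
    obtain ⟨g₀, gs, hlen, hgs⟩ := ih P' Q' hP'deg hQ'deg fun z hz => by
      have hQz : ‖Q'.eval z‖ = ‖Q₁.eval z‖ := by rw [hQ', eval_mul, eval_X, norm_mul, hz, one_mul]
      rw [hQz, ← h z hz, ← norm_sq_unitary_bool g (P.eval z) (Q.eval z)]
      simp [hP', hQ₁]
    refine ⟨g₀, g⁻¹ :: gs, by simp [hlen], fun H _ _ W v => ?_⟩
    have inv_apply : ∀ i j, (g⁻¹).1 i j = conj (g.1 j i) := fun i j => rfl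
    have h1 : aeval W P' v = g.1 false false • aeval W P v + g.1 false true • aeval W Q v := by
      simp [hP', Module.algebraMap_end_apply]
    have h2 : W (aeval W Q' v) = g.1 true false • aeval W P v + g.1 true true • aeval W Q v := by
      have : aeval W Q₁ v = W (aeval W Q' v) := by rw [hQ', map_mul, aeval_X]; rfl
      rw [← this]
      simp [hQ₁, Module.algebraMap_end_apply]
    have u1 := unitary_bool_star_mul g true true
    have u2 := unitary_bool_star_mul g false false
    have u3 := unitary_bool_star_mul g true false
    have u4 := unitary_bool_star_mul g false true
    simp only [if_true, reduceCtorEq, if_false] at u1 u2 u3 u4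
    funext b
    rw [qspPair, hgs H W v]
    cases b
    · simp only [rotPair, ctrlPair, inv_apply, h1, h2, if_true, Bool.false_eq_true, if_false]
      rw [smul_add, smul_add, smul_smul, smul_smul, smul_smul, smul_smul, add_add_add_comm,
        ← add_smul, ← add_smul, add_comm (conj _ * _), u2, add_comm (conj _ * _), u4, one_smul,
        zero_smul, add_zero]
    · simp only [rotPair, ctrlPair, inv_apply, h1, h2, if_true, Bool.false_eq_true, if_false]
      rw [smul_add, smul_add, smul_smul, smul_smul, smul_smul, smul_smul, add_add_add_comm,
        ← add_smul, ← add_smul, add_comm (conj _ * _), u3, add_comm (conj _ * _), u1, one_smul,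
        zero_smul, zero_add]

end SignalProcessing

/-! ### Trigonometric polynomials concentrated near prescribed values -/

section Filter
open Polynomial

/-- With z = e^{iφ}, cos φ = (z² + 1) / (2z), and the factor z^M clears all denominators. -/
theorem exists_circle_polynomial {M : ℕ} {g : ℝ[X]} (hg : g.natDegree ≤ M) :
    ∃ G : ℂ[X], G.natDegree ≤ 2 * M ∧ ∀ φ : ℝ,
      G.eval (Complex.exp (φ * Complex.I)) =
        Complex.exp (φ * Complex.I) ^ M * (g.eval (Real.cos φ) : ℝ) := by
  refine ⟨∑ k ∈ Finset.range (M + 1),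
    C (g.coeff k : ℂ) * ((C (1 / 2) * (X ^ 2 + 1)) ^ k * X ^ (M - k)), ?_, fun φ => ?_⟩
  · refine natDegree_sum_le_of_forall_le _ _ fun k hk => (natDegree_C_mul_le _ _).trans ?_
    have hk' := Finset.mem_range.1 hk
    refine natDegree_mul_le.trans ?_
    have h1 : ((C (1 / 2 : ℂ) * (X ^ 2 + 1)) ^ k).natDegree ≤ k * 2 :=
      natDegree_pow_le_of_le k ((natDegree_C_mul_le _ _).trans (by compute_degree))
    rw [natDegree_X_pow]
    omega
  · rw [eval_finsetSum, eval_eq_sum_range' (Nat.lt_succ_of_le hg), Complex.ofReal_sum, Finset.mul_sum]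
    refine Finset.sum_congr rfl fun k hk => ?_
    have hk' := Finset.mem_range.1 hk
    have hcos : (1 / 2 : ℂ) * (Complex.exp (φ * Complex.I) ^ 2 + 1) =
        Complex.exp (φ * Complex.I) * Complex.cos φ := by
      rw [Complex.cos, neg_mul, Complex.exp_neg]
      have := Complex.exp_ne_zero (φ * Complex.I)
      field_simp
    simp only [eval_mul, eval_C, eval_pow, eval_add, eval_X, eval_one, hcos, Complex.ofReal_mul,
      Complex.ofReal_pow, Complex.ofReal_cos]
    rw [mul_pow]
    have : Complex.exp (φ * Complex.I) ^ M =
        Complex.exp (φ * Complex.I) ^ k * Complex.exp (φ * Complex.I) ^ (M - k) := by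
      rw [← pow_add]; congr 1; omega
    rw [this]
    ring

/-- The `y`-th of `2M+1` equidistant angles. -/
noncomputable def nodeAngle (M y : ℕ) : ℝ := 2 * Real.pi * y / (2 * M + 1)

/-- A geometric sum over powers of a (2M+1)-th root of unity, which differs from 1 because 0 < |k| <
2M+1. -/
theorem sum_exp_node {M : ℕ} {k : ℤ} (hk : |k| ≤ M) (hk0 : k ≠ 0) :
    ∑ y ∈ Finset.range (2 * M + 1),
      Complex.exp (((k * nodeAngle M y : ℝ) : ℂ) * Complex.I) = 0 := by
  set η := Complex.exp (((k * nodeAngle M 1 : ℝ) : ℂ) * Complex.I) with hη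
  have hN : (2 * (M : ℂ) + 1) ≠ 0 := by exact_mod_cast (by omega : 2 * M + 1 ≠ 0)
  have h1 : ∀ y : ℕ, Complex.exp (((k * nodeAngle M y : ℝ) : ℂ) * Complex.I) = η ^ y := fun y => by
    rw [hη, ← Complex.exp_nat_mul]
    congr 1
    simp only [nodeAngle]
    push_cast
    field_simp
  have h2 : η ^ (2 * M + 1) = 1 := by
    rw [hη, ← Complex.exp_nat_mul, Complex.exp_eq_one_iff]
    refine ⟨k, ?_⟩
    simp only [nodeAngle]
    push_cast
    field_simp
  have h3 : η ≠ 1 := by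
    intro h
    rw [hη, Complex.exp_eq_one_iff] at h
    obtain ⟨m, hm⟩ := h
    have hpi : (2 * Real.pi * Complex.I : ℂ) ≠ 0 := Complex.two_pi_I_ne_zero
    have h4 : (k : ℂ) = m * (2 * M + 1) := by
      have h5 : ((k * nodeAngle M 1 : ℝ) : ℂ) * Complex.I =
          (k : ℂ) / (2 * M + 1) * (2 * Real.pi * Complex.I) := by
        simp only [nodeAngle]
        push_cast
        field_simp
      rw [h5] at hm
      have := mul_right_cancel₀ hpi hm
      rw [← this]
      field_simp
    have h6 : k = m * (2 * M + 1) := by exact_mod_cast h4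
    have hm0 : m ≠ 0 := by rintro rfl; simp at h6; exact hk0 h6
    have h7 : 1 ≤ |m| := Int.one_le_abs hm0
    have h8 : |k| = |m| * (2 * M + 1) := by rw [h6, abs_mul, abs_of_nonneg (by positivity : (0:ℤ) ≤ 2 * M + 1)]
    nlinarith
  rw [Finset.sum_congr rfl fun y _ => h1 y]
  have := mul_geom_sum η (2 * M + 1)
  rw [h2, sub_self] at this
  exact (mul_eq_zero.1 this).resolve_left (sub_ne_zero.2 h3)

/-- Summation over 2M+1 equidistant translates removes every frequency between -M and M except 0.
The translates of the kernel can therefore be normalized to a partition of unity by a constant, and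
they remain trigonometric polynomials. -/
theorem sum_kernel_const {M : ℕ} {g : ℝ[X]} (hg : g.natDegree ≤ M) (θ θ' : ℝ) :
    ∑ y ∈ Finset.range (2 * M + 1), g.eval (Real.cos (θ - nodeAngle M y)) =
      ∑ y ∈ Finset.range (2 * M + 1), g.eval (Real.cos (θ' - nodeAngle M y)) := by
  obtain ⟨G, hG, hGe⟩ := exists_circle_polynomial hg
  suffices key : ∀ θ : ℝ, ((∑ y ∈ Finset.range (2 * M + 1),
      g.eval (Real.cos (θ - nodeAngle M y)) : ℝ) : ℂ) = (2 * M + 1) * G.coeff M from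
    Complex.ofReal_injective ((key θ).trans (key θ').symm)
  intro θ
  have h1 : ∀ φ : ℝ, ((g.eval (Real.cos φ) : ℝ) : ℂ) = ∑ j ∈ Finset.range (2 * M + 1),
      G.coeff j * Complex.exp (((((j : ℤ) - M : ℤ) * φ : ℝ) : ℂ) * Complex.I) := fun φ => by
    have h2 : ((g.eval (Real.cos φ) : ℝ) : ℂ) = Complex.exp (-(M * (φ * Complex.I))) *
        G.eval (Complex.exp (φ * Complex.I)) := by
      rw [hGe, ← Complex.exp_nat_mul, ← mul_assoc, ← Complex.exp_add, neg_add_cancel, Complex.exp_zero,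
        one_mul]
    rw [h2, eval_eq_sum_range' (Nat.lt_succ_of_le hG), Finset.mul_sum]
    refine Finset.sum_congr rfl fun j _ => ?_
    rw [mul_left_comm, ← Complex.exp_nat_mul, ← Complex.exp_add]
    congr 2
    push_cast
    ring
  rw [Complex.ofReal_sum, Finset.sum_congr rfl fun y _ => h1 _, Finset.sum_comm,
    Finset.sum_eq_single_of_mem M (by simp; omega)]
  · simp
  · intro j hj hjM
    have hj' := Finset.mem_range.1 hj
    have h3 : ∀ y : ℕ, G.coeff j * Complex.exp (((((j : ℤ) - M : ℤ) * (θ - nodeAngle M y) : ℝ) : ℂ) *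
        Complex.I) = G.coeff j * Complex.exp (((((j : ℤ) - M : ℤ) * θ : ℝ) : ℂ) * Complex.I) *
        Complex.exp ((((M - (j : ℤ) : ℤ) * nodeAngle M y : ℝ) : ℂ) * Complex.I) := fun y => by
      rw [mul_assoc, ← Complex.exp_add]
      congr 2
      push_cast
      ring
    rw [Finset.sum_congr rfl fun y _ => h3 y, ← Finset.mul_sum, sum_exp_node (abs_le.2 (by omega)) (by omega), mul_zero]

theorem cos_sub_cos_sq_le (a b : ℝ) : (Real.cos a - Real.cos b) ^ 2 ≤ 2 * (1 - Real.cos (a - b)) := by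
  rw [Real.cos_sub]
  nlinarith [Real.sin_sq_add_cos_sq a, Real.sin_sq_add_cos_sq b, sq_nonneg (Real.sin a - Real.sin b)]

/-- The concentrated kernel as a polynomial in the cosine. -/
noncomputable def chebKernel (M : ℕ) (b : ℝ) : ℝ[X] :=
  C (1 / 2) * ((Chebyshev.T ℝ M).comp (C b * (1 + X) - 1) + 1)

theorem natDegree_chebKernel_le (M : ℕ) (b : ℝ) : (chebKernel M b).natDegree ≤ M := by
  refine (natDegree_C_mul_le _ _).trans ((natDegree_add_le _ _).trans (max_le ?_ (by simp)))
  refine natDegree_comp_le.trans ?_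
  have h1 : (C b * (1 + X) - 1 : ℝ[X]).natDegree ≤ 1 := by compute_degree
  have h2 : (Chebyshev.T ℝ M).natDegree ≤ M := by
    simp [Chebyshev.natDegree_T]
  calc _ ≤ M * 1 := Nat.mul_le_mul h2 h1
    _ = M := mul_one M

theorem eval_chebKernel (M : ℕ) (b x : ℝ) :
    (chebKernel M b).eval x = ((Chebyshev.T ℝ M).eval (b * (1 + x) - 1) + 1) / 2 := by
  simp [chebKernel, eval_comp]
  ring

/-- On [-1, 1] the Chebyshev polynomial is at least -1, and beyond 1 it is a hyperbolic cosine. The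
summand 1 in the kernel compensates for the first case. -/
theorem chebKernel_nonneg {M : ℕ} {b x : ℝ} (hb : 0 ≤ b) (hx : -1 ≤ x) :
    0 ≤ (chebKernel M b).eval x := by
  rw [eval_chebKernel]
  have h0 : -1 ≤ b * (1 + x) - 1 := by nlinarith
  rcases le_total (b * (1 + x) - 1) 1 with h | h
  · have := neg_le_of_abs_le (Chebyshev.abs_eval_T_real_le_one M (abs_le.2 ⟨h0, h⟩))
    linarith
  · obtain ⟨s, hs⟩ : ∃ s, Real.cosh s = b * (1 + x) - 1 := ⟨Real.arcosh _, Real.cosh_arcosh h⟩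
    rw [← hs, Chebyshev.T_real_cosh]
    have := Real.cosh_pos ((M : ℤ) * s)
    positivity

theorem chebKernel_le_one {M : ℕ} {b x : ℝ} (hb : 0 ≤ b) (hx : -1 ≤ x) (hbx : b * (1 + x) ≤ 2) :
    (chebKernel M b).eval x ≤ 1 := by
  rw [eval_chebKernel]
  have := le_of_abs_le (Chebyshev.abs_eval_T_real_le_one M
    (abs_le.2 ⟨by nlinarith, by linarith⟩ : |b * (1 + x) - 1| ≤ 1))
  linarith

theorem cosh_sub_one_le {t : ℝ} (h0 : 0 ≤ t) (h1 : t ≤ 1) : Real.cosh t - 1 ≤ t ^ 2 := by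
  have h2 := Real.cosh_le_exp_half_sq t
  have h3 := Real.abs_exp_sub_one_le (x := t ^ 2 / 2) (by rw [abs_of_nonneg (by positivity)]; nlinarith)
  rw [abs_of_nonneg (by positivity : 0 ≤ t ^ 2 / 2)] at h3
  have := le_of_abs_le h3
  linarith

/-- The function p is 1 - δ times an average of values of K at the cosines of the nodes, weighted by
the kernel centred at θ. Nodes whose cosine is farther than ε from cos θ have total weight at most
δ. They shift the average by at most 2δ, and the factor 1 - δ, which leaves room for a complementary
polynomial, by at most δ. K may be discontinuous. -/
theorem exists_filter_polynomial {K : ℝ → ℝ} (hK : ∀ x, |K x| ≤ 1) {ε δ : ℝ} (hε : 0 < ε)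
    (hε1 : ε ≤ 1) (hδ : 0 < δ) (hδ1 : δ < 1) {M : ℕ}
    (hM : 4 * (2 * M + 1) * Real.exp (-(M * (ε / 2))) ≤ δ) :
    ∃ (P : ℂ[X]) (p : ℝ → ℝ), P.natDegree ≤ 2 * M ∧
      (∀ θ : ℝ, P.eval (Complex.exp (θ * Complex.I)) = Complex.exp (θ * Complex.I) ^ M * (p θ : ℂ)) ∧
      (∀ θ, |p θ| ≤ 1 - δ) ∧
      ∀ θ lo hi : ℝ, -1 ≤ lo → hi ≤ 1 →
        (∀ x ∈ Set.Icc (-1 : ℝ) 1, |x - Real.cos θ| ≤ ε → lo ≤ K x ∧ K x ≤ hi) →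
        lo - 3 * δ ≤ p θ ∧ p θ ≤ hi + 3 * δ := by
  -- With this b the argument of the Chebyshev polynomial is cosh(ε/2) at the peak, where its value
  -- is cosh(Mε/2).
  set b : ℝ := (1 + Real.cosh (ε / 2)) / 2 with hb
  have hb1 : 1 ≤ b := by have := Real.one_le_cosh (ε / 2); linarith
  have hb2 : b - 1 ≤ ε ^ 2 / 8 := by
    have := cosh_sub_one_le (t := ε / 2) (by positivity) (by linarith)
    rw [hb]; nlinarith
  have hb0 : 0 ≤ b := by linarith
  set g := chebKernel M b
  have hg : g.natDegree ≤ M := natDegree_chebKernel_le M b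
  set N := Finset.range (2 * M + 1)
  set S : ℝ := ∑ y ∈ N, g.eval (Real.cos (0 - nodeAngle M y)) with hS
  have hsum : ∀ θ, ∑ y ∈ N, g.eval (Real.cos (θ - nodeAngle M y)) = S :=
    fun θ => sum_kernel_const hg θ 0
  have hpos : ∀ φ, 0 ≤ g.eval (Real.cos φ) := fun φ => chebKernel_nonneg hb0 (Real.neg_one_le_cos φ)
  have hSbig : Real.exp (M * (ε / 2)) / 4 ≤ S := by
    have h0 : g.eval (Real.cos (0 - nodeAngle M 0)) ≤ S :=
      Finset.single_le_sum (f := fun y => g.eval (Real.cos (0 - nodeAngle M y)))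
        (fun y _ => hpos _) (by simp [N])
    refine le_trans ?_ h0
    have h1 : nodeAngle M 0 = 0 := by simp [nodeAngle]
    rw [h1, sub_zero, Real.cos_zero, eval_chebKernel,
      show b * (1 + 1) - 1 = Real.cosh (ε / 2) by rw [hb]; ring, Chebyshev.T_real_cosh]
    rw [Real.cosh_eq]
    have h2 := Real.exp_pos (-(((M : ℤ) : ℝ) * (ε / 2)))
    push_cast at h2 ⊢
    linarith
  have hS0 : 0 < S := lt_of_lt_of_le (by positivity) hSbig
  obtain ⟨G, hG, hGe⟩ := exists_circle_polynomial hg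
  set w : ℝ → ℕ → ℝ := fun θ y => g.eval (Real.cos (θ - nodeAngle M y)) / S with hw
  have hw0 : ∀ θ y, 0 ≤ w θ y := fun θ y => div_nonneg (hpos _) hS0.le
  have hw1 : ∀ θ, ∑ y ∈ N, w θ y = 1 := fun θ => by
    rw [hw, ← Finset.sum_div, hsum, div_self hS0.ne']
  set k : ℕ → ℝ := fun y => K (Real.cos (nodeAngle M y)) with hk
  have hk1 : ∀ y, -1 ≤ k y ∧ k y ≤ 1 := fun y => abs_le.1 (hK _)
  have havg : ∀ θ, |∑ y ∈ N, w θ y * k y| ≤ 1 := fun θ => by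
    rw [← hw1 θ]
    refine (Finset.abs_sum_le_sum_abs _ _).trans (Finset.sum_le_sum fun y _ => ?_)
    rw [abs_mul, abs_of_nonneg (hw0 θ y)]
    exact mul_le_of_le_one_right (hw0 θ y) (hK _)
  refine ⟨∑ y ∈ N, C (((1 - δ) * k y / S : ℝ) *
      Complex.exp ((nodeAngle M y : ℝ) * Complex.I) ^ M) *
      G.comp (C (Complex.exp (-((nodeAngle M y : ℝ) * Complex.I))) * X),
    fun θ => (1 - δ) * ∑ y ∈ N, w θ y * k y, ?_, fun θ => ?_, fun θ => ?_, ?_⟩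
  · refine natDegree_sum_le_of_forall_le _ _ fun y _ => (natDegree_C_mul_le _ _).trans
      (natDegree_comp_le.trans ?_)
    calc _ ≤ 2 * M * 1 := Nat.mul_le_mul hG ((natDegree_C_mul_le _ _).trans natDegree_X_le)
      _ = 2 * M := mul_one _
  · rw [eval_finsetSum, Complex.ofReal_mul, Complex.ofReal_sum, Finset.mul_sum, Finset.mul_sum]
    refine Finset.sum_congr rfl fun y _ => ?_
    rw [eval_mul, eval_C, eval_comp, eval_mul, eval_C, eval_X, ← Complex.exp_add,
      show -((nodeAngle M y : ℂ) * Complex.I) + θ * Complex.I =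
        ((θ - nodeAngle M y : ℝ) : ℂ) * Complex.I by push_cast; ring, hGe,
      show Complex.exp (θ * Complex.I) ^ M = Complex.exp ((nodeAngle M y : ℝ) * Complex.I) ^ M *
        Complex.exp (((θ - nodeAngle M y : ℝ) : ℂ) * Complex.I) ^ M by
        rw [← mul_pow, ← Complex.exp_add]; congr 2; push_cast; ring]
    simp only [hw]
    push_cast
    ring
  · rw [abs_mul, abs_of_pos (by linarith)]
    exact mul_le_of_le_one_right (by linarith) (havg θ)
  · intro θ lo hi hlo hhi hbd
    have hbad : ∀ y, ¬ |Real.cos (nodeAngle M y) - Real.cos θ| ≤ ε → w θ y ≤ 1 / S := by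
      intro y hy
      rw [hw]
      refine div_le_div_of_nonneg_right (chebKernel_le_one hb0 (Real.neg_one_le_cos _) ?_) hS0.le
      -- If the Chebyshev argument exceeded 1, then 1 - cos(θ - node) < 2(b - 1) ≤ ε²/4, and the two
      -- cosines would differ by less than ε.
      by_contra! hcon
      apply hy
      have h1 := cos_sub_cos_sq_le θ (nodeAngle M y)
      have h2 := Real.cos_le_one (θ - nodeAngle M y)
      set cc := Real.cos (θ - nodeAngle M y)
      refine abs_le_of_sq_le_sq ?_ hε.le
      have h3 : (b - 1) * (1 + cc) ≤ (b - 1) * 2 :=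
        mul_le_mul_of_nonneg_left (by linarith) (by linarith)
      nlinarith
    set β : ℝ := ∑ y ∈ N, if |Real.cos (nodeAngle M y) - Real.cos θ| ≤ ε then 0 else w θ y with hβ
    have hβδ : β ≤ δ := by
      have h1 : β ≤ ∑ y ∈ N, 1 / S := Finset.sum_le_sum fun y _ => by
        split_ifs with h
        · positivity
        · exact hbad y h
      rw [Finset.sum_const, Finset.card_range, nsmul_eq_mul] at h1
      refine h1.trans (le_trans ?_ hM)
      rw [mul_one_div, div_le_iff₀ hS0, Real.exp_neg]
      have hE := Real.exp_pos (M * (ε / 2))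
      calc ((2 * M + 1 : ℕ) : ℝ) = 4 * (2 * M + 1) * (Real.exp (M * (ε / 2)))⁻¹ *
            (Real.exp (M * (ε / 2)) / 4) := by push_cast; field_simp
        _ ≤ _ := by gcongr
    have hβ0 : 0 ≤ β := Finset.sum_nonneg fun y _ => by
      split_ifs
      · exact le_rfl
      · exact hw0 θ y
    have hsumle : ∑ y ∈ N, w θ y * k y ≤ hi + β * (1 - hi) := by
      have : ∀ y ∈ N, w θ y * k y ≤ w θ y * hi +
          (if |Real.cos (nodeAngle M y) - Real.cos θ| ≤ ε then 0 else w θ y) * (1 - hi) := by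
        intro y _
        split_ifs with h
        · have := (hbd _ ⟨Real.neg_one_le_cos _, Real.cos_le_one _⟩ h).2
          rw [zero_mul, add_zero]
          exact mul_le_mul_of_nonneg_left this (hw0 θ y)
        · have := mul_le_mul_of_nonneg_left (hk1 y).2 (hw0 θ y)
          linarith
      refine (Finset.sum_le_sum this).trans (le_of_eq ?_)
      rw [Finset.sum_add_distrib, ← Finset.sum_mul, ← Finset.sum_mul, hw1, one_mul]
    have hsumge : lo - β * (1 + lo) ≤ ∑ y ∈ N, w θ y * k y := by
      have : ∀ y ∈ N, w θ y * lo -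
          (if |Real.cos (nodeAngle M y) - Real.cos θ| ≤ ε then 0 else w θ y) * (1 + lo) ≤
          w θ y * k y := by
        intro y _
        split_ifs with h
        · have := (hbd _ ⟨Real.neg_one_le_cos _, Real.cos_le_one _⟩ h).1
          rw [zero_mul, sub_zero]
          exact mul_le_mul_of_nonneg_left this (hw0 θ y)
        · have := mul_le_mul_of_nonneg_left (hk1 y).1 (hw0 θ y)
          linarith
      refine (le_of_eq ?_).trans (Finset.sum_le_sum this)
      rw [Finset.sum_sub_distrib, ← Finset.sum_mul, ← Finset.sum_mul, hw1, one_mul]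
    have hlohi : lo ≤ hi := (hbd _ ⟨Real.neg_one_le_cos θ, Real.cos_le_one θ⟩ (by simpa using hε.le)).1.trans
      (hbd _ ⟨Real.neg_one_le_cos θ, Real.cos_le_one θ⟩ (by simpa using hε.le)).2
    have ha := abs_le.1 (havg θ)
    set s := ∑ y ∈ N, w θ y * k y
    have h1 : β * (1 - hi) ≤ 2 * δ := by nlinarith
    have h2 : β * (1 + lo) ≤ 2 * δ := by nlinarith
    constructor
    · show lo - 3 * δ ≤ (1 - δ) * s
      nlinarith
    · show (1 - δ) * s ≤ hi + 3 * δ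
      nlinarith

/-- A degree that suffices for the concentration needed in `exists_filter_polynomial`. -/
theorem exists_filter_degree {ε δ : ℝ} (hε : 0 < ε) (hε1 : ε ≤ 1) (hδ : 0 < δ) (hδ1 : δ ≤ 1) :
    ∃ M : ℕ, 4 * (2 * M + 1) * Real.exp (-(M * (ε / 2))) ≤ δ ∧
      (M : ℝ) ≤ 4 / ε * Real.log (48 / (ε * δ)) + 1 := by
  have harg : 1 < 48 / (ε * δ) := by
    rw [lt_div_iff₀ (by positivity)]; nlinarith
  have hlog : 0 < Real.log (48 / (ε * δ)) := Real.log_pos harg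
  refine ⟨⌈4 / ε * Real.log (48 / (ε * δ))⌉₊, ?_, (Nat.ceil_lt_add_one (by positivity)).le⟩
  set M := ⌈4 / ε * Real.log (48 / (ε * δ))⌉₊
  have hM : 4 / ε * Real.log (48 / (ε * δ)) ≤ M := Nat.le_ceil _
  have hM1 : (1 : ℝ) ≤ M := by
    have : 0 < M := Nat.ceil_pos.2 (by positivity)
    exact_mod_cast this
  -- The decay is e^{-2x}: one factor e^{-x} absorbs M = 4x/ε, the other is at most εδ/48. Here 48 =
  -- 4 · 3 · 4, using 2M + 1 ≤ 3M.
  set x : ℝ := M * ε / 4 with hx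
  have hx1 : Real.log (48 / (ε * δ)) ≤ x := by
    rw [div_mul_eq_mul_div, div_le_iff₀ hε] at hM
    rw [hx]; linarith
  have hE := Real.exp_pos x
  have h1 : 48 / (ε * δ) ≤ Real.exp x := by
    rw [← Real.exp_log (by linarith : 0 < 48 / (ε * δ))]
    exact Real.exp_le_exp.2 hx1
  have h2 : x ≤ Real.exp x := by have := Real.add_one_le_exp x; linarith
  have h3 : Real.exp (-(M * (ε / 2))) = (Real.exp x)⁻¹ * (Real.exp x)⁻¹ := by
    rw [← Real.exp_neg, ← Real.exp_add]; congr 1; rw [hx]; ring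
  have hMx : (M : ℝ) = 4 / ε * x := by rw [hx]; field_simp
  have h4 : 48 ≤ Real.exp x * (ε * δ) := (div_le_iff₀ (by positivity)).1 h1
  rw [h3]
  have h5 : 4 * (2 * (M : ℝ) + 1) ≤ 12 * (4 / ε * Real.exp x) := by
    rw [hMx] at hM1 ⊢
    have : 4 / ε * x ≤ 4 / ε * Real.exp x := by gcongr
    linarith
  calc 4 * (2 * (M : ℝ) + 1) * ((Real.exp x)⁻¹ * (Real.exp x)⁻¹)
      ≤ 12 * (4 / ε * Real.exp x) * ((Real.exp x)⁻¹ * (Real.exp x)⁻¹) := by gcongr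
    _ = 48 / (ε * Real.exp x) := by field_simp; norm_num
    _ ≤ δ := by rw [div_le_iff₀ (by positivity)]; linarith

end Filter

/-! ### Dual activations -/

section DualActivation

/-- Independent Gaussians of variances ρ² and 1 - ρ² add up to a standard one. -/
theorem measurePreserving_correlated {ρ : ℝ} (hρ : ρ ∈ Set.Icc (-1 : ℝ) 1) :
    MeasurePreserving (fun w : ℝ × ℝ => ρ * w.1 + Real.sqrt (1 - ρ ^ 2) * w.2)
      ((gaussianReal 0 1).prod (gaussianReal 0 1)) (gaussianReal 0 1) := by
  refine ⟨by fun_prop, ?_⟩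
  have h1 : 0 ≤ 1 - ρ ^ 2 := by nlinarith [hρ.1, hρ.2]
  have h2 := gaussianReal_conv_gaussianReal (m₁ := 0) (m₂ := 0) (v₁ := NNReal.mk (ρ ^ 2) (sq_nonneg ρ) * 1)
    (v₂ := NNReal.mk (Real.sqrt (1 - ρ ^ 2) ^ 2) (sq_nonneg _) * 1)
  have h3 := gaussianReal_map_const_mul (μ := 0) (v := 1) ρ
  have h4 := gaussianReal_map_const_mul (μ := 0) (v := 1) (Real.sqrt (1 - ρ ^ 2))
  rw [mul_zero] at h3 h4
  have h5 : NNReal.mk (ρ ^ 2) (sq_nonneg ρ) * 1 +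
      NNReal.mk (Real.sqrt (1 - ρ ^ 2) ^ 2) (sq_nonneg _) * 1 = 1 := by
    apply NNReal.eq
    simp [Real.sq_sqrt h1]
  rw [h5, add_zero, ← h3, ← h4, Measure.conv, Measure.map_prod_map _ _ (by fun_prop) (by fun_prop),
    Measure.map_map (by fun_prop) (by fun_prop)] at h2
  exact h2

theorem measurePreserving_first :
    MeasurePreserving (fun w : ℝ × ℝ => w.1)
      ((gaussianReal 0 1).prod (gaussianReal 0 1)) (gaussianReal 0 1) := measurePreserving_fst

variable {f g : ℝ → ℝ} {ρ : ℝ}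

theorem integrable_mul_correlated (hf : MemLp f 2 (gaussianReal 0 1)) (hg : MemLp g 2 (gaussianReal 0 1))
    (hρ : ρ ∈ Set.Icc (-1 : ℝ) 1) :
    Integrable (fun w : ℝ × ℝ => f w.1 * g (ρ * w.1 + Real.sqrt (1 - ρ ^ 2) * w.2))
      ((gaussianReal 0 1).prod (gaussianReal 0 1)) :=
  (hf.comp_measurePreserving measurePreserving_first).integrable_mul
    (hg.comp_measurePreserving (measurePreserving_correlated hρ))

/-- The inequality |fg| ≤ (η⁻¹ f² + η g²) / 2, integrated with both marginals standard normal. The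
free η plays the part of Cauchy–Schwarz: it is chosen later as a bound for the L² norm of the small
factor. -/
theorem abs_integral_mul_correlated_le (hf : MemLp f 2 (gaussianReal 0 1))
    (hg : MemLp g 2 (gaussianReal 0 1)) (hρ : ρ ∈ Set.Icc (-1 : ℝ) 1) {η : ℝ} (hη : 0 < η) :
    |∫ w : ℝ × ℝ, f w.1 * g (ρ * w.1 + Real.sqrt (1 - ρ ^ 2) * w.2)
      ∂((gaussianReal 0 1).prod (gaussianReal 0 1))| ≤
      (η⁻¹ * ∫ u, f u ^ 2 ∂(gaussianReal 0 1) + η * ∫ u, g u ^ 2 ∂(gaussianReal 0 1)) / 2 := by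
  have mf := measurePreserving_first
  have mg := measurePreserving_correlated hρ
  have e1 : ∫ w : ℝ × ℝ, f w.1 ^ 2 ∂((gaussianReal 0 1).prod (gaussianReal 0 1)) =
      ∫ u, f u ^ 2 ∂(gaussianReal 0 1) := by
    rw [← mf.map_eq, integral_map mf.measurable.aemeasurable
      (by rw [mf.map_eq]; exact hf.1.pow 2), mf.map_eq]
  have e2 : ∫ w : ℝ × ℝ, g (ρ * w.1 + Real.sqrt (1 - ρ ^ 2) * w.2) ^ 2
      ∂((gaussianReal 0 1).prod (gaussianReal 0 1)) = ∫ u, g u ^ 2 ∂(gaussianReal 0 1) := by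
    have := integral_map (f := fun u => g u ^ 2) mg.measurable.aemeasurable
      (by rw [mg.map_eq]; exact hg.1.pow 2)
    rw [mg.map_eq] at this
    exact this.symm
  have i1 : Integrable (fun w : ℝ × ℝ => f w.1 ^ 2) _ := (hf.comp_measurePreserving mf).integrable_sq
  have i2 : Integrable (fun w : ℝ × ℝ => g (ρ * w.1 + Real.sqrt (1 - ρ ^ 2) * w.2) ^ 2) _ :=
    (hg.comp_measurePreserving mg).integrable_sq
  rw [← e1, ← e2, ← integral_const_mul, ← integral_const_mul,
    ← integral_add (i1.const_mul _) (i2.const_mul _), ← integral_div]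
  refine (abs_integral_le_integral_abs).trans (integral_mono (integrable_mul_correlated hf hg hρ).abs
    (((i1.const_mul _).add (i2.const_mul _)).div_const 2) fun w => ?_)
  simp only [abs_mul]
  set a := f w.1
  set b := g (ρ * w.1 + Real.sqrt (1 - ρ ^ 2) * w.2)
  have h1 : 0 ≤ η⁻¹ * (|a| - η * |b|) ^ 2 := by positivity
  have h2 : η⁻¹ * (|a| - η * |b|) ^ 2 = η⁻¹ * a ^ 2 + η * b ^ 2 - 2 * (|a| * |b|) := by
    rw [← sq_abs a, ← sq_abs b]; field_simp; ring
  linarith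

theorem abs_dualActivation_le (hf : MemLp f 2 (gaussianReal 0 1)) (hρ : ρ ∈ Set.Icc (-1 : ℝ) 1) :
    |dualActivation f ρ| ≤ ∫ u, f u ^ 2 ∂(gaussianReal 0 1) := by
  have := abs_integral_mul_correlated_le hf hf hρ one_pos
  rw [inv_one, one_mul, ← two_mul, mul_div_cancel_left₀ _ two_ne_zero] at this
  exact this

theorem continuous_dualActivation_of_bounded (g : BoundedContinuousFunction ℝ ℝ) :
    Continuous (dualActivation g) := by
  refine continuous_of_dominated (bound := fun _ => ‖g‖ * ‖g‖) (fun ρ => ?_) (fun ρ => ?_)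
    (integrable_const _) (ae_of_all _ fun w => ?_)
  · exact (by fun_prop : Continuous fun w : ℝ × ℝ =>
      g w.1 * g (ρ * w.1 + Real.sqrt (1 - ρ ^ 2) * w.2)).aestronglyMeasurable
  · refine ae_of_all _ fun w => ?_
    rw [norm_mul]
    exact mul_le_mul (g.norm_coe_le_norm _) (g.norm_coe_le_norm _) (norm_nonneg _) (norm_nonneg _)
  · fun_prop

/-- The difference splits into the correlation of f - g with f and that of g with f - g. The bound
does not depend on ρ, so L² approximation gives uniform approximation. -/
theorem abs_dualActivation_sub_le (hf : MemLp f 2 (gaussianReal 0 1))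
    (hg : MemLp g 2 (gaussianReal 0 1)) (hρ : ρ ∈ Set.Icc (-1 : ℝ) 1) {η : ℝ} (hη : 0 < η)
    (hfg : ∫ u, (f u - g u) ^ 2 ∂(gaussianReal 0 1) ≤ η ^ 2) :
    |dualActivation f ρ - dualActivation g ρ| ≤
      η * (1 + (∫ u, f u ^ 2 ∂(gaussianReal 0 1)) + η ^ 2 +
        ∫ u, f u ^ 2 ∂(gaussianReal 0 1)) := by
  have hs : MemLp (f - g) 2 (gaussianReal 0 1) := hf.sub hg
  have hs2 : Integrable (fun u => (f u - g u) ^ 2) (gaussianReal 0 1) := hs.integrable_sq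
  set F := ∫ u, f u ^ 2 ∂(gaussianReal 0 1)
  have hF : 0 ≤ F := integral_nonneg fun u => sq_nonneg _
  have hG : ∫ u, g u ^ 2 ∂(gaussianReal 0 1) ≤ 2 * F + 2 * η ^ 2 := by
    calc ∫ u, g u ^ 2 ∂(gaussianReal 0 1) ≤ ∫ u, (2 * f u ^ 2 + 2 * (f u - g u) ^ 2) ∂(gaussianReal 0 1) := by
          refine integral_mono hg.integrable_sq ((hf.integrable_sq.const_mul 2).add
            (hs2.const_mul 2)) fun u => ?_
          show g u ^ 2 ≤ 2 * f u ^ 2 + 2 * (f u - g u) ^ 2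
          nlinarith [sq_nonneg (2 * f u - g u)]
      _ = 2 * F + 2 * ∫ u, (f u - g u) ^ 2 ∂(gaussianReal 0 1) := by
          rw [integral_add (hf.integrable_sq.const_mul 2) (hs2.const_mul 2),
            integral_const_mul, integral_const_mul]
      _ ≤ _ := by linarith
  have e : dualActivation f ρ - dualActivation g ρ =
      (∫ w : ℝ × ℝ, (f - g) w.1 * f (ρ * w.1 + Real.sqrt (1 - ρ ^ 2) * w.2)
        ∂((gaussianReal 0 1).prod (gaussianReal 0 1))) +
      ∫ w : ℝ × ℝ, g w.1 * (f - g) (ρ * w.1 + Real.sqrt (1 - ρ ^ 2) * w.2)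
        ∂((gaussianReal 0 1).prod (gaussianReal 0 1)) := by
    rw [dualActivation, dualActivation, ← integral_sub (integrable_mul_correlated hf hf hρ)
      (integrable_mul_correlated hg hg hρ), ← integral_add (integrable_mul_correlated hs hf hρ)
      (integrable_mul_correlated hg hs hρ)]
    refine integral_congr_ae (ae_of_all _ fun w => ?_)
    simp only [Pi.sub_apply]
    ring
  have b1 := abs_integral_mul_correlated_le hs hf hρ hη
  have b2 := abs_integral_mul_correlated_le hg hs hρ (inv_pos.2 hη)
  rw [inv_inv] at b2
  simp only [Pi.sub_apply] at b1 b2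
  have h1 : η⁻¹ * ∫ u, (f u - g u) ^ 2 ∂(gaussianReal 0 1) ≤ η := by
    rw [inv_mul_le_iff₀ hη]; linarith [sq η]
  have h2 : η * ∫ u, g u ^ 2 ∂(gaussianReal 0 1) ≤ η * (2 * F + 2 * η ^ 2) :=
    mul_le_mul_of_nonneg_left hG hη.le
  rw [e]
  simp only [Pi.sub_apply]
  refine (abs_add_le _ _).trans ((add_le_add b1 b2).trans ?_)
  nlinarith [mul_nonneg hη.le hF]

/-- Bounded continuous functions are dense in L², their dual activations are continuous by dominated
convergence, and the approximation is uniform in ρ. Square integrability is all that is available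
for the derivative of the activation. -/
theorem continuousOn_dualActivation (hf : MemLp f 2 (gaussianReal 0 1)) :
    ContinuousOn (dualActivation f) (Set.Icc (-1) 1) := by
  refine continuousOn_of_uniform_approx_of_continuousOn fun V hV => ?_
  obtain ⟨e, he, hVe⟩ := Metric.mem_uniformity_dist.1 hV
  suffices h : ∃ F, ContinuousOn F (Set.Icc (-1) 1) ∧
      ∀ ρ ∈ Set.Icc (-1 : ℝ) 1, dist (dualActivation f ρ) (F ρ) < e from
    h.imp fun F hF => ⟨hF.1, fun ρ hρ => hVe (hF.2 ρ hρ)⟩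
  set F := ∫ u, f u ^ 2 ∂(gaussianReal 0 1)
  have hF : 0 ≤ F := integral_nonneg fun u => sq_nonneg _
  set η : ℝ := min 1 (e / (2 * (2 + 2 * F)))
  have hη : 0 < η := lt_min one_pos (by positivity)
  obtain ⟨g, hg, hgm⟩ := hf.exists_boundedContinuous_eLpNorm_sub_le (by norm_num)
    (ε := ENNReal.ofReal η) (by simpa using hη)
  have hfg : ∫ u, (f u - g u) ^ 2 ∂(gaussianReal 0 1) ≤ η ^ 2 := by
    have h1 := (hf.sub hgm).eLpNorm_eq_integral_rpow_norm (by norm_num) (by norm_num)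
    rw [h1, ENNReal.ofReal_le_ofReal_iff hη.le] at hg
    simp only [ENNReal.toReal_ofNat, Real.rpow_ofNat, Pi.sub_apply, Real.norm_eq_abs, sq_abs] at hg
    have h0 : 0 ≤ ∫ u, (f u - g u) ^ 2 ∂(gaussianReal 0 1) := integral_nonneg fun u => sq_nonneg _
    have h2 := pow_le_pow_left₀ (Real.rpow_nonneg h0 _) hg 2
    rwa [← Real.rpow_natCast, ← Real.rpow_mul h0, Nat.cast_ofNat, inv_mul_cancel₀ two_ne_zero,
      Real.rpow_one] at h2
  refine ⟨dualActivation g, (continuous_dualActivation_of_bounded g).continuousOn, fun ρ hρ => ?_⟩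
  rw [Real.dist_eq]
  refine (abs_dualActivation_sub_le hf hgm hρ hη hfg).trans_lt ?_
  have h1 : η ≤ 1 := min_le_left _ _
  have h2 : η ≤ e / (2 * (2 + 2 * F)) := min_le_right _ _
  calc η * (1 + F + η ^ 2 + F) ≤ (e / (2 * (2 + 2 * F))) * (2 + 2 * F) := by
        apply mul_le_mul h2 _ (by positivity) (by positivity)
        nlinarith
    _ = e / 2 := by field_simp
    _ < e := by linarith

end DualActivation

/-! ### The kernel of a normalized activation -/

namespace IsNormalizedActivation

variable {σ : ℝ → ℝ}

theorem continuous (hσ : IsNormalizedActivation σ) : Continuous σ := by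
  rw [continuous_iff_continuousAt]
  intro x
  refine (hσ.absolutelyContinuous (x - 1) (x + 1)).continuousOn.continuousAt ?_
  rw [Set.uIcc_of_le (by linarith)]
  exact Icc_mem_nhds (by linarith) (by linarith)

theorem memLp (hσ : IsNormalizedActivation σ) : MemLp σ 2 (gaussianReal 0 1) := by
  rw [memLp_two_iff_integrable_sq hσ.continuous.aestronglyMeasurable]
  by_contra h
  have := hσ.variance_one
  rw [integral_undef h] at this
  exact zero_ne_one this

theorem dualActivation_mem (hσ : IsNormalizedActivation σ) {ρ : ℝ} (hρ : ρ ∈ Set.Icc (-1 : ℝ) 1) :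
    dualActivation σ ρ ∈ Set.Icc (-1 : ℝ) 1 := by
  have := abs_dualActivation_le hσ.memLp hρ
  rw [hσ.variance_one] at this
  exact abs_le.1 this

theorem iterate_mem (hσ : IsNormalizedActivation σ) {ρ : ℝ} (hρ : ρ ∈ Set.Icc (-1 : ℝ) 1) (l : ℕ) :
    (dualActivation σ)^[l] ρ ∈ Set.Icc (-1 : ℝ) 1 := by
  induction l with
  | zero => exact hρ
  | succ l ih => rw [Function.iterate_succ_apply']; exact hσ.dualActivation_mem ih

theorem continuousOn_iterate (hσ : IsNormalizedActivation σ) (l : ℕ) :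
    ContinuousOn (dualActivation σ)^[l] (Set.Icc (-1) 1) := by
  induction l with
  | zero => exact continuousOn_id
  | succ l ih =>
    rw [Function.iterate_succ']
    exact (continuousOn_dualActivation hσ.memLp).comp ih fun ρ hρ => hσ.iterate_mem hρ l

theorem continuousOn_kernelHat (hσ : IsNormalizedActivation σ) (L : ℕ) : ContinuousOn (kernelHat σ L) (Set.Icc (-1) 1) :=
  continuousOn_finsetSum _ fun _ _ => (hσ.continuousOn_iterate _).mul
    (continuousOn_finsetProd _ fun l _ => (continuousOn_dualActivation hσ.memLp_deriv).comp
      (hσ.continuousOn_iterate l) fun _ hρ => hσ.iterate_mem hρ l)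

/-- The compositions stay in [-1, 1] because σ has variance 1, and each derivative factor is at most
the Gaussian second moment of σ'. Growth exponential in L is harmless: it costs O(L) bits of the
register. -/
theorem abs_kernelHat_le (hσ : IsNormalizedActivation σ) {ρ : ℝ} (hρ : ρ ∈ Set.Icc (-1 : ℝ) 1) (L : ℕ) :
    |kernelHat σ L ρ| ≤ (L + 1) * (1 + ∫ u, deriv σ u ^ 2 ∂(gaussianReal 0 1)) ^ L := by
  set μ := ∫ u, deriv σ u ^ 2 ∂(gaussianReal 0 1)
  have hμ : 0 ≤ μ := integral_nonneg fun u => sq_nonneg _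
  have h1 : ∀ h ∈ Finset.Icc 1 (L + 1), |(dualActivation σ)^[h - 1] ρ *
      ∏ h' ∈ Finset.Icc h L, dualActivation (deriv σ) ((dualActivation σ)^[h'] ρ)| ≤ (1 + μ) ^ L := by
    intro h hh
    rw [abs_mul, Finset.abs_prod]
    have h2 : |(dualActivation σ)^[h - 1] ρ| ≤ 1 := abs_le.2 (hσ.iterate_mem hρ _)
    have h3 : ∏ h' ∈ Finset.Icc h L, |dualActivation (deriv σ) ((dualActivation σ)^[h'] ρ)| ≤
        ∏ h' ∈ Finset.Icc h L, (1 + μ) := by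
      refine Finset.prod_le_prod (fun _ _ => abs_nonneg _) fun l _ => ?_
      have := abs_dualActivation_le hσ.memLp_deriv (hσ.iterate_mem hρ l)
      linarith
    rw [Finset.prod_const] at h3
    have h4 : (1 + μ) ^ (Finset.Icc h L).card ≤ (1 + μ) ^ L := by
      refine pow_le_pow_right₀ (by linarith) ?_
      rw [Nat.card_Icc]
      have := (Finset.mem_Icc.1 hh).1
      omega
    calc _ ≤ 1 * (1 + μ) ^ L := mul_le_mul h2 (h3.trans h4)
          (Finset.prod_nonneg fun _ _ => abs_nonneg _) zero_le_one
      _ = _ := one_mul _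
  refine (Finset.abs_sum_le_sum_abs _ _).trans ((Finset.sum_le_sum h1).trans (le_of_eq ?_))
  rw [Finset.sum_const, Nat.card_Icc, nsmul_eq_mul]
  push_cast
  congr 1

theorem continuousOn_clippedKernel (hσ : IsNormalizedActivation σ) (L : ℕ) (δhat : ℝ) :
    ContinuousOn (clippedKernel σ L δhat) (Set.Icc (-1) 1) :=
  continuousOn_const.sup (continuousOn_const.inf ((hσ.continuousOn_kernelHat L).div_const _))

end IsNormalizedActivation

theorem abs_clippedKernel_le (σ : ℝ → ℝ) (L : ℕ) (δhat ρ : ℝ) : |clippedKernel σ L δhat ρ| ≤ 1 :=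
  abs_le.2 ⟨le_max_left _ _, max_le (by norm_num) (min_le_left _ _)⟩

/-! ### Operators on subsets of the qubits -/

section Operators

variable {b q : ℕ}

theorem extend_comp_emb (w : Fin b ↪ Fin q) (y : Bits b) (z : Bits q) :
    Function.extend w y z ∘ w = y := Function.extend_comp w.injective y z

theorem extend_apply_of_ne (w : Fin b ↪ Fin q) (y : Bits b) (z : Bits q) {c : Fin q}
    (hc : ∀ t, w t ≠ c) : Function.extend w y z c = z c :=
  Function.extend_apply' _ _ _ fun ⟨t, ht⟩ => hc t ht

theorem extend_extend (w : Fin b ↪ Fin q) (y y' : Bits b) (z : Bits q) :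
    Function.extend w y (Function.extend w y' z) = Function.extend w y z := by
  funext c
  by_cases h : ∃ t, w t = c
  · obtain ⟨t, rfl⟩ := h
    rw [w.injective.extend_apply, w.injective.extend_apply]
  · rw [Function.extend_apply' _ _ _ h, Function.extend_apply' _ _ _ h,
      Function.extend_apply' _ _ _ h]

theorem extend_restrict (w : Fin b ↪ Fin q) (z : Bits q) : Function.extend w (z ∘ w) z = z := by
  funext c
  by_cases h : ∃ t, w t = c
  · obtain ⟨t, rfl⟩ := h
    rw [w.injective.extend_apply]; rfl
  · rw [Function.extend_apply' _ _ _ h]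

theorem applyOn_mul (w : Fin b ↪ Fin q) (M N : Matrix (Bits b) (Bits b) ℂ) (ψ : Bits q → ℂ) :
    applyOn w (M * N) ψ = applyOn w M (applyOn w N ψ) := by
  funext z
  simp only [applyOn, Matrix.mul_apply, Finset.sum_mul, Finset.mul_sum, extend_comp_emb,
    extend_extend]
  rw [Finset.sum_comm]
  simp only [mul_assoc]

theorem applyOn_one (w : Fin b ↪ Fin q) (ψ : Bits q → ℂ) : applyOn w 1 ψ = ψ := by
  funext z
  simp only [applyOn, Matrix.one_apply, ite_mul, one_mul, zero_mul, Finset.sum_ite_eq,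
    Finset.mem_univ, if_true, extend_restrict]

theorem applyOn_add (w : Fin b ↪ Fin q) (M : Matrix (Bits b) (Bits b) ℂ) (φ ψ : Bits q → ℂ) :
    applyOn w M (φ + ψ) = applyOn w M φ + applyOn w M ψ := by
  funext z
  simp only [applyOn, Pi.add_apply, mul_add, Finset.sum_add_distrib]

theorem applyOn_smul (w : Fin b ↪ Fin q) (M : Matrix (Bits b) (Bits b) ℂ) (a : ℂ) (ψ : Bits q → ℂ) :
    applyOn w M (a • ψ) = a • applyOn w M ψ := by
  funext z
  simp only [applyOn, Pi.smul_apply, smul_eq_mul, Finset.mul_sum, mul_left_comm]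

theorem applyOn_adjoint (w : Fin b ↪ Fin q) (M : Matrix (Bits b) (Bits b) ℂ) (φ ψ : Bits q → ℂ) :
    star φ ⬝ᵥ applyOn w M ψ = star (applyOn w M.conjTranspose φ) ⬝ᵥ ψ := by
  simp only [dotProduct, applyOn, Pi.star_apply, star_sum, star_mul', Matrix.conjTranspose_apply,
    star_star, Finset.mul_sum, Finset.sum_mul]
  rw [← Fintype.sum_prod_type', ← Fintype.sum_prod_type']
  -- Exchanging y with the part of z on the qubits w is an involution; it swaps row and column
  -- indices of the operator.
  have hinv : Function.Involutive fun p : Bits q × Bits b => (Function.extend w p.2 p.1, p.1 ∘ w) :=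
    fun p => Prod.ext (by simp only [extend_extend, extend_restrict]) (extend_comp_emb _ _ _)
  refine Fintype.sum_equiv hinv.toPerm _ _ fun p => ?_
  simp only [Function.Involutive.coe_toPerm, extend_extend, extend_restrict, extend_comp_emb]
  ring

variable {c : Fin q} {w : Fin b ↪ Fin q}

theorem applyControlled_mul (hc : ∀ t, w t ≠ c) (M N : Matrix (Bits b) (Bits b) ℂ)
    (ψ : Bits q → ℂ) :
    applyControlled c w (M * N) ψ = applyControlled c w M (applyControlled c w N ψ) := by
  funext z
  by_cases h : z c = true
  · rw [applyControlled, if_pos h, applyControlled, if_pos h, applyOn_mul]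
    refine Finset.sum_congr rfl fun y _ => ?_
    rw [applyControlled, extend_apply_of_ne w _ z hc, if_pos h]
  · simp [applyControlled, h]

theorem applyControlled_one (ψ : Bits q → ℂ) : applyControlled c w 1 ψ = ψ := by
  funext z
  simp only [applyControlled, applyOn_one, ite_self]

theorem applyControlled_add (M : Matrix (Bits b) (Bits b) ℂ) (φ ψ : Bits q → ℂ) :
    applyControlled c w M (φ + ψ) = applyControlled c w M φ + applyControlled c w M ψ := by
  funext z
  by_cases h : z c = true <;> simp [applyControlled, h, applyOn_add]

theorem applyControlled_smul (M : Matrix (Bits b) (Bits b) ℂ) (a : ℂ) (ψ : Bits q → ℂ) :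
    applyControlled c w M (a • ψ) = a • applyControlled c w M ψ := by
  funext z
  by_cases h : z c = true <;> simp [applyControlled, h, applyOn_smul]

theorem applyControlled_adjoint (hc : ∀ t, w t ≠ c) (M : Matrix (Bits b) (Bits b) ℂ)
    (φ ψ : Bits q → ℂ) :
    star φ ⬝ᵥ applyControlled c w M ψ = star (applyControlled c w M.conjTranspose φ) ⬝ᵥ ψ := by
  set φ₁ : Bits q → ℂ := fun z => if z c then φ z else 0
  set φ₀ : Bits q → ℂ := fun z => if z c then 0 else φ z
  have h1 : star φ ⬝ᵥ applyControlled c w M ψ = star φ₁ ⬝ᵥ applyOn w M ψ + star φ₀ ⬝ᵥ ψ := by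
    simp only [dotProduct, ← Finset.sum_add_distrib]
    refine Finset.sum_congr rfl fun z _ => ?_
    by_cases h : z c = true <;> simp [applyControlled, h, φ₁, φ₀]
  have h2 : applyControlled c w M.conjTranspose φ = applyOn w M.conjTranspose φ₁ + φ₀ := by
    funext z
    by_cases h : z c = true <;>
      simp [applyControlled, h, φ₁, φ₀, applyOn, extend_apply_of_ne w _ z hc]
  rw [h1, h2, applyOn_adjoint, star_add, add_dotProduct]

end Operators

/-! ### Circuits without loading queries, for one fixed address -/

section Circuits

variable {d q : ℕ}

/-- The action of an operation on the work qubits when the address queries return `R` and the test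
queries return `S` (loading queries are ignored). -/
noncomputable def Instr.act (R S : Matrix.unitaryGroup (Bits (dataQubits d)) ℂ) :
    Instr d q → (Bits q → ℂ) → (Bits q → ℂ)
  | .gate w g, ψ => applyOn w g.1 ψ
  | .load _, ψ => ψ
  | .row inv c w _, ψ => applyControlled c w (orInverse inv R) ψ
  | .test inv c w _, ψ => applyControlled c w (orInverse inv S) ψ

/-- Operations other than loading queries. -/
def Instr.LoadFree : Instr d q → Prop
  | .load _ => False
  | _ => True

/-- The inverse operation. -/
def Instr.inverse : Instr d q → Instr d q
  | .gate w g => .gate w g⁻¹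
  | .load inv => .load !inv
  | .row inv c w hc => .row (!inv) c w hc
  | .test inv c w hc => .test (!inv) c w hc

/-- The inverse circuit. -/
def inverseCircuit (C : List (Instr d q)) : List (Instr d q) := (C.map Instr.inverse).reverse

variable {R S : Matrix.unitaryGroup (Bits (dataQubits d)) ℂ}

theorem orInverse_not_mul {ι : Type*} [Fintype ι] [DecidableEq ι] (inv : Bool)
    (U : Matrix.unitaryGroup ι ℂ) : orInverse (!inv) U * orInverse inv U = 1 := by
  cases inv
  · exact congrArg Subtype.val (inv_mul_cancel U)
  · exact congrArg Subtype.val (mul_inv_cancel U)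

theorem orInverse_not {ι : Type*} [Fintype ι] [DecidableEq ι] (inv : Bool)
    (U : Matrix.unitaryGroup ι ℂ) : orInverse (!inv) U = (orInverse inv U).conjTranspose := by
  cases inv
  · rfl
  · exact (star_star U.1).symm

theorem Instr.act_inverse_act (g : Instr d q) (ψ : Bits q → ℂ) :
    g.inverse.act R S (g.act R S ψ) = ψ := by
  cases g with
  | gate w g =>
    simp only [Instr.inverse, Instr.act]
    rw [← applyOn_mul, show (g⁻¹).1 * g.1 = 1 from congrArg Subtype.val (inv_mul_cancel g), applyOn_one]
  | load inv => rfl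
  | row inv c w hc =>
    simp only [Instr.inverse, Instr.act]
    rw [← applyControlled_mul hc, orInverse_not_mul, applyControlled_one]
  | test inv c w hc =>
    simp only [Instr.inverse, Instr.act]
    rw [← applyControlled_mul hc, orInverse_not_mul, applyControlled_one]

theorem Instr.act_adjoint (g : Instr d q) (φ ψ : Bits q → ℂ) :
    star φ ⬝ᵥ g.act R S ψ = star (g.inverse.act R S φ) ⬝ᵥ ψ := by
  cases g with
  | gate w g => exact applyOn_adjoint w _ φ ψ
  | load inv => rfl
  | row inv c w hc =>
    simp only [Instr.inverse, Instr.act]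
    rw [orInverse_not, applyControlled_adjoint hc]
  | test inv c w hc =>
    simp only [Instr.inverse, Instr.act]
    rw [orInverse_not, applyControlled_adjoint hc]

theorem Instr.act_add (g : Instr d q) (φ ψ : Bits q → ℂ) :
    g.act R S (φ + ψ) = g.act R S φ + g.act R S ψ := by
  cases g with
  | gate w g => exact applyOn_add _ _ _ _
  | load inv => rfl
  | row inv c w hc => exact applyControlled_add _ _ _
  | test inv c w hc => exact applyControlled_add _ _ _

theorem Instr.act_smul (g : Instr d q) (a : ℂ) (ψ : Bits q → ℂ) :
    g.act R S (a • ψ) = a • g.act R S ψ := by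
  cases g with
  | gate w g => exact applyOn_smul _ _ _ _
  | load inv => rfl
  | row inv c w hc => exact applyControlled_smul _ _ _
  | test inv c w hc => exact applyControlled_smul _ _ _

variable (R S) in
/-- The linear action of a circuit on the work qubits for fixed answers to the queries. -/
noncomputable def circuitEnd (C : List (Instr d q)) : Module.End ℂ (Bits q → ℂ) where
  toFun ψ := C.foldl (fun φ g => g.act R S φ) ψ
  map_add' φ ψ := by
    induction C generalizing φ ψ with
    | nil => rfl
    | cons g C ih => simp only [List.foldl_cons, Instr.act_add, ih]
  map_smul' a ψ := by
    induction C generalizing ψ with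
    | nil => rfl
    | cons g C ih => simp only [List.foldl_cons, Instr.act_smul, ih, RingHom.id_apply]

@[simp] theorem circuitEnd_nil (ψ : Bits q → ℂ) : circuitEnd R S [] ψ = ψ := rfl

@[simp] theorem circuitEnd_cons (g : Instr d q) (C : List (Instr d q)) (ψ : Bits q → ℂ) :
    circuitEnd R S (g :: C) ψ = circuitEnd R S C (g.act R S ψ) := rfl

theorem circuitEnd_append (C D : List (Instr d q)) (ψ : Bits q → ℂ) :
    circuitEnd R S (C ++ D) ψ = circuitEnd R S D (circuitEnd R S C ψ) :=
  List.foldl_append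

theorem circuitEnd_inverseCircuit (C : List (Instr d q)) (ψ : Bits q → ℂ) :
    circuitEnd R S (inverseCircuit C) (circuitEnd R S C ψ) = ψ := by
  induction C generalizing ψ with
  | nil => rfl
  | cons g C ih =>
    rw [inverseCircuit, List.map_cons, List.reverse_cons, circuitEnd_append, circuitEnd_cons,
      ← inverseCircuit, circuitEnd_cons, ih, circuitEnd_nil, Instr.act_inverse_act]

theorem circuitEnd_adjoint (C : List (Instr d q)) (φ ψ : Bits q → ℂ) :
    star φ ⬝ᵥ circuitEnd R S C ψ = star (circuitEnd R S (inverseCircuit C) φ) ⬝ᵥ ψ := by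
  induction C generalizing φ ψ with
  | nil => rfl
  | cons g C ih =>
    rw [inverseCircuit, List.map_cons, List.reverse_cons, circuitEnd_append, ← inverseCircuit,
      circuitEnd_cons, circuitEnd_cons, circuitEnd_nil, ih, Instr.act_adjoint]

theorem circuitEnd_isometry (C : List (Instr d q)) (φ ψ : Bits q → ℂ) :
    star (circuitEnd R S C φ) ⬝ᵥ circuitEnd R S C ψ = star φ ⬝ᵥ ψ := by
  rw [circuitEnd_adjoint, circuitEnd_inverseCircuit]

theorem circuitTime_append (T : ℕ) (C D : List (Instr d q)) :
    circuitTime T (C ++ D) = circuitTime T C + circuitTime T D := by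
  simp [circuitTime]

theorem circuitTime_cons (T : ℕ) (g : Instr d q) (C : List (Instr d q)) :
    circuitTime T (g :: C) = g.time T + circuitTime T C := by
  simp [circuitTime]

@[simp] theorem circuitTime_nil (T : ℕ) : circuitTime T ([] : List (Instr d q)) = 0 := rfl

theorem circuitTime_inverseCircuit (T : ℕ) (C : List (Instr d q)) :
    circuitTime T (inverseCircuit C) = circuitTime T C := by
  rw [inverseCircuit, circuitTime, List.map_reverse, List.sum_reverse, List.map_map, circuitTime]
  congr 2
  funext g
  cases g <;> rfl

theorem loadFree_inverseCircuit {C : List (Instr d q)} (hC : ∀ g ∈ C, g.LoadFree) :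
    ∀ g ∈ inverseCircuit C, g.LoadFree := by
  intro g hg
  obtain ⟨g', hg', rfl⟩ := List.mem_map.1 (List.mem_reverse.1 hg)
  have := hC g' hg'
  cases g' <;> trivial

/-- Without loading queries nothing changes the index register, so the circuit is block diagonal
over the addresses and the analysis reduces to fixed query answers. -/
theorem run_apply {n : ℕ} [NeZero n] {x : Fin n → EuclideanSpace ℝ (Fin d)}
    {xs : EuclideanSpace ℝ (Fin d)} (Q : QuantumAccess x xs) {C : List (Instr d q)}
    (hC : ∀ g ∈ C, g.LoadFree) (ψ : QState n q) (i : Fin n) (z : Bits q) :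
    run Q C ψ (i, z) = circuitEnd (Q.row i) Q.test C (fun z => ψ (i, z)) z := by
  induction C generalizing ψ with
  | nil => rfl
  | cons g C ih =>
    rw [run, List.foldl_cons, ← run, ih fun g' hg' => hC g' (List.mem_cons_of_mem _ hg'),
      circuitEnd_cons]
    have := hC g List.mem_cons_self
    cases g with
    | load inv => exact this.elim
    | _ => rfl

/-! ### Relabelling of the qubits -/

variable {r : ℕ}

/-- The operation on the qubits selected by an embedding. -/
def Instr.relabel (e : Fin q ↪ Fin r) : Instr d q → Instr d r
  | .gate w g => .gate (w.trans e) g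
  | .load inv => .load inv
  | .row inv c w hc => .row inv (e c) (w.trans e) fun t h => hc t (e.injective h)
  | .test inv c w hc => .test inv (e c) (w.trans e) fun t h => hc t (e.injective h)

theorem extend_trans {b : ℕ} (w : Fin b ↪ Fin q) (e : Fin q ↪ Fin r) (y : Bits b) (z : Bits r) :
    Function.extend (w.trans e) y z = Function.extend e (Function.extend w y (z ∘ e)) z := by
  funext k
  by_cases h : ∃ t, e t = k
  · obtain ⟨t, rfl⟩ := h
    rw [e.injective.extend_apply]
    by_cases h' : ∃ s, w s = t
    · obtain ⟨s, rfl⟩ := h'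
      rw [w.injective.extend_apply]
      exact (w.trans e).injective.extend_apply y z s
    · rw [Function.extend_apply' _ _ _ h', Function.extend_apply']
      · rfl
      · rintro ⟨s, hs⟩; exact h' ⟨s, e.injective hs⟩
  · rw [Function.extend_apply' _ _ _ h, Function.extend_apply']
    rintro ⟨s, hs⟩; exact h ⟨w s, hs⟩

theorem applyOn_trans {b : ℕ} (w : Fin b ↪ Fin q) (e : Fin q ↪ Fin r)
    (M : Matrix (Bits b) (Bits b) ℂ) (ψ : Bits r → ℂ) (z : Bits r) :
    applyOn (w.trans e) M ψ z = applyOn w M (fun y => ψ (Function.extend e y z)) (z ∘ e) := by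
  simp only [applyOn, extend_trans]
  rfl

theorem Instr.act_relabel (e : Fin q ↪ Fin r) (g : Instr d q) (ψ : Bits r → ℂ) (z : Bits r) :
    (g.relabel e).act R S ψ z = g.act R S (fun y => ψ (Function.extend e y z)) (z ∘ e) := by
  cases g with
  | gate w g => exact applyOn_trans _ _ _ _ _
  | load inv => simp only [Instr.relabel, Instr.act, extend_restrict]
  | row inv c w hc =>
    simp only [Instr.relabel, Instr.act, applyControlled, applyOn_trans, Function.comp_apply,
      extend_restrict]
  | test inv c w hc =>
    simp only [Instr.relabel, Instr.act, applyControlled, applyOn_trans, Function.comp_apply,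
      extend_restrict]

theorem circuitEnd_relabel (e : Fin q ↪ Fin r) (C : List (Instr d q)) (ψ : Bits r → ℂ)
    (z : Bits r) :
    circuitEnd R S (C.map (Instr.relabel e)) ψ z =
      circuitEnd R S C (fun y => ψ (Function.extend e y z)) (z ∘ e) := by
  induction C generalizing ψ with
  | nil => simp only [List.map_nil, circuitEnd_nil, extend_restrict]
  | cons g C ih =>
    rw [List.map_cons, circuitEnd_cons, ih, circuitEnd_cons]
    have : (fun y => (g.relabel e).act R S ψ (Function.extend e y z)) =
        g.act R S fun y => ψ (Function.extend e y z) := by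
      funext y
      rw [Instr.act_relabel, extend_comp_emb]
      simp only [extend_extend]
    rw [this]

theorem circuitTime_relabel (T : ℕ) (e : Fin q ↪ Fin r) (C : List (Instr d q)) :
    circuitTime T (C.map (Instr.relabel e)) = circuitTime T C := by
  rw [circuitTime, List.map_map, circuitTime]
  congr 2
  funext g
  cases g <;> rfl

theorem loadFree_relabel (e : Fin q ↪ Fin r) {C : List (Instr d q)} (hC : ∀ g ∈ C, g.LoadFree) :
    ∀ g ∈ C.map (Instr.relabel e), g.LoadFree := by
  intro g hg
  obtain ⟨g', hg', rfl⟩ := List.mem_map.1 hg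
  have := hC g' hg'
  cases g' <;> trivial

/-! ### Multiplexed single-qubit gates -/

/-- The single-qubit operator `G` on the qubit `t`. -/
def act1 (t : Fin q) (G : Matrix Bool Bool ℂ) (ψ : Bits q → ℂ) : Bits q → ℂ := fun z =>
  G (z t) false * ψ (Function.update z t false) + G (z t) true * ψ (Function.update z t true)

/-- The block matrix that applies `g b` to the second qubit if the first one is `b`. -/
def muxMatrix (g : Bool → Matrix Bool Bool ℂ) : Matrix (Bits 2) (Bits 2) ℂ :=
  Matrix.of fun y y' => if y 0 = y' 0 then g (y 0) (y 1) (y' 1) else 0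

theorem sum_bits_two {M : Type*} [AddCommMonoid M] (f : Bits 2 → M) :
    ∑ y, f y = ∑ a : Bool, ∑ b : Bool, f ![a, b] := by
  rw [← Fintype.sum_prod_type']
  exact Fintype.sum_equiv (finTwoArrowEquiv Bool) _ _ fun y => by
    congr 1; funext i; fin_cases i <;> rfl

theorem muxMatrix_mem (g : Bool → Matrix.unitaryGroup Bool ℂ) :
    muxMatrix (fun b => (g b).1) ∈ Matrix.unitaryGroup (Bits 2) ℂ := by
  rw [Matrix.mem_unitaryGroup_iff]
  ext y y'
  have h := fun b => Matrix.mem_unitaryGroup_iff.1 (g b).2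
  have h' := fun b i j => congrFun (congrFun (h b) i) j
  simp only [Matrix.mul_apply, Matrix.star_apply, Matrix.one_apply, Fintype.sum_bool] at h'
  rw [Matrix.mul_apply, sum_bits_two]
  have hy : y = y' ↔ y 0 = y' 0 ∧ y 1 = y' 1 :=
    ⟨fun h => by simp [h], fun h => by funext i; fin_cases i; exacts [h.1, h.2]⟩
  simp only [Matrix.one_apply, hy, muxMatrix, Matrix.of_apply, Matrix.star_apply, Fintype.sum_bool,
    Matrix.cons_val_zero, Matrix.cons_val_one]
  by_cases e : y 0 = y' 0
  · cases e' : y' 0 <;> simpa [e, e'] using h' _ (y 1) (y' 1)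
  · cases e' : y' 0 <;> cases e'' : y 0 <;> simp_all

/-- The list of two distinct qubits. -/
def pairEmb (k t : Fin q) (h : k ≠ t) : Fin 2 ↪ Fin q :=
  ⟨![k, t], fun i j hij => by fin_cases i <;> fin_cases j <;> simp_all [eq_comm]⟩

theorem extend_pairEmb {k t : Fin q} (h : k ≠ t) (z : Bits q) (b : Bool) :
    Function.extend (pairEmb k t h) ![z k, b] z = Function.update z t b := by
  funext s
  by_cases hs : s = t
  · subst hs
    rw [Function.update_self]
    exact (pairEmb k s h).injective.extend_apply ![z k, b] z 1
  · rw [Function.update_of_ne hs]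
    by_cases hk : s = k
    · subst hk
      exact (pairEmb s t h).injective.extend_apply ![z s, b] z 0
    · refine extend_apply_of_ne _ _ _ fun i hi => ?_
      fin_cases i
      · exact hk hi.symm
      · exact hs hi.symm

/-- The two-qubit gate that applies `g b` to the qubit `t` if the qubit `k` is `b`. -/
def muxGate (k t : Fin q) (h : k ≠ t) (g : Bool → Matrix.unitaryGroup Bool ℂ) : Instr d q :=
  .gate (pairEmb k t h) ⟨_, muxMatrix_mem g⟩

theorem act_muxGate {k t : Fin q} (h : k ≠ t) (g : Bool → Matrix.unitaryGroup Bool ℂ)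
    (ψ : Bits q → ℂ) (z : Bits q) :
    (muxGate (d := d) k t h g).act R S ψ z = act1 t (g (z k)).1 ψ z := by
  have key : ∀ a b : Bool, muxMatrix (fun b => (g b).1) (z ∘ pairEmb k t h) ![a, b] *
      ψ (Function.extend (pairEmb k t h) ![a, b] z) =
      if z k = a then (g (z k)).1 (z t) b * ψ (Function.update z t b) else 0 := by
    intro a b
    by_cases hz : z k = a
    · subst hz
      rw [extend_pairEmb, if_pos rfl]
      congr 1
      exact if_pos rfl
    · rw [if_neg hz]
      refine mul_eq_zero_of_left ?_ _
      exact if_neg hz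
  show applyOn _ _ _ _ = _
  rw [applyOn]
  rw [sum_bits_two]
  simp only [key, Fintype.sum_bool]
  cases z k <;> simp [act1, add_comm]

@[simp] theorem time_muxGate (T : ℕ) {k t : Fin q} (h : k ≠ t)
    (g : Bool → Matrix.unitaryGroup Bool ℂ) : (muxGate (d := d) k t h g).time T = 1 := rfl

theorem act1_mul (t : Fin q) (G G' : Matrix Bool Bool ℂ) (ψ : Bits q → ℂ) :
    act1 t (G * G') ψ = act1 t G (act1 t G' ψ) := by
  funext z
  simp only [act1, Matrix.mul_apply, Fintype.sum_bool, Function.update_self, Function.update_idem]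
  ring

theorem act1_one (t : Fin q) (ψ : Bits q → ℂ) : act1 t 1 ψ = ψ := by
  funext z
  have hz : ψ (Function.update z t (z t)) = ψ z := by rw [Function.update_eq_self]
  cases h : z t <;> rw [h] at hz <;> rw [act1, h] <;> simp [hz]

end Circuits

/-! ### Standard gates -/

section Gates

/-- The Pauli matrix `X`. -/
def gateX : Matrix.unitaryGroup Bool ℂ :=
  ⟨Matrix.of fun i j => if i = j then 0 else 1, by
    rw [Matrix.mem_unitaryGroup_iff]
    ext i j
    cases i <;> cases j <;> simp [Matrix.mul_apply, Matrix.star_apply]⟩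

/-- The Pauli matrix `Z`. -/
def gateZ : Matrix.unitaryGroup Bool ℂ :=
  ⟨Matrix.of fun i j => if i = j then (if i then -1 else 1) else 0, by
    rw [Matrix.mem_unitaryGroup_iff]
    ext i j
    cases i <;> cases j <;> simp [Matrix.mul_apply, Matrix.star_apply]⟩

/-- A square root of `X`. -/
noncomputable def gateV : Matrix.unitaryGroup Bool ℂ :=
  ⟨Matrix.of fun i j => if i = j then ⟨1 / 2, 1 / 2⟩ else ⟨1 / 2, -1 / 2⟩, by
    rw [Matrix.mem_unitaryGroup_iff]
    ext i j
    cases i <;> cases j <;>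
      simp [Matrix.mul_apply, Matrix.star_apply, Complex.ext_iff] <;> norm_num⟩

/-- The Hadamard matrix. -/
noncomputable def gateH : Matrix.unitaryGroup Bool ℂ :=
  ⟨Matrix.of fun i j => (((Real.sqrt 2)⁻¹ : ℝ) : ℂ) * if i && j then -1 else 1, by
    have h : (((Real.sqrt 2)⁻¹ : ℝ) : ℂ) * (((Real.sqrt 2)⁻¹ : ℝ) : ℂ) = 1 / 2 := by
      rw [← Complex.ofReal_mul, ← mul_inv, Real.mul_self_sqrt zero_le_two]
      norm_num
    rw [Matrix.mem_unitaryGroup_iff]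
    ext i j
    cases i <;> cases j <;> simp [Matrix.mul_apply, Matrix.star_apply] <;>
      simp only [Complex.ofReal_inv] at h <;> linear_combination 2 * h⟩

theorem gateV_mul_self : gateV.1 * gateV.1 = gateX.1 := by
  ext i j
  cases i <;> cases j <;>
    simp [Matrix.mul_apply, gateV, gateX, Complex.ext_iff] <;> norm_num

theorem gateX_mul_self : gateX.1 * gateX.1 = 1 := by
  ext i j
  cases i <;> cases j <;> simp [Matrix.mul_apply, gateX]

variable {d q : ℕ} {R S : Matrix.unitaryGroup (Bits (dataQubits d)) ℂ}

theorem act1_gateX (t : Fin q) (ψ : Bits q → ℂ) (z : Bits q) :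
    act1 t gateX.1 ψ z = ψ (Function.update z t !z t) := by
  cases h : z t <;> simp [act1, gateX, h]

theorem act1_gateZ (t : Fin q) (ψ : Bits q → ℂ) (z : Bits q) :
    act1 t gateZ.1 ψ z = (if z t then -1 else 1) * ψ z := by
  have hz : ψ (Function.update z t (z t)) = ψ z := by rw [Function.update_eq_self]
  cases h : z t <;> rw [h] at hz <;> simp [act1, gateZ, h, hz]

/-- The gate `g`, controlled on the qubit `k`. -/
def ctrlGate (k t : Fin q) (h : k ≠ t) (g : Matrix.unitaryGroup Bool ℂ) : Instr d q :=
  muxGate k t h fun b => if b then g else 1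

/-- The single-qubit gate `g` on the qubit `t` (with an idle second qubit `k`). -/
def singleGate (k t : Fin q) (h : k ≠ t) (g : Matrix.unitaryGroup Bool ℂ) : Instr d q :=
  muxGate k t h fun _ => g

theorem act_singleGate {k t : Fin q} (h : k ≠ t) (g : Matrix.unitaryGroup Bool ℂ) (ψ : Bits q → ℂ) :
    (singleGate (d := d) k t h g).act R S ψ = act1 t g.1 ψ := by
  funext z
  rw [singleGate, act_muxGate]

theorem act_ctrlGate {k t : Fin q} (h : k ≠ t) (g : Matrix.unitaryGroup Bool ℂ) (ψ : Bits q → ℂ)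
    (z : Bits q) : (ctrlGate (d := d) k t h g).act R S ψ z = if z k then act1 t g.1 ψ z else ψ z := by
  rw [ctrlGate, act_muxGate]
  cases z k
  · simp [act1_one]
  · simp

theorem act_ctrlGate_X {k t : Fin q} (h : k ≠ t) (ψ : Bits q → ℂ) (z : Bits q) :
    (ctrlGate (d := d) k t h gateX).act R S ψ z = ψ (Function.update z t (xor (z t) (z k))) := by
  rw [act_ctrlGate, act1_gateX]
  cases z k <;> simp

/-- `t ← t ⊕ (a ∨ b)`. -/
noncomputable def orGate (a b t : Fin q) (hab : a ≠ b) (hat : a ≠ t) (hbt : b ≠ t) : List (Instr d q) :=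
  [ctrlGate a t hat gateV, ctrlGate b t hbt gateV, ctrlGate a b hab gateX, ctrlGate b t hbt gateV,
    ctrlGate a b hab gateX]

theorem act1_congr {t : Fin q} {G : Matrix Bool Bool ℂ} {φ ψ : Bits q → ℂ} {z z' : Bits q}
    (h : z t = z' t) (h' : ∀ b, φ (Function.update z t b) = ψ (Function.update z' t b)) :
    act1 t G φ z = act1 t G ψ z' := by
  simp only [act1, h, h']

/-- The three controlled square roots of X have exponents a, b and a ⊕ b, and a + b + (a ⊕ b) = 2 (a
∨ b). The two controlled X gates put a ⊕ b into the place of b and restore it. -/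
theorem circuitEnd_orGate {a b t : Fin q} (hab : a ≠ b) (hat : a ≠ t) (hbt : b ≠ t)
    (ψ : Bits q → ℂ) (z : Bits q) :
    circuitEnd R S (orGate (d := d) a b t hab hat hbt) ψ z =
      ψ (Function.update z t (xor (z t) (z a || z b))) := by
  have mux : ∀ (k : Fin q) (hk : k ≠ t) (φ : Bits q → ℂ) (z : Bits q),
      (ctrlGate (d := d) k t hk gateV).act R S φ z = act1 t (if z k then gateV.1 else 1) φ z := by
    intro k hk φ z
    rw [act_ctrlGate]
    cases z k <;> simp [act1_one]
  simp only [orGate, circuitEnd_cons, circuitEnd_nil]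
  rw [act_ctrlGate_X, mux]
  rw [act1_congr (z' := z) (ψ := act1 t (if z b then gateV.1 else 1)
    (act1 t (if z a then gateV.1 else 1) ψ)) (Function.update_of_ne hbt.symm _ _)]
  · rw [← act1_mul, ← act1_mul, Function.update_self]
    have : (if xor (z b) (z a) then gateV.1 else 1) *
        (if z b then gateV.1 else 1) * (if z a then gateV.1 else 1) =
        if z a || z b then gateX.1 else 1 := by
      cases z a <;> cases z b <;> simp [gateV_mul_self]
    rw [this]
    cases z a || z b
    · simp [act1_one]
    · simp [act1_gateX]
  · intro v
    have e : Function.update (Function.update (Function.update z b (xor (z b) (z a))) t v) b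
        (xor (Function.update (Function.update z b (xor (z b) (z a))) t v b)
          (Function.update (Function.update z b (xor (z b) (z a))) t v a)) = Function.update z t v := by
      funext s
      by_cases hs : s = b
      · subst hs
        simp [hbt, hat, hab, Function.update_of_ne]
      · by_cases hst : s = t
        · subst hst; simp [Function.update_of_ne hs]
        · simp [Function.update_apply, hs, hst]
    rw [act_ctrlGate_X, e, mux]
    have e1 : Function.update z t v b = z b := Function.update_of_ne hbt _ _
    rw [e1]
    refine act1_congr rfl fun v' => ?_
    rw [mux]
    have e2 : Function.update (Function.update z t v) t v' a = z a := by
      rw [Function.update_idem, Function.update_of_ne hat]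
    rw [e2]

theorem circuitTime_orGate {a b t : Fin q} (hab : a ≠ b) (hat : a ≠ t) (hbt : b ≠ t) (T : ℕ) :
    circuitTime T (orGate (d := d) a b t hab hat hbt) = 5 := rfl

theorem loadFree_ctrlGate {k t : Fin q} (h : k ≠ t) (g : Matrix.unitaryGroup Bool ℂ) :
    (ctrlGate (d := d) k t h g).LoadFree := trivial

end Gates

/-! ### A register of control qubits next to a working register -/

section Slices

variable {d q r : ℕ} {R S : Matrix.unitaryGroup (Bits (dataQubits d)) ℂ}

/-- The state of the second register if the first one holds `u`. -/
def slice (ψ : Bits (q + r) → ℂ) (u : Bits q) : Bits r → ℂ := fun h => ψ (Fin.append u h)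

theorem update_append_left (u : Bits q) (h : Bits r) (c : Fin q) (b : Bool) :
    Function.update (Fin.append u h) (Fin.castAdd r c) b = Fin.append (Function.update u c b) h := by
  funext s
  refine Fin.addCases (fun i => ?_) (fun i => ?_) s
  · by_cases hi : i = c
    · subst hi; simp
    · rw [Function.update_of_ne (fun e => hi (Fin.castAdd_injective _ _ e)), Fin.append_left,
        Fin.append_left, Function.update_of_ne hi]
  · rw [Function.update_of_ne (by simp [Fin.ext_iff]; omega), Fin.append_right, Fin.append_right]

theorem update_append_right (u : Bits q) (h : Bits r) (c : Fin r) (b : Bool) :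
    Function.update (Fin.append u h) (Fin.natAdd q c) b = Fin.append u (Function.update h c b) := by
  funext s
  refine Fin.addCases (fun i => ?_) (fun i => ?_) s
  · rw [Function.update_of_ne (by simp [Fin.ext_iff]; omega), Fin.append_left, Fin.append_left]
  · by_cases hi : i = c
    · subst hi; simp
    · rw [Function.update_of_ne (fun e => hi (Fin.natAdd_injective _ _ e)), Fin.append_right,
        Fin.append_right, Function.update_of_ne hi]

theorem castAdd_ne_natAdd (c : Fin q) (t : Fin r) : Fin.castAdd r c ≠ Fin.natAdd q t := by
  simp [Fin.ext_iff]; omega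

theorem extend_natAdd_append (u : Bits q) (h y : Bits r) :
    Function.extend (Fin.natAddEmb q) y (Fin.append u h) = Fin.append u y := by
  funext s
  refine Fin.addCases (fun i => ?_) (fun i => ?_) s
  · rw [Fin.append_left, extend_apply_of_ne _ _ _ fun t => (castAdd_ne_natAdd i t).symm,
      Fin.append_left]
  · rw [Fin.append_right]
    exact (Fin.natAddEmb q).injective.extend_apply y _ i

theorem slice_relabel (C : List (Instr d r)) (ψ : Bits (q + r) → ℂ) (u : Bits q) :
    slice (circuitEnd R S (C.map (Instr.relabel (Fin.natAddEmb q))) ψ) u =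
      circuitEnd R S C (slice ψ u) := by
  funext h
  rw [slice, circuitEnd_relabel]
  simp only [extend_natAdd_append]
  exact congrArg _ (funext fun t => Fin.append_right u h t)

theorem slice_ctrlGate (c : Fin q) (t : Fin r) (g : Matrix.unitaryGroup Bool ℂ)
    (ψ : Bits (q + r) → ℂ) (u : Bits q) :
    slice ((ctrlGate (d := d) (Fin.castAdd r c) (Fin.natAdd q t) (castAdd_ne_natAdd c t) g).act R S ψ) u =
      if u c then act1 t g.1 (slice ψ u) else slice ψ u := by
  funext h
  rw [slice, act_ctrlGate, Fin.append_left]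
  cases u c
  · rfl
  · simp only [if_true, act1, Fin.append_right, update_append_right, slice]

theorem slice_singleGate (c : Fin q) (k : Fin r) (g : Matrix.unitaryGroup Bool ℂ)
    (ψ : Bits (q + r) → ℂ) (u : Bits q) :
    slice ((singleGate (d := d) (Fin.natAdd q k) (Fin.castAdd r c) (castAdd_ne_natAdd c k).symm g).act
      R S ψ) u = g.1 (u c) false • slice ψ (Function.update u c false) +
        g.1 (u c) true • slice ψ (Function.update u c true) := by
  funext h
  rw [slice, act_singleGate]
  simp only [act1, Fin.append_left, update_append_left, slice, Pi.add_apply, Pi.smul_apply, smul_eq_mul]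

theorem slice_cnot {k t : Fin q} (h : k ≠ t) (ψ : Bits (q + r) → ℂ) (u : Bits q) :
    slice ((ctrlGate (d := d) (Fin.castAdd r k) (Fin.castAdd r t)
      (fun e => h (Fin.castAdd_injective _ _ e)) gateX).act R S ψ) u =
      slice ψ (Function.update u t (xor (u t) (u k))) := by
  funext h
  rw [slice, act_ctrlGate_X, Fin.append_left, Fin.append_left, update_append_left]
  rfl

end Slices

/-! ### The quantum walk -/

section Walk
open ComplexConjugate

variable {d : ℕ}

/-- The data qubits, one qubit that selects a query, and the qubits of a chain of disjunctions. -/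
abbrev walkQubits (d : ℕ) : ℕ := (dataQubits d + 1) + (dataQubits d + 2)

/-- The data qubits and the selection qubit. -/
def sysQubit (j : Fin (dataQubits d + 1)) : Fin (walkQubits d) := Fin.castAdd _ j

/-- The qubits of the chain. -/
def chainQubit (j : Fin (dataQubits d + 2)) : Fin (walkQubits d) := Fin.natAdd _ j

/-- The selection qubit. -/
def selQubit (d : ℕ) : Fin (walkQubits d) := sysQubit (Fin.last _)

/-- The end of the chain. -/
def flagQubit (d : ℕ) : Fin (walkQubits d) := chainQubit (Fin.last _)

/-- The data qubits. -/
def dataEmb (d : ℕ) : Fin (dataQubits d) ↪ Fin (walkQubits d) :=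
  Fin.castSuccEmb.trans (Fin.castAddEmb _)

theorem sysQubit_ne_chainQubit (i : Fin (dataQubits d + 1)) (j : Fin (dataQubits d + 2)) :
    sysQubit i ≠ chainQubit j := castAdd_ne_natAdd i j

theorem dataEmb_ne_selQubit (t : Fin (dataQubits d)) : dataEmb d t ≠ selQubit d := by
  intro h
  have : (t : ℕ) = dataQubits d := congrArg Fin.val h
  omega

theorem dataEmb_ne_chainQubit (t : Fin (dataQubits d)) (j) : dataEmb d t ≠ chainQubit j :=
  sysQubit_ne_chainQubit t.castSucc j

theorem flagQubit_ne_selQubit : flagQubit d ≠ selQubit d := (sysQubit_ne_chainQubit _ _).symm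

theorem chainQubit_ne {i j : ℕ} {hi : i < dataQubits d + 2} {hj : j < dataQubits d + 2} (h : i ≠ j) :
    chainQubit (d := d) ⟨i, hi⟩ ≠ chainQubit ⟨j, hj⟩ := fun e =>
  h (congrArg Fin.val (Fin.natAdd_injective _ _ e))

variable (d) in
/-- Preparation of `2^{-1/2} (|0⟩|x_*⟩ + |1⟩|x_i⟩)`. -/
noncomputable def prepCircuit : List (Instr d (walkQubits d)) :=
  [singleGate _ _ flagQubit_ne_selQubit gateH,
    .row false (selQubit d) (dataEmb d) dataEmb_ne_selQubit,
    singleGate _ _ flagQubit_ne_selQubit gateX,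
    .test false (selQubit d) (dataEmb d) dataEmb_ne_selQubit,
    singleGate _ _ flagQubit_ne_selQubit gateX]

/-- Computes the disjunctions of the first `k` system qubits, in reverse order of application. -/
noncomputable def chainCircuit : (k : ℕ) → k ≤ dataQubits d + 1 → List (Instr d (walkQubits d))
  | 0, _ => []
  | k + 1, h => orGate (sysQubit ⟨k, h⟩) (chainQubit ⟨k, by omega⟩) (chainQubit ⟨k + 1, by omega⟩)
      (sysQubit_ne_chainQubit _ _) (sysQubit_ne_chainQubit _ _)
      (chainQubit_ne (Nat.lt_succ_self k).ne) ++ chainCircuit k (by omega)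

variable (d) in
/-- Preparation of the walk state after uncomputing the chain. -/
noncomputable def walkBasis : List (Instr d (walkQubits d)) :=
  chainCircuit (dataQubits d + 1) le_rfl ++ prepCircuit d

variable (d) in
/-- One step of the quantum walk. -/
noncomputable def walkCircuit : List (Instr d (walkQubits d)) :=
  singleGate _ _ flagQubit_ne_selQubit gateX :: (inverseCircuit (walkBasis d) ++
    singleGate _ _ flagQubit_ne_selQubit.symm gateZ :: walkBasis d)

/-- One step of the quantum walk, controlled on the qubit `c` of a further register. -/
noncomputable def ctrlWalk {q : ℕ} (c : Fin q) : List (Instr d (q + walkQubits d)) :=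
  ctrlGate (Fin.castAdd _ c) (Fin.natAdd q (selQubit d)) (castAdd_ne_natAdd _ _) gateX ::
    ((inverseCircuit (walkBasis d)).map (Instr.relabel (Fin.natAddEmb q)) ++
      ctrlGate (Fin.castAdd _ c) (Fin.natAdd q (flagQubit d)) (castAdd_ne_natAdd _ _) gateZ ::
        (walkBasis d).map (Instr.relabel (Fin.natAddEmb q)))

variable {R S : Matrix.unitaryGroup (Bits (dataQubits d)) ℂ}

theorem inverse_inverse {q : ℕ} (g : Instr d q) : g.inverse.inverse = g := by
  cases g <;> simp [Instr.inverse]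

theorem inverseCircuit_inverseCircuit {q : ℕ} (C : List (Instr d q)) :
    inverseCircuit (inverseCircuit C) = C := by
  rw [inverseCircuit, inverseCircuit, List.map_reverse, List.reverse_reverse, List.map_map]
  have : (Instr.inverse ∘ Instr.inverse : Instr d q → Instr d q) = id := funext inverse_inverse
  rw [this, List.map_id]

theorem circuitEnd_inverseCircuit' {q : ℕ} (C : List (Instr d q)) (ψ : Bits q → ℂ) :
    circuitEnd R S C (circuitEnd R S (inverseCircuit C) ψ) = ψ := by
  have := circuitEnd_inverseCircuit (R := R) (S := S) (inverseCircuit C) ψ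
  rwa [inverseCircuit_inverseCircuit] at this

/-- Only the flip and the sign change carry the extra control. When it is off, the basis change
cancels with its inverse, so no query needs a second control. -/
theorem slice_ctrlWalk {q : ℕ} (c : Fin q) (ψ : Bits (q + walkQubits d) → ℂ) (u : Bits q) :
    slice (circuitEnd R S (ctrlWalk (d := d) c) ψ) u =
      if u c then circuitEnd R S (walkCircuit d) (slice ψ u) else slice ψ u := by
  rw [ctrlWalk, circuitEnd_cons, circuitEnd_append, circuitEnd_cons, slice_relabel, slice_ctrlGate,
    slice_relabel, slice_ctrlGate]
  cases u c
  · simp only [Bool.false_eq_true, if_false, circuitEnd_inverseCircuit']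
  · simp only [if_true, walkCircuit, circuitEnd_cons, circuitEnd_append, act_singleGate]

/-- Coherent superposition, over the values of the selection qubit, of states of the data qubits. -/
def selState (α : Bool → Bits (dataQubits d) → ℂ) : Bits (walkQubits d) → ℂ := fun z =>
  if ∀ j, z (chainQubit j) = false then α (z (selQubit d)) (z ∘ dataEmb d) else 0

theorem update_sel_chain (z : Bits (walkQubits d)) (b : Bool) (j) :
    Function.update z (selQubit d) b (chainQubit j) = z (chainQubit j) :=
  Function.update_of_ne (sysQubit_ne_chainQubit _ _).symm _ _

theorem update_sel_data (z : Bits (walkQubits d)) (b : Bool) :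
    Function.update z (selQubit d) b ∘ dataEmb d = z ∘ dataEmb d :=
  funext fun t => Function.update_of_ne (dataEmb_ne_selQubit t) _ _

theorem act1_selState (G : Matrix Bool Bool ℂ) (α : Bool → Bits (dataQubits d) → ℂ) :
    act1 (selQubit d) G (selState α) =
      selState fun b y => G b false * α false y + G b true * α true y := by
  funext z
  simp only [act1, selState, update_sel_chain, update_sel_data, Function.update_self]
  split_ifs <;> simp

theorem applyControlled_selState (M : Matrix (Bits (dataQubits d)) (Bits (dataQubits d)) ℂ)
    (α : Bool → Bits (dataQubits d) → ℂ) :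
    applyControlled (selQubit d) (dataEmb d) M (selState α) =
      selState fun b y => if b then M.mulVec (α true) y else α b y := by
  funext z
  have h1 : ∀ y j, Function.extend (dataEmb d) y z (chainQubit j) = z (chainQubit j) :=
    fun y j => extend_apply_of_ne _ _ _ fun t => dataEmb_ne_chainQubit t j
  have h2 : ∀ y, Function.extend (dataEmb d) y z (selQubit d) = z (selQubit d) :=
    fun y => extend_apply_of_ne _ _ _ dataEmb_ne_selQubit
  simp only [applyControlled, applyOn, selState, h1, h2, extend_comp_emb]
  by_cases hc : ∀ j, z (chainQubit j) = false
  · cases hs : z (selQubit d)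
    · simp [hc]
    · simp [hc, Matrix.mulVec, dotProduct]
  · simp [hc]

theorem zeroBits_chainQubit (d : ℕ) (j) : zeroBits (walkQubits d) (chainQubit j) = false := rfl

theorem zero_eq_selState : Pi.single (zeroBits (walkQubits d)) (1 : ℂ) =
    selState fun b => if b then 0 else Pi.single (zeroBits _) 1 := by
  funext z
  by_cases hz : z = zeroBits _
  · subst hz
    rw [Pi.single_eq_same, selState, if_pos (zeroBits_chainQubit d)]
    have : zeroBits (walkQubits d) ∘ dataEmb d = zeroBits _ := rfl
    rw [this]
    simp [zeroBits]
  · rw [Pi.single_eq_of_ne hz, selState]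
    by_cases hc : ∀ j, z (chainQubit j) = false
    · rw [if_pos hc]
      cases hs : z (selQubit d)
      · simp only [Bool.false_eq_true, if_false]
        rw [Pi.single_eq_of_ne]
        intro h
        apply hz
        funext k
        refine Fin.addCases (fun i => ?_) (fun i => hc i) k
        refine Fin.lastCases hs (fun t => ?_) i
        exact congrFun h t
      · simp
    · rw [if_neg hc]

/-- The prepared state. -/
theorem circuitEnd_prepCircuit : circuitEnd R S (prepCircuit d) (Pi.single (zeroBits _) 1) =
    selState fun b y => (((Real.sqrt 2)⁻¹ : ℝ) : ℂ) *
      if b then R.1 y (zeroBits _) else S.1 y (zeroBits _) := by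
  have hsteps : ∀ ψ, circuitEnd R S (prepCircuit d) ψ =
      act1 (selQubit d) gateX.1 (applyControlled (selQubit d) (dataEmb d) (orInverse false S)
        (act1 (selQubit d) gateX.1 (applyControlled (selQubit d) (dataEmb d) (orInverse false R)
          (act1 (selQubit d) gateH.1 ψ)))) := fun ψ => by
    simp only [prepCircuit, circuitEnd_cons, circuitEnd_nil, act_singleGate]
    rfl
  rw [hsteps, zero_eq_selState]
  simp only [act1_selState, applyControlled_selState]
  congr 1
  funext b y
  have hR : ∀ (M : Matrix (Bits (dataQubits d)) (Bits (dataQubits d)) ℂ) (c : ℂ),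
      M.mulVec (fun y => c * (Pi.single (zeroBits (dataQubits d)) 1 : Bits (dataQubits d) → ℂ) y) y =
        c * M y (zeroBits _) := fun M c => by
    simp [Matrix.mulVec, dotProduct, Pi.single_apply, mul_comm]
  have hc := hR R.1 ((Real.sqrt 2)⁻¹ : ℝ)
  have hc' := hR S.1 ((Real.sqrt 2)⁻¹ : ℝ)
  simp only [Complex.ofReal_inv] at hc hc'
  cases b <;> simp [gateX, gateH, orInverse, hc, hc']

/-- Overlap of the prepared state with the state with exchanged vectors. -/
theorem circuitEnd_inverse_prepCircuit {ρ : ℝ}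
    (hρ : ∑ y, conj (R.1 y (zeroBits _)) * S.1 y (zeroBits _) = (ρ : ℂ)) :
    ∃ α : Bool → Bits (dataQubits d) → ℂ, α false (zeroBits _) = ρ ∧
      circuitEnd R S (inverseCircuit (prepCircuit d)) (act1 (selQubit d) gateX.1
        (circuitEnd R S (prepCircuit d) (Pi.single (zeroBits _) 1))) = selState α := by
  rw [circuitEnd_prepCircuit]
  have e2 : ∀ (g : Matrix.unitaryGroup Bool ℂ) (ψ : Bits (walkQubits d) → ℂ),
      (singleGate (d := d) _ _ (flagQubit_ne_selQubit (d := d)) g).inverse.act R S ψ =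
        act1 (selQubit d) (g⁻¹).1 ψ := fun g ψ => by
    have h := Instr.act_inverse_act (R := R) (S := S)
      (singleGate (d := d) _ _ (flagQubit_ne_selQubit (d := d)) g) (act1 (selQubit d) (g⁻¹).1 ψ)
    rw [act_singleGate, ← act1_mul, show g.1 * (g⁻¹).1 = 1 from congrArg Subtype.val (mul_inv_cancel g),
      act1_one] at h
    exact h
  have hr : ((Real.sqrt 2)⁻¹ : ℂ) * ((Real.sqrt 2)⁻¹ : ℂ) = 1 / 2 := by
    rw [← Complex.ofReal_inv, ← Complex.ofReal_mul, ← mul_inv, Real.mul_self_sqrt zero_le_two]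
    norm_num
  have hX : (gateX⁻¹).1 = gateX.1 := by
    show star gateX.1 = gateX.1
    ext i j
    cases i <;> cases j <;> simp [gateX, Matrix.star_apply]
  have hH : (gateH⁻¹).1 = gateH.1 := by
    show star gateH.1 = gateH.1
    ext i j
    cases i <;> cases j <;> simp [gateH, Matrix.star_apply]
  have hm : ∀ (U : Matrix.unitaryGroup (Bits (dataQubits d)) ℂ) (c : ℂ) (v : Bits (dataQubits d) → ℂ),
      (orInverse true U).mulVec (fun y => c * v y) (zeroBits _) =
        c * ∑ y, conj (U.1 y (zeroBits _)) * v y := fun U c v => by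
    rw [Matrix.mulVec, dotProduct, Finset.mul_sum]
    refine Finset.sum_congr rfl fun y _ => ?_
    show conj (U.1 y _) * _ = _
    ring
  have hρ' : ∑ y, conj (S.1 y (zeroBits _)) * R.1 y (zeroBits _) = (ρ : ℂ) := by
    have := congrArg conj hρ
    rw [map_sum, Complex.conj_ofReal] at this
    rw [← this]
    refine Finset.sum_congr rfl fun y _ => ?_
    rw [map_mul, Complex.conj_conj, mul_comm]
  have hsteps : ∀ ψ, circuitEnd R S (inverseCircuit (prepCircuit d)) ψ =
      act1 (selQubit d) gateH.1 (applyControlled (selQubit d) (dataEmb d) (orInverse true R)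
        (act1 (selQubit d) gateX.1 (applyControlled (selQubit d) (dataEmb d) (orInverse true S)
          (act1 (selQubit d) gateX.1 ψ)))) := fun ψ => by
    simp only [prepCircuit, inverseCircuit, List.map_cons, List.map_nil, List.reverse_cons,
      List.reverse_nil, List.nil_append, List.cons_append, circuitEnd_cons, circuitEnd_nil, e2, hX, hH]
    rfl
  rw [hsteps]
  simp only [act1_selState, applyControlled_selState]
  refine ⟨_, ?_, rfl⟩
  have h1 := hm S ((Real.sqrt 2)⁻¹ : ℝ) fun y => R.1 y (zeroBits _)
  have h2 := hm R ((Real.sqrt 2)⁻¹ : ℝ) fun y => S.1 y (zeroBits _)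
  rw [hρ'] at h1
  rw [hρ] at h2
  simp only [Complex.ofReal_inv] at h1 h2
  simp [gateX, gateH, h1, h2]
  linear_combination 2 * (ρ : ℂ) * hr

/-- The circuit permutes basis states and hence acts by pullback along some f, which computes in
chain qubit j the disjunction of the first j system qubits. As a pullback the circuit itself
uncomputes the chain, and its inverse computes it. -/
theorem circuitEnd_chainCircuit (k : ℕ) (hk : k ≤ dataQubits d + 1) :
    ∃ f : Bits (walkQubits d) → Bits (walkQubits d),
      (∀ ψ z, circuitEnd R S (chainCircuit k hk) ψ z = ψ (f z)) ∧
      ∀ z, (∀ j, z (chainQubit j) = false) →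
        (∀ i, f z (sysQubit i) = z (sysQubit i)) ∧
        ∀ j : Fin (dataQubits d + 2), f z (chainQubit j) =
          decide ((j : ℕ) ≤ k ∧ ∃ i : Fin (dataQubits d + 1), (i : ℕ) < j ∧ z (sysQubit i) = true) := by
  induction k with
  | zero =>
    refine ⟨id, fun ψ z => rfl, fun z hz => ⟨fun i => rfl, fun j => ?_⟩⟩
    rw [id, hz]
    symm
    rw [decide_eq_false_iff_not]
    rintro ⟨h1, i, h2, -⟩
    omega
  | succ k ih =>
    obtain ⟨f, hf, hfz⟩ := ih (by omega)
    set a := sysQubit (d := d) ⟨k, hk⟩ with ha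
    set b := chainQubit (d := d) ⟨k, by omega⟩ with hb
    set t := chainQubit (d := d) ⟨k + 1, by omega⟩ with ht
    refine ⟨fun z => Function.update (f z) t (xor (f z t) (f z a || f z b)), fun ψ z => ?_,
      fun z hz => ⟨fun i => ?_, fun j => ?_⟩⟩
    · rw [chainCircuit, circuitEnd_append, hf, circuitEnd_orGate]
    · beta_reduce
      rw [Function.update_of_ne (sysQubit_ne_chainQubit _ _), (hfz z hz).1]
    · beta_reduce
      by_cases hj : chainQubit j = t
      · have hj' : j = ⟨k + 1, by omega⟩ := by
          have := congrArg Fin.val hj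
          simp only [chainQubit, ht, Fin.val_natAdd] at this
          exact Fin.ext (by simpa using this)
        rw [hj, Function.update_self, ht, (hfz z hz).2, ha, (hfz z hz).1, hb, (hfz z hz).2, hj']
        rw [Bool.eq_iff_iff]
        simp only [Nat.succ_le_iff, lt_irrefl, false_and, decide_false, Bool.false_bne, Bool.or_eq_true,
          decide_eq_true_eq, le_refl, true_and]
        constructor
        · rintro (h | ⟨i, h1, h2⟩)
          · exact ⟨⟨k, hk⟩, Nat.lt_succ_self k, h⟩
          · exact ⟨i, Nat.lt_succ_of_lt h1, h2⟩
        · rintro ⟨i, h1, h2⟩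
          rcases Nat.lt_succ_iff_lt_or_eq.1 h1 with h1 | h1
          · exact Or.inr ⟨i, h1, h2⟩
          · left
            convert h2
            exact h1.symm
      · rw [Function.update_of_ne hj, (hfz z hz).2]
        have hjk : (j : ℕ) ≠ k + 1 := fun h => hj (by rw [ht]; congr 1; exact Fin.ext h)
        rw [Bool.eq_iff_iff, decide_eq_true_eq, decide_eq_true_eq]
        have : (j : ℕ) ≤ k ↔ (j : ℕ) ≤ k + 1 := by omega
        rw [this]

/-- The flag says whether some system qubit is set, so Z on it, conjugated by the chain, is the
reflection 2|0⟩⟨0| - 1 on states with cleared chain. -/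
theorem circuitEnd_reflection (α : Bool → Bits (dataQubits d) → ℂ) :
    circuitEnd R S (chainCircuit (dataQubits d + 1) le_rfl) (act1 (flagQubit d) gateZ.1
      (circuitEnd R S (inverseCircuit (chainCircuit (dataQubits d + 1) le_rfl)) (selState α))) =
      (2 * α false (zeroBits _)) • Pi.single (zeroBits _) 1 - selState α := by
  obtain ⟨f, hf, hfz⟩ := circuitEnd_chainCircuit (R := R) (S := S) (dataQubits d + 1) le_rfl
  funext z
  rw [hf, act1_gateZ, ← hf (circuitEnd R S (inverseCircuit _) _), circuitEnd_inverseCircuit']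
  simp only [Pi.sub_apply, Pi.smul_apply, smul_eq_mul]
  by_cases hc : ∀ j, z (chainQubit j) = false
  · rw [flagQubit, (hfz z hc).2]
    by_cases hz : z = zeroBits _
    · subst hz
      rw [decide_eq_false (by rintro ⟨-, i, -, hi⟩; exact absurd hi (by simp [zeroBits])),
        Pi.single_eq_same, selState, if_pos hc]
      have : zeroBits (walkQubits d) ∘ dataEmb d = zeroBits _ := rfl
      rw [this, show zeroBits (walkQubits d) (selQubit d) = false from rfl]
      simp only [Bool.false_eq_true, if_false]
      ring
    · rw [Pi.single_eq_of_ne hz, decide_eq_true]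
      · simp
      · refine ⟨by simp, ?_⟩
        by_contra! hcon
        apply hz
        funext k
        refine Fin.addCases (fun i => ?_) (fun i => hc i) k
        have := hcon i (by rw [Fin.val_last]; omega)
        exact Bool.eq_false_iff.2 this
  · have hz : z ≠ zeroBits _ := by
      rintro rfl
      exact hc fun _ => rfl
    rw [Pi.single_eq_of_ne hz, selState, if_neg hc]
    simp

variable (R S) in
/-- The walk state `2^{-1/2} (|0⟩|x_*⟩ + |1⟩|x_i⟩)`. -/
noncomputable def walkState : Bits (walkQubits d) → ℂ :=
  circuitEnd R S (prepCircuit d) (Pi.single (zeroBits _) 1)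

variable (R S) in
/-- The walk state with exchanged vectors. -/
noncomputable def walkState' : Bits (walkQubits d) → ℂ := act1 (selQubit d) gateX.1 (walkState R S)

theorem circuitEnd_inverseCircuit_append {q : ℕ} (C D : List (Instr d q)) (ψ : Bits q → ℂ) :
    circuitEnd R S (inverseCircuit (C ++ D)) ψ =
      circuitEnd R S (inverseCircuit C) (circuitEnd R S (inverseCircuit D) ψ) := by
  rw [inverseCircuit, List.map_append, List.reverse_append, circuitEnd_append, inverseCircuit,
    inverseCircuit]

/-- Conjugating the reflection about |0…0⟩ by the preparation gives the reflection about s. The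
hypothesis guarantees that the chain is clear where the reflection acts; `α false (zeroBits _)` is
the overlap with s. -/
theorem circuitEnd_walkCircuit (ψ : Bits (walkQubits d) → ℂ) {α : Bool → Bits (dataQubits d) → ℂ}
    (h : circuitEnd R S (inverseCircuit (prepCircuit d)) (act1 (selQubit d) gateX.1 ψ) = selState α) :
    circuitEnd R S (walkCircuit d) ψ =
      (2 * α false (zeroBits _)) • walkState R S - act1 (selQubit d) gateX.1 ψ := by
  rw [walkCircuit, circuitEnd_cons, circuitEnd_append, circuitEnd_cons, act_singleGate, act_singleGate,
    walkBasis, circuitEnd_inverseCircuit_append, h, circuitEnd_append, circuitEnd_reflection, map_sub,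
    map_smul, ← h, circuitEnd_inverseCircuit']
  rfl

/-- Together with `circuitEnd_walkCircuit_walkState'` this closes the walk on the span of s and s';
the characteristic polynomial is λ² - 2ρλ + 1, with roots e^{±i arccos ρ}. -/
theorem circuitEnd_walkCircuit_walkState {ρ : ℝ}
    (hρ : ∑ y, conj (R.1 y (zeroBits _)) * S.1 y (zeroBits _) = (ρ : ℂ)) :
    circuitEnd R S (walkCircuit d) (walkState R S) =
      (2 * (ρ : ℂ)) • walkState R S - walkState' R S := by
  obtain ⟨α, hα, h⟩ := circuitEnd_inverse_prepCircuit (R := R) (S := S) hρ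
  rw [circuitEnd_walkCircuit (walkState R S) h, hα]
  rfl

theorem circuitEnd_walkCircuit_walkState' :
    circuitEnd R S (walkCircuit d) (walkState' R S) = walkState R S := by
  have h : act1 (selQubit d) gateX.1 (walkState' R S) = walkState R S := by
    rw [walkState', ← act1_mul, gateX_mul_self, act1_one]
  rw [circuitEnd_walkCircuit (α := fun b => if b then 0 else Pi.single (zeroBits _) 1), h]
  · simp only [Bool.false_eq_true, if_false, Pi.single_eq_same]
    module
  · rw [h, walkState, circuitEnd_inverseCircuit, zero_eq_selState]

theorem walkState_inner_self : star (walkState R S) ⬝ᵥ walkState R S = 1 := by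
  rw [walkState, circuitEnd_isometry]
  simp

theorem walkState_inner_walkState' {ρ : ℝ}
    (hρ : ∑ y, conj (R.1 y (zeroBits _)) * S.1 y (zeroBits _) = (ρ : ℂ)) :
    star (walkState R S) ⬝ᵥ walkState' R S = ρ := by
  obtain ⟨α, hα, h⟩ := circuitEnd_inverse_prepCircuit (R := R) (S := S) hρ
  have e : walkState' R S = circuitEnd R S (prepCircuit d) (selState α) := by
    rw [← h, circuitEnd_inverseCircuit']
    rfl
  rw [e, walkState, circuitEnd_isometry]
  have : star (Pi.single (zeroBits _) 1 : Bits (walkQubits d) → ℂ) = Pi.single (zeroBits _) 1 := by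
    rw [← Pi.single_star, star_one]
  rw [this, single_dotProduct, one_mul, selState, if_pos (zeroBits_chainQubit d), ← hα]
  rfl

/-! ### Costs -/

theorem circuitTime_chainCircuit (T k : ℕ) (hk : k ≤ dataQubits d + 1) :
    circuitTime T (chainCircuit k hk) = 5 * k := by
  induction k with
  | zero => rfl
  | succ k ih =>
    rw [chainCircuit, circuitTime_append, circuitTime_orGate, ih]
    ring

theorem circuitTime_prepCircuit (T : ℕ) : circuitTime T (prepCircuit d) = 2 * T + 3 := by
  simp only [prepCircuit, circuitTime_cons, singleGate, time_muxGate, circuitTime_nil]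
  simp only [Instr.time]
  ring

theorem circuitTime_walkBasis (T : ℕ) :
    circuitTime T (walkBasis d) = 5 * (dataQubits d + 1) + (2 * T + 3) := by
  rw [walkBasis, circuitTime_append, circuitTime_chainCircuit, circuitTime_prepCircuit]

theorem circuitTime_walkCircuit (T : ℕ) :
    circuitTime T (walkCircuit d) = 4 * T + 10 * dataQubits d + 18 := by
  rw [walkCircuit, circuitTime_cons, circuitTime_append, circuitTime_cons, circuitTime_inverseCircuit,
    circuitTime_walkBasis]
  simp only [singleGate, time_muxGate]
  ring

theorem circuitTime_ctrlWalk (T : ℕ) {q : ℕ} (c : Fin q) :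
    circuitTime T (ctrlWalk (d := d) c) = 4 * T + 10 * dataQubits d + 18 := by
  rw [ctrlWalk, circuitTime_cons, circuitTime_append, circuitTime_cons, circuitTime_relabel,
    circuitTime_relabel, circuitTime_inverseCircuit, circuitTime_walkBasis]
  simp only [ctrlGate, time_muxGate]
  ring

theorem loadFree_append {q : ℕ} {C D : List (Instr d q)} (hC : ∀ g ∈ C, g.LoadFree)
    (hD : ∀ g ∈ D, g.LoadFree) : ∀ g ∈ C ++ D, g.LoadFree := fun g hg =>
  (List.mem_append.1 hg).elim (hC g) (hD g)

theorem loadFree_cons {q : ℕ} {C : List (Instr d q)} {g : Instr d q} (hg : g.LoadFree)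
    (hC : ∀ g ∈ C, g.LoadFree) : ∀ g' ∈ g :: C, g'.LoadFree :=
  List.forall_mem_cons.2 ⟨hg, hC⟩

theorem loadFree_prepCircuit : ∀ g ∈ prepCircuit d, g.LoadFree := by
  rw [prepCircuit]
  repeat' refine loadFree_cons ?_ ?_
  all_goals first | trivial | simp

theorem loadFree_orGate {q : ℕ} {a b t : Fin q} (hab : a ≠ b) (hat : a ≠ t) (hbt : b ≠ t) :
    ∀ g ∈ orGate (d := d) a b t hab hat hbt, g.LoadFree := by
  rw [orGate]
  repeat' refine loadFree_cons (loadFree_ctrlGate _ _) ?_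
  simp

theorem loadFree_chainCircuit (k : ℕ) (hk : k ≤ dataQubits d + 1) :
    ∀ g ∈ chainCircuit k hk, g.LoadFree := by
  induction k with
  | zero => simp [chainCircuit]
  | succ k ih =>
    rw [chainCircuit]
    exact loadFree_append (loadFree_orGate _ _ _) (ih _)

theorem loadFree_walkBasis : ∀ g ∈ walkBasis d, g.LoadFree :=
  loadFree_append (loadFree_chainCircuit _ _) loadFree_prepCircuit

theorem loadFree_walkCircuit : ∀ g ∈ walkCircuit d, g.LoadFree :=
  loadFree_cons trivial (loadFree_append (loadFree_inverseCircuit loadFree_walkBasis)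
    (loadFree_cons trivial loadFree_walkBasis))

theorem loadFree_ctrlWalk {q : ℕ} (c : Fin q) : ∀ g ∈ ctrlWalk (d := d) c, g.LoadFree :=
  loadFree_cons trivial (loadFree_append
    (loadFree_relabel _ (loadFree_inverseCircuit loadFree_walkBasis))
    (loadFree_cons trivial (loadFree_relabel _ loadFree_walkBasis)))

end Walk

/-! ### Polynomials of the walk -/

section WalkPolynomial
open Polynomial ComplexConjugate

theorem star_star_dotProduct {ι : Type*} [Fintype ι] (φ ψ : ι → ℂ) :
    star (star φ ⬝ᵥ ψ) = star ψ ⬝ᵥ φ := by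
  simp [dotProduct, star_sum, mul_comm]

/-- Inner products of polynomials of a walk operator, applied to its initial state, in terms of the
eigenvalues `e^{± iθ}`. -/
theorem inner_aeval_walk {ι : Type*} [Fintype ι] {W : Module.End ℂ (ι → ℂ)} {s s' : ι → ℂ} {θ : ℝ}
    (hW : ∀ φ ψ, star (W φ) ⬝ᵥ W ψ = star φ ⬝ᵥ ψ)
    (h1 : W s = (2 * (Real.cos θ : ℂ)) • s - s') (h2 : W s' = s)
    (h3 : star s ⬝ᵥ s = 1) (h4 : star s ⬝ᵥ s' = (Real.cos θ : ℂ)) (F G : ℂ[X]) :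
    star (aeval W F s) ⬝ᵥ aeval W G s =
      (conj (F.eval (Complex.exp (θ * Complex.I))) * G.eval (Complex.exp (θ * Complex.I)) +
        conj (F.eval (Complex.exp ((-θ : ℝ) * Complex.I))) *
          G.eval (Complex.exp ((-θ : ℝ) * Complex.I))) / 2 := by
  set l := Complex.exp (θ * Complex.I) with hl
  set m := Complex.exp ((-θ : ℝ) * Complex.I) with hm
  have hlm : l * m = 1 := by
    rw [hl, hm, ← Complex.exp_add]
    simp
  have hsum : l + m = 2 * (Real.cos θ : ℂ) := by
    rw [Complex.ofReal_cos, Complex.cos, hl, hm]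
    push_cast
    ring
  have hcl : conj l = m := by
    rw [hl, hm, ← Complex.exp_conj]
    simp
  have hcm : conj m = l := by rw [← hcl, Complex.conj_conj]
  -- The moments obey the Chebyshev recursion, so they equal cos kθ. As no eigenvectors are formed,
  -- the degenerate case cos θ = ±1 needs no separate treatment.
  have hrec : ∀ k : ℕ, star s ⬝ᵥ (W ^ k) s = (l ^ k + m ^ k) / 2 := by
    intro k
    induction k using Nat.twoStepInduction with
    | zero => simp [h3]
    | one =>
      rw [pow_one, h1, dotProduct_sub, dotProduct_smul, h3, h4, pow_one, pow_one, hsum]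
      simp only [smul_eq_mul]
      ring
    | more k ih1 ih2 =>
      have e : (W ^ (k + 2)) s = (2 * (Real.cos θ : ℂ)) • (W ^ (k + 1)) s - (W ^ k) s := by
        rw [pow_succ, Module.End.mul_apply, h1, map_sub, map_smul, pow_succ W k,
          Module.End.mul_apply, Module.End.mul_apply, h2]
      rw [e, dotProduct_sub, dotProduct_smul, ih1, ih2, ← hsum, smul_eq_mul]
      have e1 : l ^ (k + 2) = l ^ (k + 1) * l := pow_succ _ _
      have e2 : m ^ (k + 2) = m ^ (k + 1) * m := pow_succ _ _
      have e3 : l ^ (k + 1) * m = l ^ k := by rw [pow_succ, mul_assoc, hlm, mul_one]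
      have e4 : m ^ (k + 1) * l = m ^ k := by rw [pow_succ, mul_assoc, mul_comm m, hlm, mul_one]
      rw [e1, e2]
      linear_combination (1 / 2 : ℂ) * e3 + (1 / 2 : ℂ) * e4
  have hiso : ∀ k φ ψ, star ((W ^ k) φ) ⬝ᵥ (W ^ k) ψ = star φ ⬝ᵥ ψ := by
    intro k
    induction k with
    | zero => intro φ ψ; rfl
    | succ k ih => intro φ ψ; rw [pow_succ', Module.End.mul_apply, Module.End.mul_apply, hW, ih]
  have hle : ∀ k j : ℕ, star ((W ^ k) s) ⬝ᵥ (W ^ (k + j)) s =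
      (m ^ k * l ^ (k + j) + l ^ k * m ^ (k + j)) / 2 := by
    intro k j
    rw [pow_add, Module.End.mul_apply, hiso, hrec, pow_add, pow_add, ← mul_assoc, ← mul_assoc,
      ← mul_pow, ← mul_pow, mul_comm m l, hlm, one_pow, one_mul, one_mul]
  have hpow : ∀ k j : ℕ, star ((W ^ k) s) ⬝ᵥ (W ^ j) s = (m ^ k * l ^ j + l ^ k * m ^ j) / 2 := by
    intro k j
    rcases le_total k j with h | h
    · obtain ⟨i, rfl⟩ := Nat.exists_eq_add_of_le h
      exact hle k i
    · obtain ⟨i, rfl⟩ := Nat.exists_eq_add_of_le h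
      have h5 := congrArg star (hle j i)
      rw [star_star_dotProduct] at h5
      rw [h5]
      simp only [RCLike.star_def, map_div₀, map_add, map_mul, map_pow, hcl, hcm, Complex.conj_ofNat]
      ring
  induction F using Polynomial.induction_on' with
  | add F F' ih ih' =>
    rw [map_add, LinearMap.add_apply, star_add, add_dotProduct, ih, ih']
    simp only [eval_add, map_add]
    ring
  | monomial k a =>
    induction G using Polynomial.induction_on' with
    | add G G' ih ih' =>
      rw [map_add, LinearMap.add_apply, dotProduct_add, ih, ih']
      simp only [eval_add]
      ring
    | monomial j b =>
      rw [aeval_monomial, aeval_monomial, Module.End.mul_apply, Module.End.mul_apply,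
        Module.algebraMap_end_apply, Module.algebraMap_end_apply, star_smul, smul_dotProduct,
        dotProduct_smul, hpow]
      simp only [eval_monomial, map_mul, map_pow, hcl, hcm, smul_eq_mul, RCLike.star_def]
      ring

variable {d q : ℕ} {R S : Matrix.unitaryGroup (Bits (dataQubits d)) ℂ}

/-- A circuit for quantum signal processing of the walk, with signal qubit `c`. -/
noncomputable def qspCircuit (c : Fin q) (g₀ : Matrix.unitaryGroup Bool ℂ) :
    List (Matrix.unitaryGroup Bool ℂ) → List (Instr d (q + walkQubits d))
  | [] => [singleGate (Fin.natAdd q (selQubit d)) (Fin.castAdd _ c) (castAdd_ne_natAdd c _).symm g₀]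
  | g :: gs => qspCircuit c g₀ gs ++ (ctrlWalk c ++
      [singleGate (Fin.natAdd q (selQubit d)) (Fin.castAdd _ c) (castAdd_ne_natAdd c _).symm g])

/-- The remaining qubits of the control register are spectators, which later allows several signal
qubits to be processed one after another. -/
theorem slice_qspCircuit (c : Fin q) (g₀ : Matrix.unitaryGroup Bool ℂ)
    (gs : List (Matrix.unitaryGroup Bool ℂ)) (ψ : Bits (q + walkQubits d) → ℂ) (u : Bits q) :
    (fun b => slice (circuitEnd R S (qspCircuit (d := d) c g₀ gs) ψ) (Function.update u c b)) =
      qspPair (circuitEnd R S (walkCircuit d)) g₀ gs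
        fun b => slice ψ (Function.update u c b) := by
  induction gs with
  | nil =>
    funext b
    rw [qspCircuit, circuitEnd_cons, circuitEnd_nil, slice_singleGate]
    simp only [Function.update_self, Function.update_idem, qspPair, rotPair]
  | cons g gs ih =>
    funext b
    rw [qspCircuit, circuitEnd_append, circuitEnd_append, circuitEnd_cons, circuitEnd_nil,
      slice_singleGate, slice_ctrlWalk, slice_ctrlWalk, Function.update_self, Function.update_idem,
      Function.update_self, Function.update_idem, Function.update_self]
    have h : ∀ b, slice (circuitEnd R S (qspCircuit (d := d) c g₀ gs) ψ) (Function.update u c b) =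
        qspPair (circuitEnd R S (walkCircuit d)) g₀ gs (fun b => slice ψ (Function.update u c b)) b :=
      fun b => congrFun ih b
    rw [h, h]
    simp only [qspPair, rotPair, ctrlPair]

theorem circuitTime_qspCircuit (T : ℕ) (c : Fin q) (g₀ : Matrix.unitaryGroup Bool ℂ)
    (gs : List (Matrix.unitaryGroup Bool ℂ)) :
    circuitTime T (qspCircuit (d := d) c g₀ gs) =
      gs.length * (4 * T + 10 * dataQubits d + 19) + 1 := by
  induction gs with
  | nil => rw [qspCircuit, circuitTime_cons]; simp [singleGate]
  | cons g gs ih =>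
    rw [qspCircuit, circuitTime_append, circuitTime_append, ih, circuitTime_ctrlWalk, circuitTime_cons,
      circuitTime_nil, singleGate, time_muxGate, List.length_cons]
    ring

theorem loadFree_qspCircuit (c : Fin q) (g₀ : Matrix.unitaryGroup Bool ℂ)
    (gs : List (Matrix.unitaryGroup Bool ℂ)) : ∀ g ∈ qspCircuit (d := d) c g₀ gs, g.LoadFree := by
  induction gs with
  | nil => exact loadFree_cons trivial (by simp)
  | cons g gs ih =>
    exact loadFree_append ih (loadFree_append (loadFree_ctrlWalk c) (loadFree_cons trivial (by simp)))

/-- A polynomial of the walk that is less than `1` on the circle is realized, as the amplitude of an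
initially cleared qubit `c` being cleared, by a circuit. -/
theorem exists_qspCircuit {N : ℕ} {P : ℂ[X]} (hP : P.natDegree ≤ N)
    (h1 : ∀ z : ℂ, ‖z‖ = 1 → ‖P.eval z‖ < 1) :
    ∃ Q : ℂ[X], (∀ z : ℂ, ‖z‖ = 1 → ‖P.eval z‖ ^ 2 + ‖Q.eval z‖ ^ 2 = 1) ∧
      ∀ (d q : ℕ) (c : Fin q), ∃ C : List (Instr d (q + walkQubits d)),
        (∀ g ∈ C, g.LoadFree) ∧
        (∀ T, circuitTime T C = N * (4 * T + 10 * dataQubits d + 19) + 1) ∧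
        ∀ R S (ψ : Bits (q + walkQubits d) → ℂ),
          (∀ u, u c = true → slice ψ u = 0) → ∀ u,
          slice (circuitEnd R S C ψ) u =
            aeval (circuitEnd R S (walkCircuit d)) (if u c then Q else P)
              (slice ψ (Function.update u c false)) := by
  obtain ⟨Q, hQ, hPQ⟩ := exists_complementary hP h1
  obtain ⟨g₀, gs, hlen, hgs⟩ := exists_qspPair N P Q hP hQ hPQ
  refine ⟨Q, hPQ, fun d q c => ⟨qspCircuit c g₀ gs, loadFree_qspCircuit c g₀ gs, fun T => ?_,
    fun R S ψ hψ u => ?_⟩⟩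
  · rw [circuitTime_qspCircuit, hlen]
  · have h := congrFun (slice_qspCircuit (R := R) (S := S) c g₀ gs ψ u) (u c)
    have h0 : (fun b => slice ψ (Function.update u c b)) =
        fun b => if b then 0 else slice ψ (Function.update u c false) := by
      funext b
      cases b
      · rfl
      · exact hψ _ (Function.update_self _ _ _)
    simp only [Function.update_eq_self] at h
    rw [h, h0, hgs]
    cases u c <;> rfl

end WalkPolynomial

/-! ### Amplitude-encoded data -/

section Data
open ComplexConjugate

theorem binary_injective {b i j : ℕ} (hi : i < 2 ^ b) (hj : j < 2 ^ b) (h : binary b i = binary b j) :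
    i = j := by
  refine Nat.eq_of_testBit_eq fun t => ?_
  rcases lt_or_ge t b with ht | ht
  · exact congrFun h ⟨t, ht⟩
  · rw [Nat.testBit_lt_two_pow (hi.trans_le (Nat.pow_le_pow_right two_pos ht)),
      Nat.testBit_lt_two_pow (hj.trans_le (Nat.pow_le_pow_right two_pos ht))]

theorem sum_amplitudeEncoding {d : ℕ} {x xs : EuclideanSpace ℝ (Fin d)} (hx : ‖x‖ = 1) (hxs : ‖xs‖ = 1) :
    ∑ y, conj (amplitudeEncoding x y) * amplitudeEncoding xs y = ((inner ℝ xs x : ℝ) : ℂ) := by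
  have hinj : ∀ j k : Fin d, binary (dataQubits d) j = binary (dataQubits d) k ↔ j = k := fun j k =>
    ⟨fun h => Fin.ext (binary_injective (j.2.trans_le (Nat.le_pow_clog one_lt_two d))
      (k.2.trans_le (Nat.le_pow_clog one_lt_two d)) h), fun h => by rw [h]⟩
  simp only [amplitudeEncoding, map_sum, Finset.sum_mul, Finset.mul_sum, hx, hxs, div_one]
  rw [Finset.sum_comm]
  rw [PiLp.inner_apply, Complex.ofReal_sum]
  refine Finset.sum_congr rfl fun j _ => ?_
  rw [Finset.sum_comm, Finset.sum_eq_single j]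
  · rw [Finset.sum_eq_single (binary (dataQubits d) j)]
    · simp
    · intro y _ hy
      rw [if_neg hy.symm, map_zero, zero_mul]
    · simp
  · intro k _ hk
    refine Finset.sum_eq_zero fun y _ => ?_
    by_cases h1 : binary (dataQubits d) k = y
    · have h2 : ¬ binary (dataQubits d) j = y := fun h => hk ((hinj k j).1 (h1.trans h.symm))
      rw [if_neg h2, mul_zero]
    · rw [if_neg h1, map_zero, zero_mul]
  · simp

theorem QuantumAccess.sum_row_test {n d : ℕ} [NeZero n] {x : Fin n → EuclideanSpace ℝ (Fin d)}
    {xs : EuclideanSpace ℝ (Fin d)} (Q : QuantumAccess x xs) {i : Fin n} (hx : ‖x i‖ = 1)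
    (hxs : ‖xs‖ = 1) :
    ∑ y, conj ((Q.row i).1 y (zeroBits _)) * Q.test.1 y (zeroBits _) =
      ((inner ℝ xs (x i) : ℝ) : ℂ) := by
  rw [← sum_amplitudeEncoding hx hxs]
  simp only [Q.row_spec, Q.test_spec]

end Data

/-! ### Functions of the inner product as amplitudes -/

section Amplitude
open Polynomial ComplexConjugate

variable {d q : ℕ} {R S : Matrix.unitaryGroup (Bits (dataQubits d)) ℂ}

theorem slice_single_zero (u : Bits q) (r : ℕ) :
    slice (Pi.single (zeroBits (q + r)) (1 : ℂ)) u =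
      if u = zeroBits q then Pi.single (zeroBits r) 1 else 0 := by
  have h0 : Fin.append (zeroBits q) (zeroBits r) = zeroBits (q + r) := by
    funext k
    refine Fin.addCases (fun i => ?_) (fun i => ?_) k
    · rw [Fin.append_left]; rfl
    · rw [Fin.append_right]; rfl
  funext h
  rw [slice, ← h0]
  have hiff : Fin.append u h = Fin.append (zeroBits q) (zeroBits r) ↔ u = zeroBits q ∧ h = zeroBits r := by
    constructor
    · intro e
      constructor
      · funext i; simpa [Fin.append_left] using congrFun e (Fin.castAdd r i)
      · funext i; simpa [Fin.append_right] using congrFun e (Fin.natAdd q i)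
    · rintro ⟨rfl, rfl⟩; rfl
  by_cases hu : u = zeroBits q
  · by_cases hh : h = zeroBits r
    · simp [hu, hh]
    · rw [Pi.single_eq_of_ne (fun e => hh (hiff.1 e).2), if_pos hu, Pi.single_eq_of_ne hh]
  · rw [Pi.single_eq_of_ne (fun e => hu (hiff.1 e).1), if_neg hu, Pi.zero_apply]

theorem apply_zeroBits_eq_slice (ψ : Bits (q + walkQubits d) → ℂ) :
    ψ (zeroBits _) = slice ψ (zeroBits q) (zeroBits _) := by
  rw [slice]
  congr 1
  funext k
  refine Fin.addCases (fun i => ?_) (fun i => ?_) k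
  · rw [Fin.append_left]; rfl
  · rw [Fin.append_right]; rfl

theorem circuitEnd_replicate (C : List (Instr d q)) (M : ℕ) (ψ : Bits q → ℂ) :
    circuitEnd R S (List.replicate M C).flatten ψ = (circuitEnd R S C ^ M) ψ := by
  induction M generalizing ψ with
  | zero => rfl
  | succ M ih =>
    rw [List.replicate_succ, List.flatten_cons, circuitEnd_append, ih, pow_succ, Module.End.mul_apply]

theorem circuitTime_replicate (T : ℕ) (C : List (Instr d q)) (M : ℕ) :
    circuitTime T (List.replicate M C).flatten = M * circuitTime T C := by
  induction M with
  | zero => simp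
  | succ M ih => rw [List.replicate_succ, List.flatten_cons, circuitTime_append, ih]; ring

theorem loadFree_replicate {C : List (Instr d q)} (hC : ∀ g ∈ C, g.LoadFree) (M : ℕ) :
    ∀ g ∈ (List.replicate M C).flatten, g.LoadFree := by
  induction M with
  | zero => simp
  | succ M ih => rw [List.replicate_succ, List.flatten_cons]; exact loadFree_append hC ih

/-- P(W) is applied to s, and then W^M and the preparation are undone. The amplitude at |0…0⟩ is
⟨W^M s, P(W) s⟩, where W^M cancels the factor z^M of P at the eigenvalues and leaves the real mean
of p(θ) and p(-θ). The 3M in the time is the degree 2M of P plus these M steps. -/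
theorem exists_amplitude_circuit {K : ℝ → ℝ} (hK : ∀ x, |K x| ≤ 1) {ε δ : ℝ} (hε : 0 < ε)
    (hε1 : ε ≤ 1) (hδ : 0 < δ) (hδ1 : δ < 1) {M : ℕ}
    (hM : 4 * (2 * M + 1) * Real.exp (-(M * (ε / 2))) ≤ δ) (d : ℕ) :
    ∃ C : List (Instr d (1 + walkQubits d)), (∀ g ∈ C, g.LoadFree) ∧
      (∀ T, circuitTime T C ≤ (3 * M + 2) * (4 * T + 10 * dataQubits d + 19)) ∧
      ∀ R S (ρ : ℝ), ρ ∈ Set.Icc (-1 : ℝ) 1 →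
        ∑ y, conj (R.1 y (zeroBits _)) * S.1 y (zeroBits _) = (ρ : ℂ) →
        ∃ a : ℝ, circuitEnd R S C (Pi.single (zeroBits _) 1) (zeroBits _) = (a : ℂ) ∧ |a| ≤ 1 ∧
          ∀ lo hi : ℝ, -1 ≤ lo → hi ≤ 1 →
            (∀ x ∈ Set.Icc (-1 : ℝ) 1, |x - ρ| ≤ ε → lo ≤ K x ∧ K x ≤ hi) →
            lo - 3 * δ ≤ a ∧ a ≤ hi + 3 * δ := by
  obtain ⟨P, p, hPdeg, hPp, hp1, hp⟩ := exists_filter_polynomial hK hε hε1 hδ hδ1 hM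
  have hP1 : ∀ z : ℂ, ‖z‖ = 1 → ‖P.eval z‖ < 1 := by
    intro z hz
    have hz' : z = Complex.exp (Complex.arg z * Complex.I) := by
      have := Complex.norm_mul_exp_arg_mul_I z
      rw [hz, Complex.ofReal_one, one_mul] at this
      exact this.symm
    rw [hz', hPp, norm_mul, norm_pow, Complex.norm_exp_ofReal_mul_I, one_pow, one_mul,
      Complex.norm_real, Real.norm_eq_abs]
    exact (hp1 _).trans_lt (by linarith)
  obtain ⟨Q, -, hC⟩ := exists_qspCircuit hPdeg hP1
  obtain ⟨C, hCl, hCt, hCs⟩ := hC d 1 0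
  set D := prepCircuit d ++ (List.replicate M (walkCircuit d)).flatten
  have hDl : ∀ g ∈ D, g.LoadFree :=
    loadFree_append loadFree_prepCircuit (loadFree_replicate loadFree_walkCircuit M)
  refine ⟨(prepCircuit d).map (Instr.relabel (Fin.natAddEmb 1)) ++
    (C ++ (inverseCircuit D).map (Instr.relabel (Fin.natAddEmb 1))),
    loadFree_append (loadFree_relabel _ loadFree_prepCircuit)
      (loadFree_append hCl (loadFree_relabel _ (loadFree_inverseCircuit hDl))), fun T => ?_, ?_⟩
  · rw [circuitTime_append, circuitTime_append, circuitTime_relabel, circuitTime_relabel,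
      circuitTime_inverseCircuit, circuitTime_append, circuitTime_replicate, hCt,
      circuitTime_prepCircuit, circuitTime_walkCircuit]
    have : M * (4 * T + 10 * dataQubits d + 18) ≤ M * (4 * T + 10 * dataQubits d + 19) :=
      Nat.mul_le_mul le_rfl (by omega)
    have e : (3 * M + 2) * (4 * T + 10 * dataQubits d + 19) =
      2 * M * (4 * T + 10 * dataQubits d + 19) + M * (4 * T + 10 * dataQubits d + 19) +
        2 * (4 * T + 10 * dataQubits d + 19) := by ring
    omega
  · intro R S ρ hρ hRS
    set θ := Real.arccos ρ
    have hθ : Real.cos θ = ρ := Real.cos_arccos hρ.1 hρ.2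
    refine ⟨(p θ + p (-θ)) / 2, ?_, ?_, ?_⟩
    · set W := circuitEnd R S (walkCircuit d)
      set ψ := circuitEnd R S ((prepCircuit d).map (Instr.relabel (Fin.natAddEmb 1)))
        (Pi.single (zeroBits (1 + walkQubits d)) 1)
      have hψ : ∀ u, slice ψ u = if u = zeroBits 1 then walkState R S else 0 := by
        intro u
        rw [slice_relabel, slice_single_zero]
        split_ifs
        · rfl
        · exact map_zero _
      rw [circuitEnd_append, circuitEnd_append, apply_zeroBits_eq_slice (circuitEnd R S _ _), slice_relabel,
        hCs R S ψ (fun u hu => by rw [hψ, if_neg]; rintro rfl; simp [zeroBits] at hu)]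
      have hu0 : Function.update (zeroBits 1) 0 false = zeroBits 1 := Function.update_eq_self _ _
      rw [hu0, hψ, if_pos rfl]
      simp only [zeroBits, Bool.false_eq_true, if_false]
      have h1 : ∀ φ : Bits (walkQubits d) → ℂ, φ (zeroBits _) =
          star (Pi.single (zeroBits _) 1 : Bits (walkQubits d) → ℂ) ⬝ᵥ φ := fun φ => by
        rw [← Pi.single_star, star_one, single_dotProduct, one_mul]
      have h2 : circuitEnd R S D (Pi.single (zeroBits _) 1) = aeval W (X ^ M : ℂ[X]) (walkState R S) := by
        rw [circuitEnd_append, circuitEnd_replicate, map_pow, aeval_X]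
        rfl
      show circuitEnd R S (inverseCircuit D) (aeval W P (walkState R S)) (zeroBits _) = _
      rw [h1 (circuitEnd R S (inverseCircuit D) _), circuitEnd_adjoint, inverseCircuit_inverseCircuit, h2,
        inner_aeval_walk (θ := θ) (s' := walkState' R S) (circuitEnd_isometry _)
          (by rw [hθ]; exact circuitEnd_walkCircuit_walkState hRS) circuitEnd_walkCircuit_walkState'
          walkState_inner_self (by rw [hθ]; exact walkState_inner_walkState' hRS)]
      have h3 : ∀ t : ℝ, conj ((X ^ M : ℂ[X]).eval (Complex.exp (t * Complex.I))) *
          P.eval (Complex.exp (t * Complex.I)) = p t := fun t => by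
        rw [hPp, eval_pow, eval_X, ← mul_assoc, mul_comm (conj _), Complex.mul_conj, ← Complex.sq_norm,
          norm_pow, Complex.norm_exp_ofReal_mul_I]
        simp
      rw [h3, h3]
      push_cast
      ring
    · have h1 := abs_le.1 (hp1 θ)
      have h2 := abs_le.1 (hp1 (-θ))
      rw [abs_le]
      constructor <;> linarith [h1.1, h1.2, h2.1, h2.2]
    · intro lo hi hlo hhi h
      have h1 := hp θ lo hi hlo hhi (by rwa [hθ])
      have h2 := hp (-θ) lo hi hlo hhi (by rwa [Real.cos_neg, hθ])
      constructor <;> linarith [h1.1, h1.2, h2.1, h2.2]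

end Amplitude

/-! ### Post-selection -/

section PostSelection

variable {n d q : ℕ} [NeZero n] {x : Fin n → EuclideanSpace ℝ (Fin d)}
  {xs : EuclideanSpace ℝ (Fin d)}

theorem run_uniformState (Q : QuantumAccess x xs) {C : List (Instr d q)}
    (hC : ∀ g ∈ C, g.LoadFree) :
    run Q C (uniformState n q) = superpose fun i => WithLp.toLp 2
      (circuitEnd (Q.row i) Q.test C (Pi.single (zeroBits q) 1)) := by
  ext ⟨i, z⟩
  rw [run_apply Q hC]
  have h : (fun z => uniformState n q (i, z)) =
      (((Real.sqrt n)⁻¹ : ℝ) : ℂ) • (Pi.single (zeroBits q) 1 : Bits q → ℂ) := by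
    funext z
    simp only [uniformState, superpose, Pi.smul_apply, smul_eq_mul, PiLp.single_apply,
      Pi.single_apply]
  rw [h, map_smul]
  rfl

theorem run_load_zeroState (Q : QuantumAccess x xs) (hx : ∀ i, ‖x i‖ = 1) (C : List (Instr d q)) :
    run Q (Instr.load false :: C) (zeroState n q) = run Q C (uniformState n q) := by
  have h : Instr.apply Q (Instr.load false) (zeroState n q) = uniformState n q := by
    ext ⟨i, z⟩
    show ∑ j, orInverse false Q.load i j * (if j = 0 ∧ z = zeroBits q then 1 else 0) =
      (((Real.sqrt n)⁻¹ : ℝ) : ℂ) * (EuclideanSpace.single (zeroBits q) (1 : ℂ)) z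
    rw [PiLp.single_apply, Finset.sum_eq_single 0]
    · have h0 : orInverse false Q.load i 0 = (((Real.sqrt n)⁻¹ : ℝ) : ℂ) := by
        rw [orInverse, if_neg (by simp), Q.load_spec]
        simp [hx]
      rw [h0]
      simp
    · intro j _ hj
      simp [hj]
    · simp
  rw [run, List.foldl_cons, h, run]

theorem accepted_run (Q : QuantumAccess x xs) {C : List (Instr d q)}
    (hC : ∀ g ∈ C, g.LoadFree) (i : Fin n) :
    accepted (run Q C (uniformState n q)) i = (((Real.sqrt n)⁻¹ : ℝ) : ℂ) *
      circuitEnd (Q.row i) Q.test C (Pi.single (zeroBits q) 1) (zeroBits q) := by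
  rw [run_uniformState Q hC]
  rfl

theorem acceptProb_eq {n q : ℕ} {ψ : QState n q} {a : Fin n → ℝ}
    (h : ∀ i, accepted ψ i = (((Real.sqrt n)⁻¹ : ℝ) : ℂ) * (a i : ℂ)) :
    acceptProb ψ = (∑ i, a i ^ 2) / n := by
  rw [acceptProb, EuclideanSpace.norm_sq_eq, Finset.sum_div]
  refine Finset.sum_congr rfl fun i _ => ?_
  rw [h, ← Complex.ofReal_mul, Complex.norm_real, Real.norm_eq_abs, sq_abs, mul_pow, inv_pow,
    Real.sq_sqrt (Nat.cast_nonneg n)]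
  ring

/-- With A = ∑ a² and S = ∑ k a the second factor equals 2S - A, and A (2S - A) ≤ S². -/
theorem sum_sq_mul_le {ι : Type*} (s : Finset ι) (a k : ι → ℝ) :
    (∑ i ∈ s, a i ^ 2) * (∑ i ∈ s, k i ^ 2 - ∑ i ∈ s, (a i - k i) ^ 2) ≤ (∑ i ∈ s, k i * a i) ^ 2 := by
  have h : ∑ i ∈ s, (a i - k i) ^ 2 =
      ∑ i ∈ s, a i ^ 2 + ∑ i ∈ s, k i ^ 2 - 2 * ∑ i ∈ s, k i * a i := by
    rw [Finset.mul_sum, ← Finset.sum_add_distrib, ← Finset.sum_sub_distrib]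
    exact Finset.sum_congr rfl fun i _ => by ring
  rw [h]
  nlinarith [sq_nonneg (∑ i ∈ s, k i * a i - ∑ i ∈ s, a i ^ 2)]

theorem inner_kernelState_postSelected {ψ : QState n q} {a k : Fin n → ℝ}
    (h : ∀ i, accepted ψ i = (((Real.sqrt n)⁻¹ : ℝ) : ℂ) * (a i : ℂ)) :
    ‖inner ℂ (kernelState k) (postSelected ψ)‖ ^ 2 =
      (∑ i, k i * a i) ^ 2 / ((∑ i, k i ^ 2) * ∑ i, a i ^ 2) := by
  have hn : (0 : ℝ) < n := Nat.cast_pos.2 (NeZero.pos n)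
  have hin : inner ℂ (kernelState k) (postSelected ψ) =
      (((∑ i, k i * a i) / (Real.sqrt (∑ i, k i ^ 2) * ‖accepted ψ‖ * Real.sqrt n) : ℝ) : ℂ) := by
    rw [PiLp.inner_apply, Finset.sum_div, Complex.ofReal_sum]
    refine Finset.sum_congr rfl fun i _ => ?_
    have : postSelected ψ i = (((‖accepted ψ‖)⁻¹ * ((Real.sqrt n)⁻¹ * a i) : ℝ) : ℂ) := by
      show (((‖accepted ψ‖)⁻¹ : ℝ) : ℂ) * accepted ψ i = _
      rw [h]
      push_cast
      ring
    rw [this, RCLike.inner_apply]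
    show _ * (starRingEnd ℂ) ((k i / Real.sqrt (∑ j, k j ^ 2) : ℝ) : ℂ) = _
    rw [Complex.conj_ofReal, ← Complex.ofReal_mul]
    congr 1
    simp only [div_eq_mul_inv, mul_inv]
    ring
  have hP : 0 ≤ ∑ i, k i ^ 2 := Finset.sum_nonneg fun i _ => sq_nonneg _
  have hA := acceptProb_eq h
  rw [acceptProb] at hA
  rw [hin, Complex.norm_real, Real.norm_eq_abs, sq_abs, div_pow, mul_pow, mul_pow, hA,
    Real.sq_sqrt hP, Real.sq_sqrt hn.le, mul_assoc, div_mul_cancel₀ _ hn.ne']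

theorem expectedTime_eq (T : ℕ) (Q : QuantumAccess x xs) (C : List (Instr d q))
    (h0 : 0 < acceptProb (run Q C (zeroState n q))) (h1 : acceptProb (run Q C (zeroState n q)) ≤ 1) :
    expectedTime T Q C = ENNReal.ofReal (circuitTime T C / acceptProb (run Q C (zeroState n q))) := by
  set s := acceptProb (run Q C (zeroState n q)) with hs
  have h2 : 1 - ENNReal.ofReal (1 - s) = ENNReal.ofReal s := by
    rw [← ENNReal.ofReal_one, ← ENNReal.ofReal_sub _ (by linarith)]
    congr 1
    ring
  rw [expectedTime, ENNReal.tsum_mul_right]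
  simp only [← hs, ENNReal.ofReal_pow (by linarith : (0 : ℝ) ≤ 1 - s)]
  rw [ENNReal.tsum_geometric, h2, ENNReal.ofReal_div_of_pos h0, ENNReal.ofReal_natCast, mul_comm,
    ENNReal.div_eq_inv_mul, mul_comm]

/-- Post-selection of approximate amplitudes. -/
theorem postSelection_bounds (T : ℕ) (Q : QuantumAccess x xs) (hx : ∀ i, ‖x i‖ = 1)
    (C : List (Instr d q)) {a k : Fin n → ℝ} {η p Δ B : ℝ}
    (h : ∀ i, accepted (run Q C (uniformState n q)) i = (((Real.sqrt n)⁻¹ : ℝ) : ℂ) * (a i : ℂ))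
    (ha : ∀ i, |a i| ≤ 1) (hak : ∀ i, |a i - k i| ≤ η) (hp : 0 < p) (hη : η ^ 2 ≤ 2 * Δ * p)
    (hη' : η ^ 2 ≤ p / 4) (hB : 4 * (circuitTime T (Instr.load false :: C) : ℝ) ≤ B)
    (hP : p ≤ (∑ i, k i ^ 2) / n) :
    1 - 2 * Δ ≤ ‖inner ℂ (kernelState k) (postSelected (run Q C (uniformState n q)))‖ ^ 2 ∧
      expectedTime T Q (Instr.load false :: C) ≤ ENNReal.ofReal (B * (n / ∑ i, k i ^ 2)) := by
  have hn : (0 : ℝ) < n := Nat.cast_pos.2 (NeZero.pos n)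
  set P := ∑ i, k i ^ 2
  set A := ∑ i, a i ^ 2
  rw [le_div_iff₀ hn] at hP
  have hP0 : 0 < P := (mul_pos hp hn).trans_le hP
  have hE : ∑ i, (a i - k i) ^ 2 ≤ n * η ^ 2 := by
    refine (Finset.sum_le_card_nsmul _ _ (η ^ 2) fun i _ => ?_).trans_eq (by simp)
    rw [← sq_abs]
    exact pow_le_pow_left₀ (abs_nonneg _) (hak i) 2
  -- The squared errors sum to at most n p / 4 ≤ P / 4. The acceptance probability thus loses at
  -- most a factor 4 against the ideal one, which the 4 in `hB` pays for.
  have hA : P / 4 ≤ A := by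
    have h1 : P ≤ 2 * A + 2 * ∑ i, (a i - k i) ^ 2 := by
      rw [Finset.mul_sum, Finset.mul_sum, ← Finset.sum_add_distrib]
      exact Finset.sum_le_sum fun i _ => by nlinarith [sq_nonneg (a i + (a i - k i))]
    nlinarith
  have hA0 : 0 < A := by linarith
  have hA1 : A ≤ n := by
    refine (Finset.sum_le_card_nsmul _ _ 1 fun i _ => ?_).trans_eq (by simp)
    rw [← sq_abs]
    exact pow_le_one₀ (abs_nonneg _) (ha i)
  constructor
  · rw [inner_kernelState_postSelected h, le_div_iff₀ (mul_pos hP0 hA0)]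
    refine le_trans ?_ (sum_sq_mul_le Finset.univ a k)
    have : (1 - 2 * Δ) * P ≤ P - ∑ i, (a i - k i) ^ 2 := by nlinarith
    calc (1 - 2 * Δ) * (P * A) = A * ((1 - 2 * Δ) * P) := by ring
      _ ≤ _ := mul_le_mul_of_nonneg_left this hA0.le
  · have hs : acceptProb (run Q (Instr.load false :: C) (zeroState n q)) = A / n := by
      rw [run_load_zeroState Q hx, acceptProb_eq h]
    rw [expectedTime_eq T Q _ (by rw [hs]; positivity) (by rw [hs, div_le_one hn]; exact hA1), hs]
    refine ENNReal.ofReal_le_ofReal ?_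
    rw [div_div_eq_mul_div, mul_div_assoc', div_le_div_iff₀ hA0 hP0]
    have ht : (0 : ℝ) ≤ circuitTime T (Instr.load false :: C) := Nat.cast_nonneg _
    calc (circuitTime T (Instr.load false :: C) : ℝ) * n * P
        ≤ circuitTime T (Instr.load false :: C) * n * (4 * A) := by
          refine mul_le_mul_of_nonneg_left (by linarith) (by positivity)
      _ = 4 * circuitTime T (Instr.load false :: C) * n * A := by ring
      _ ≤ B * n * A := by gcongr

end PostSelection

/-! ### Intermediate values -/

/-- A number between the bounds of a continuous function near `t`, up to an error `δ`, is a value of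
the function near `t`, up to the error `δ`. -/
theorem exists_close_value {K : ℝ → ℝ} (hc : ContinuousOn K (Set.Icc (-1) 1)) (hK : ∀ x, |K x| ≤ 1)
    {t ε δ a : ℝ} (ht : t ∈ Set.Icc (-1 : ℝ) 1) (hε : 0 < ε) (hδ : 0 ≤ δ)
    (h : ∀ lo hi : ℝ, -1 ≤ lo → hi ≤ 1 →
      (∀ x ∈ Set.Icc (-1 : ℝ) 1, |x - t| ≤ ε → lo ≤ K x ∧ K x ≤ hi) → lo - δ ≤ a ∧ a ≤ hi + δ) :
    ∃ ρ ∈ Set.Icc (-1 : ℝ) 1, |ρ - t| ≤ ε ∧ |a - K ρ| ≤ δ := by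
  set l := max (-1) (t - ε)
  set r := min 1 (t + ε)
  have hlt : l ≤ t := max_le ht.1 (by linarith)
  have htr : t ≤ r := le_min ht.2 (by linarith)
  have hmem : ∀ y, y ∈ Set.Icc l r ↔ y ∈ Set.Icc (-1 : ℝ) 1 ∧ |y - t| ≤ ε := by
    intro y
    simp only [Set.mem_Icc, l, r, max_le_iff, le_min_iff, abs_le]
    constructor
    · rintro ⟨⟨h1, h2⟩, h3, h4⟩
      exact ⟨⟨h1, h3⟩, by linarith, by linarith⟩
    · rintro ⟨⟨h1, h2⟩, h3, h4⟩
      exact ⟨⟨h1, by linarith⟩, h2, by linarith⟩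
  have him := (hc.mono fun y hy => ((hmem y).1 hy).1).image_Icc (hlt.trans htr)
  set lo := sInf (K '' Set.Icc l r)
  set hi := sSup (K '' Set.Icc l r)
  have hv : ∀ y ∈ Set.Icc l r, lo ≤ K y ∧ K y ≤ hi := fun y hy => by
    have := Set.mem_image_of_mem K hy
    rwa [him] at this
  have hw : ∀ v ∈ Set.Icc lo hi, ∃ y ∈ Set.Icc l r, K y = v := fun v hv => by
    rwa [← him] at hv
  have hlohi : lo ≤ hi := (hv t ⟨hlt, htr⟩).1.trans (hv t ⟨hlt, htr⟩).2
  obtain ⟨y, -, hy⟩ := hw lo ⟨le_rfl, hlohi⟩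
  obtain ⟨y', -, hy'⟩ := hw hi ⟨hlohi, le_rfl⟩
  obtain ⟨h1, h2⟩ := h lo hi (by rw [← hy]; exact (abs_le.1 (hK y)).1)
    (by rw [← hy']; exact (abs_le.1 (hK y')).2) fun x hx hxt => hv x ((hmem x).2 ⟨hx, hxt⟩)
  -- Clamping a to the range of K near t moves it by at most δ, and the clamped number is attained.
  obtain ⟨ρ, hρ, hρv⟩ := hw (max lo (min hi a)) ⟨le_max_left _ _, max_le hlohi (min_le_left _ _)⟩
  refine ⟨ρ, ((hmem ρ).1 hρ).1, ((hmem ρ).1 hρ).2, ?_⟩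
  rw [hρv, abs_le]
  rcases le_total hi a with ha | ha
  · rw [min_eq_left ha, max_eq_right hlohi]
    constructor <;> linarith
  · rw [min_eq_right ha]
    rcases le_total lo a with hb | hb
    · rw [max_eq_right hb]
      constructor <;> linarith
    · rw [max_eq_left hb]
      constructor <;> linarith

/-! ### Running times -/

theorem one_le_one_add_log (n d : ℕ) : 1 ≤ 1 + Real.log (n * d) := by
  rw [← Nat.cast_mul]
  linarith [Real.log_natCast_nonneg (n * d)]

theorem dataQubits_le (n d : ℕ) [NeZero n] [NeZero d] :
    (dataQubits d : ℝ) ≤ 2 * (1 + Real.log (n * d)) := by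
  have hd : (1 : ℝ) ≤ d := Nat.one_le_cast.2 (NeZero.one_le)
  have hn : (1 : ℝ) ≤ n := Nat.one_le_cast.2 (NeZero.one_le)
  have h1 : Real.log d ≤ Real.log (n * d) :=
    Real.log_le_log (by linarith) (by nlinarith)
  have h0 : 0 ≤ Real.log d := Real.log_nonneg hd
  rcases Nat.lt_or_ge 1 d with h | h
  · have h2 := Nat.pow_pred_clog_lt_self one_lt_two h
    have h3 : ((2 : ℝ) ^ (Nat.clog 2 d).pred) ≤ d := by exact_mod_cast h2.le
    have h4 := Real.log_le_log (by positivity) h3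
    rw [Real.log_pow] at h4
    have h5 : (Nat.clog 2 d : ℝ) ≤ (Nat.clog 2 d).pred + 1 := by
      cases Nat.clog 2 d <;> simp
    have h6 := Real.log_two_gt_d9
    have h7 : ((Nat.clog 2 d).pred : ℝ) ≤ 2 * Real.log d := by
      have : (0 : ℝ) ≤ (Nat.clog 2 d).pred := Nat.cast_nonneg _
      nlinarith
    show (Nat.clog 2 d : ℝ) ≤ _
    linarith
  · have : dataQubits d = 0 := Nat.clog_of_right_le_one h 2
    rw [this]
    push_cast
    linarith

/-- A walk step takes polylogarithmic time. -/
theorem walk_time_le {T : ℕ → ℕ → ℕ} {A c : ℕ}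
    (hT : ∀ n d : ℕ, 1 ≤ n → 1 ≤ d → (T n d : ℝ) ≤ A * (1 + Real.log (n * d)) ^ c)
    (n d : ℕ) [NeZero n] [NeZero d] :
    4 * (T n d : ℝ) + 10 * dataQubits d + 19 ≤ (4 * A + 39) * (1 + Real.log (n * d)) ^ (c + 1) := by
  have h1 := hT n d NeZero.one_le NeZero.one_le
  have h2 := dataQubits_le n d
  have h3 := one_le_one_add_log n d
  set l := 1 + Real.log (n * d)
  have h4 : l ^ c ≤ l ^ (c + 1) := pow_le_pow_right₀ h3 (Nat.le_succ c)
  have h5 : l ≤ l ^ (c + 1) := le_self_pow₀ h3 (Nat.succ_ne_zero c)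
  have h6 : (A : ℝ) * l ^ c ≤ A * l ^ (c + 1) := mul_le_mul_of_nonneg_left h4 (Nat.cast_nonneg A)
  nlinarith

/-- The logarithm in the degree splits into log 288 (288 = 48 · 6), log(1/Δ) and log(1/(εp)). Since
log(1/Δ) ≥ 1/2, X is at least 1/(2ε), so the last term is at most 2 log(2 + X/p). -/
theorem amplitude_time_le {M ε Δ p X : ℝ} (hε : 0 < ε) (hε1 : ε ≤ 1) (hΔ : 0 < Δ) (hΔ2 : Δ < 1 / 2)
    (hp : 0 < p) (hM : M ≤ 4 / ε * Real.log (48 / (ε * (Δ * p / 6))) + 1)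
    (hX : Real.log (1 / Δ) / ε ≤ X) :
    3 * M + 3 ≤ 228 * (Real.log (1 / Δ) / ε) * (1 + Real.log (2 + X / p)) := by
  have hl : 1 / 2 ≤ Real.log (1 / Δ) := by
    have h1 : Real.log 2 ≤ Real.log (1 / Δ) :=
      Real.log_le_log two_pos (by rw [le_div_iff₀ hΔ]; linarith)
    linarith [Real.log_two_gt_d9]
  have h288 : Real.log 288 ≤ 6 := by
    rw [Real.log_le_iff_le_exp (by norm_num)]
    have := Real.exp_one_gt_d9
    calc (288 : ℝ) ≤ 2.7 ^ 6 := by norm_num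
      _ ≤ Real.exp 1 ^ 6 := by gcongr; linarith
      _ = Real.exp 6 := by rw [← Real.exp_nat_mul]; norm_num
  have hX0 : 0 ≤ X := (by positivity : (0 : ℝ) ≤ Real.log (1 / Δ) / ε).trans hX
  have hεp : 1 / (ε * p) ≤ 2 * (X / p) := by
    have h2 : 1 / 2 / ε ≤ X := le_trans (by gcongr) hX
    have h3 : 1 / 2 / ε / p ≤ X / p := by gcongr
    calc 1 / (ε * p) = 2 * (1 / 2 / ε / p) := by field_simp
      _ ≤ _ := by linarith
  have hlog : Real.log (1 / (ε * p)) ≤ 2 * Real.log (2 + X / p) := by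
    have h0 : 0 ≤ X / p := by positivity
    have : 2 * Real.log (2 + X / p) = Real.log ((2 + X / p) ^ 2) := by rw [Real.log_pow]; norm_num
    rw [this]
    exact Real.log_le_log (by positivity) (hεp.trans (by nlinarith))
  have hsplit : Real.log (48 / (ε * (Δ * p / 6))) =
      Real.log 288 + Real.log (1 / Δ) + Real.log (1 / (ε * p)) := by
    rw [← Real.log_mul (by norm_num) (by positivity), ← Real.log_mul (by positivity) (by positivity)]
    congr 1
    field_simp
    norm_num
  rw [hsplit] at hM
  set l := Real.log (1 / Δ)
  have hY0 : 0 ≤ Real.log (2 + X / p) := Real.log_nonneg (by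
    have : 0 ≤ X / p := by positivity
    linarith)
  set Y := Real.log (2 + X / p)
  have hfin : Real.log 288 + l + Real.log (1 / (ε * p)) + 1 ≤ 19 * (l * (1 + Y)) := by nlinarith
  have h1ε : 1 ≤ 1 / ε := by rw [le_div_iff₀ hε]; linarith
  calc 3 * M + 3 ≤ 12 * (1 / ε) * (Real.log 288 + l + Real.log (1 / (ε * p))) + 6 := by
        have : 4 / ε = 4 * (1 / ε) := by ring
        rw [this] at hM
        linarith
    _ ≤ 12 * (1 / ε) * (Real.log 288 + l + Real.log (1 / (ε * p)) + 1) := by linarith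
    _ ≤ 12 * (1 / ε) * (19 * (l * (1 + Y))) := by gcongr
    _ = 228 * (l / ε) * (1 + Y) := by ring

/-- `exists_amplitude_circuit` for the clipped kernel produces the amplitudes, and
`exists_close_value` reads each of them as a kernel value at a nearby ρ_i. The depth enters only
through the choice of gates, not through their number. -/
theorem exists_amplitude_encoding (σ : ℝ → ℝ) (hσ : IsNormalizedActivation σ)
    (T : ℕ → ℕ → ℕ)
    (hT : ∃ A c : ℕ, ∀ n d : ℕ, 1 ≤ n → 1 ≤ d → (T n d : ℝ) ≤ A * (1 + Real.log (n * d)) ^ c) :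
    ∃ A c : ℕ, ∀ (n d L : ℕ) [NeZero n] [NeZero d] (δhat ε Δ p : ℝ),
      0 < ε → ε ≤ 1 → 0 < Δ → Δ < 1 / 2 → 0 < p → p ≤ 1 →
        ∃ (q : ℕ) (C : List (Instr d q)),
          let X : ℝ := (1 + Real.log (n * d)) ^ c * Real.log (1 / Δ) / ε
          let B : ℝ := A * X * (1 + Real.log (2 + X / p)) ^ c
          (circuitTime (T n d) (Instr.load false :: C) : ℝ) ≤ B ∧
          ∀ (x : Fin n → EuclideanSpace ℝ (Fin d)) (xs : EuclideanSpace ℝ (Fin d)),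
            (∀ i, ‖x i‖ = 1) → ‖xs‖ = 1 → ∀ Q : QuantumAccess x xs,
              ∃ ρ : Fin n → ℝ, (∀ i, ρ i ∈ Set.Icc (-1 : ℝ) 1) ∧
                (∀ i, |ρ i - inner ℝ xs (x i)| ≤ ε) ∧
                let k : Fin n → ℝ := fun i => clippedKernel σ L δhat (ρ i)
                let P : ℝ := ∑ i, k i ^ 2
                let out := run Q C (uniformState n q)
                (∀ i, ‖(Real.sqrt n : ℂ) * accepted out i - (k i : ℂ)‖ ^ 2 ≤ 2 * Δ * p) ∧
                (p ≤ P / n →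
                  1 - 2 * Δ ≤ ‖inner ℂ (kernelState k) (postSelected out)‖ ^ 2 ∧
                  expectedTime (T n d) Q (Instr.load false :: C) ≤
                    ENNReal.ofReal (B * (n / P))) := by
  obtain ⟨A, c, hT⟩ := hT
  -- 912 = 4 · 228: the constant of `amplitude_time_le` times the loss in acceptance probability.
  -- The rest is the cost of a walk step from `walk_time_le`.
  refine ⟨912 * (4 * A + 39), c + 1, fun n d L _ _ δhat ε Δ p hε hε1 hΔ hΔ2 hp hp1 => ?_⟩
  have hn : (0 : ℝ) < n := Nat.cast_pos.2 (NeZero.pos n)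
  -- The filter precision δ = Δp/6 makes the amplitude error 3δ = Δp/2, whose square is below both
  -- 2Δp and p/4.
  have hδ : 0 < Δ * p / 6 := by positivity
  have hδ1 : Δ * p / 6 < 1 := by nlinarith
  obtain ⟨M, hM, hM'⟩ := exists_filter_degree hε hε1 hδ hδ1.le
  obtain ⟨C, hCl, hCt, hC⟩ := exists_amplitude_circuit (K := clippedKernel σ L δhat)
    (abs_clippedKernel_le σ L δhat) hε hε1 hδ hδ1 hM d
  refine ⟨_, C, ?_⟩
  intro X B
  have hl := one_le_one_add_log n d
  have hlog : 0 < Real.log (1 / Δ) := Real.log_pos (by rw [lt_div_iff₀ hΔ]; linarith)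
  have hX : Real.log (1 / Δ) / ε ≤ X :=
    div_le_div_of_nonneg_right (le_mul_of_one_le_left hlog.le (one_le_pow₀ hl)) hε.le
  have hX0 : 0 < X := (div_pos hlog hε).trans_le hX
  have hY : 1 ≤ 1 + Real.log (2 + X / p) := by
    have h1 : 0 ≤ X / p := by positivity
    linarith [Real.log_nonneg (by linarith : (1 : ℝ) ≤ 2 + X / p)]
  have htime : 4 * (circuitTime (T n d) (Instr.load false :: C) : ℝ) ≤ B := by
    have h1 : (circuitTime (T n d) (Instr.load false :: C) : ℝ) ≤
        (3 * M + 3) * (4 * T n d + 10 * dataQubits d + 19) := by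
      have h2 : circuitTime (T n d) (Instr.load false :: C) ≤
          (3 * M + 3) * (4 * T n d + 10 * dataQubits d + 19) := by
        rw [circuitTime_cons]
        have := hCt (T n d)
        show T n d + _ ≤ _
        have e : (3 * M + 3) * (4 * T n d + 10 * dataQubits d + 19) =
          (3 * M + 2) * (4 * T n d + 10 * dataQubits d + 19) +
            (4 * T n d + 10 * dataQubits d + 19) := by ring
        omega
      exact_mod_cast h2
    calc 4 * (circuitTime (T n d) (Instr.load false :: C) : ℝ)
        ≤ 4 * ((3 * M + 3) * (4 * T n d + 10 * dataQubits d + 19)) := by linarith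
      _ ≤ 4 * ((228 * (Real.log (1 / Δ) / ε) * (1 + Real.log (2 + X / p))) *
          ((4 * A + 39) * (1 + Real.log (n * d)) ^ (c + 1))) := by
        have := amplitude_time_le hε hε1 hΔ hΔ2 hp hM' hX
        have h3 := walk_time_le hT n d
        have h4 : (0 : ℝ) ≤ 4 * T n d + 10 * dataQubits d + 19 := by positivity
        have h5 : (0 : ℝ) ≤ 3 * M + 3 := by positivity
        exact mul_le_mul_of_nonneg_left (mul_le_mul this h3 h4 (h5.trans this)) (by norm_num)
      _ = (912 * (4 * A + 39) : ℝ) * X * (1 + Real.log (2 + X / p)) := by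
        simp only [X]
        ring
      _ ≤ (912 * (4 * A + 39) : ℝ) * X * (1 + Real.log (2 + X / p)) ^ (c + 1) := by
        refine mul_le_mul_of_nonneg_left (le_self_pow₀ hY (Nat.succ_ne_zero c)) (by positivity)
      _ = B := by
        simp only [B]
        push_cast
        ring
  refine ⟨le_trans (by linarith [(Nat.cast_nonneg _ : (0 : ℝ) ≤
    circuitTime (T n d) (Instr.load false :: C))]) htime, fun x xs hx hxs Q => ?_⟩
  have hin : ∀ i, inner ℝ xs (x i) ∈ Set.Icc (-1 : ℝ) 1 := fun i => by
    have := abs_real_inner_le_norm xs (x i)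
    rw [hx, hxs, one_mul] at this
    exact abs_le.1 this
  choose a ha ha1 hK using fun i => hC (Q.row i) Q.test (inner ℝ xs (x i)) (hin i)
    (Q.sum_row_test (hx i) hxs)
  choose ρ hρ hρε hρa using fun i => exists_close_value (hσ.continuousOn_clippedKernel L δhat)
    (abs_clippedKernel_le σ L δhat) (hin i) hε (by positivity : 0 ≤ 3 * (Δ * p / 6)) (hK i)
  refine ⟨ρ, hρ, hρε, ?_⟩
  intro k P out
  have hacc : ∀ i, accepted out i = (((Real.sqrt n)⁻¹ : ℝ) : ℂ) * (a i : ℂ) := fun i => by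
    rw [← ha]
    exact accepted_run Q hCl i
  have hη : (3 * (Δ * p / 6)) ^ 2 ≤ 2 * Δ * p := by
    have : Δ * p ≤ 1 / 2 := by nlinarith
    nlinarith [mul_pos hΔ hp]
  have hη' : (3 * (Δ * p / 6)) ^ 2 ≤ p / 4 := by
    have h1 : Δ * p ≤ p := by nlinarith
    have h2 : Δ * p ≤ 1 := by nlinarith
    nlinarith [mul_pos hΔ hp]
  refine ⟨fun i => ?_, postSelection_bounds _ Q hx C hacc ha1 hρa hp hη hη' htime⟩
  refine le_trans ?_ hη
  rw [hacc, ← mul_assoc, ← Complex.ofReal_mul, mul_inv_cancel₀ (Real.sqrt_pos.2 hn).ne',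
    Complex.ofReal_one, one_mul, ← Complex.ofReal_sub, Complex.norm_real, Real.norm_eq_abs]
  exact pow_le_pow_left₀ (abs_nonneg _) (hρa i) 2

/-! ### Writing a table into a register -/

section Table

variable {d K b r : ℕ} {R S : Matrix.unitaryGroup (Bits (dataQubits d)) ℂ}

/-- Controlled on the qubit `k`, flip the qubits of the output register that are listed in `l`. -/
def flipCircuit (k : Fin K) (l : List (Fin b)) : List (Instr d ((K + b) + r)) :=
  l.map fun t => ctrlGate (Fin.castAdd r (Fin.castAdd b k)) (Fin.castAdd r (Fin.natAdd K t))
    (fun e => castAdd_ne_natAdd k t (Fin.castAdd_injective _ _ e)) gateX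

theorem slice_flipCircuit (k : Fin K) {l : List (Fin b)} (hl : l.Nodup)
    (ψ : Bits ((K + b) + r) → ℂ) (a : Bits K) (y : Bits b) :
    slice (circuitEnd R S (flipCircuit (d := d) k l) ψ) (Fin.append a y) =
      slice ψ (Fin.append a fun t => xor (y t) (a k && decide (t ∈ l))) := by
  induction l generalizing ψ with
  | nil => simp [flipCircuit]
  | cons t l ih =>
    rw [List.nodup_cons] at hl
    rw [flipCircuit, List.map_cons, circuitEnd_cons, ← flipCircuit, ih hl.2,
      slice_cnot (castAdd_ne_natAdd k t),
      Fin.append_left, Fin.append_right, update_append_right]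
    congr 2
    funext s
    by_cases hs : s = t
    · subst hs
      rw [Function.update_self]
      simp [hl.1]
    · rw [Function.update_of_ne hs]
      simp [hs]

theorem circuitTime_flipCircuit (T : ℕ) (k : Fin K) (l : List (Fin b)) :
    circuitTime T (flipCircuit (d := d) (r := r) k l) = l.length := by
  induction l with
  | nil => rfl
  | cons t l ih =>
    rw [flipCircuit, List.map_cons, circuitTime_cons, ← flipCircuit, ih, ctrlGate, time_muxGate,
      List.length_cons, add_comm]

theorem loadFree_flipCircuit (k : Fin K) (l : List (Fin b)) :
    ∀ g ∈ flipCircuit (d := d) (r := r) k l, g.LoadFree := by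
  intro g hg
  obtain ⟨t, -, rfl⟩ := List.mem_map.1 hg
  trivial

/-- If the first `K` qubits hold `1…10…0` with `j` ones and the output register is cleared, write the
entry `v j` of the table `v` into the output register (first `J` steps). -/
def tableCircuit (v : ℕ → Bits b) : (J : ℕ) → J ≤ K → List (Instr d ((K + b) + r))
  | 0, _ => []
  | J + 1, h => tableCircuit v J (Nat.le_of_succ_le h) ++
      flipCircuit ⟨J, h⟩ ((List.finRange b).filter fun t => xor (v (J + 1) t) (v J t))

/-- Step J adds v (J+1) ⊕ v J if control J is set, so on a thermometer code with j ones the steps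
telescope from v 0 = 0 to v j. Each flip therefore needs only a single control. -/
theorem tableCircuit_support {v : ℕ → Bits b} (hv : v 0 = zeroBits b) (J : ℕ) (hJ : J ≤ K)
    {ψ : Bits ((K + b) + r) → ℂ} {j : ℕ} {a : Bits K} (ha : ∀ k : Fin K, a k = decide ((k : ℕ) < j))
    (hψ : ∀ y, y ≠ zeroBits b → slice ψ (Fin.append a y) = 0) {y : Bits b}
    (hy : slice (circuitEnd R S (tableCircuit (d := d) v J hJ) ψ) (Fin.append a y) ≠ 0) :
    y = v (min j J) := by
  induction J generalizing y with
  | zero =>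
    rw [Nat.min_zero, hv]
    by_contra h
    exact hy (hψ y h)
  | succ J ih =>
    rw [tableCircuit, circuitEnd_append, slice_flipCircuit _ ((List.nodup_finRange b).filter _)] at hy
    have h := ih _ hy
    funext t
    have ht := congrFun h t
    simp only [List.mem_filter, List.mem_finRange, true_and, Bool.decide_eq_true, ha] at ht
    rcases Nat.lt_or_ge J j with hlt | hge
    · rw [min_eq_right hlt.le] at ht
      rw [min_eq_right hlt]
      simp only [hlt, decide_true, Bool.true_and] at ht
      revert ht
      cases y t <;> cases v (J + 1) t <;> cases v J t <;> simp
    · rw [min_eq_left hge] at ht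
      rw [min_eq_left (by omega)]
      simpa [Nat.not_lt.2 hge] using ht

theorem slice_tableCircuit_eq_zero (v : ℕ → Bits b) (J : ℕ) (hJ : J ≤ K)
    {ψ : Bits ((K + b) + r) → ℂ} {a : Bits K} (hψ : ∀ y, slice ψ (Fin.append a y) = 0) (y : Bits b) :
    slice (circuitEnd R S (tableCircuit (d := d) v J hJ) ψ) (Fin.append a y) = 0 := by
  induction J generalizing y with
  | zero => exact hψ y
  | succ J ih =>
    rw [tableCircuit, circuitEnd_append, slice_flipCircuit _ ((List.nodup_finRange b).filter _), ih]

theorem circuitTime_tableCircuit (T : ℕ) (v : ℕ → Bits b) (J : ℕ) (hJ : J ≤ K) :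
    circuitTime T (tableCircuit (d := d) (r := r) v J hJ) ≤ J * b := by
  induction J with
  | zero => exact Nat.zero_le _
  | succ J ih =>
    rw [tableCircuit, circuitTime_append, circuitTime_flipCircuit, Nat.succ_mul]
    refine Nat.add_le_add (ih _) ((List.length_filter_le _ _).trans_eq (List.length_finRange))

theorem loadFree_tableCircuit (v : ℕ → Bits b) (J : ℕ) (hJ : J ≤ K) :
    ∀ g ∈ tableCircuit (d := d) (r := r) v J hJ, g.LoadFree := by
  induction J with
  | zero => simp [tableCircuit]
  | succ J ih => exact loadFree_append (ih _) (loadFree_flipCircuit _ _)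

end Table

/-! ### Fixed-point numbers -/

theorem sum_testBit_two_pow (m a : ℕ) (h : a < 2 ^ m) :
    ∑ t : Fin m, (if a.testBit t then (2 : ℝ) ^ (t : ℕ) else 0) = a := by
  induction m generalizing a with
  | zero => simp_all
  | succ m ih =>
    have h2 : a / 2 < 2 ^ m := by
      rw [pow_succ] at h
      omega
    have h3 := ih (a / 2) h2
    rw [Fin.sum_univ_succ]
    have h4 : ∀ t : Fin m, (if a.testBit (t.succ : ℕ) then (2 : ℝ) ^ (t.succ : ℕ) else 0) =
        2 * if (a / 2).testBit t then (2 : ℝ) ^ (t : ℕ) else 0 := by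
      intro t
      rw [Fin.val_succ, Nat.testBit_succ, pow_succ]
      split_ifs <;> ring
    simp only [h4, ← Finset.mul_sum, h3, Fin.val_zero, Nat.testBit_zero, pow_zero]
    have h5 : (a : ℝ) = 2 * (a / 2 : ℕ) + (a % 2 : ℕ) := by exact_mod_cast (Nat.div_add_mod a 2).symm
    rw [h5]
    rcases Nat.mod_two_eq_zero_or_one a with h | h <;> simp [h, add_comm]

theorem exists_fixedPoint_eq (p m : ℕ) (N : ℤ) (h1 : -2 ^ m ≤ N) (h2 : N < 2 ^ m) :
    ∃ y : Bits (m + 1), fixedPoint p y = N / 2 ^ p := by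
  rcases lt_or_ge N 0 with hN | hN
  -- A negative N is stored as the digits of N + 2^m with the sign bit set.
  · obtain ⟨a, ha⟩ := Int.eq_ofNat_of_zero_le (by linarith : 0 ≤ N + 2 ^ m)
    refine ⟨Fin.snoc (α := fun _ => Bool) (fun t : Fin m => a.testBit t) true, ?_⟩
    have hlt : a < 2 ^ m := by
      have : (a : ℤ) < 2 ^ m := by linarith
      exact_mod_cast this
    simp only [fixedPoint, Fin.snoc_castSucc, Fin.snoc_last, sum_testBit_two_pow m a hlt, if_true]
    have : (a : ℝ) = N + 2 ^ m := by exact_mod_cast ha.symm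
    rw [this]
    ring
  · obtain ⟨a, rfl⟩ := Int.eq_ofNat_of_zero_le hN
    refine ⟨Fin.snoc (α := fun _ => Bool) (fun t : Fin m => a.testBit t) false, ?_⟩
    have hlt : a < 2 ^ m := by exact_mod_cast h2
    simp only [fixedPoint, Fin.snoc_castSucc, Fin.snoc_last, sum_testBit_two_pow m a hlt]
    simp

theorem exists_fixedPoint_close (p m : ℕ) {v : ℝ} (hv : |v| * 2 ^ p + 1 ≤ 2 ^ m) :
    ∃ y : Bits (m + 1), |fixedPoint p y - v| ≤ 1 / 2 ^ (p + 1) := by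
  have h2 : (0 : ℝ) < 2 ^ p := by positivity
  have hr := abs_sub_round (v * 2 ^ p)
  have hN := abs_le.1 hr
  have hv' : |v * 2 ^ p| + 1 ≤ 2 ^ m := by rwa [abs_mul, abs_of_pos h2]
  have hvb := abs_le.1 (le_refl |v * 2 ^ p|)
  obtain ⟨y, hy⟩ := exists_fixedPoint_eq p m (round (v * 2 ^ p))
    (by
      have : (-2 ^ m : ℝ) ≤ round (v * 2 ^ p) := by linarith [hN.2]
      exact_mod_cast this)
    (by
      have : (round (v * 2 ^ p) : ℝ) < 2 ^ m := by linarith [hN.1]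
      exact_mod_cast this)
  refine ⟨y, ?_⟩
  have : fixedPoint p y - v = -(v * 2 ^ p - round (v * 2 ^ p)) / 2 ^ p := by
    rw [hy]
    field_simp
    ring
  rw [this, abs_div, abs_neg, abs_of_pos h2, pow_succ, div_le_div_iff₀ h2 (by positivity)]
  nlinarith

/-! ### Several polynomials of one walk -/

section Bits
open Polynomial ComplexConjugate

/-- The polynomial that belongs to the outcomes `u`, if the first `J` of the qubits have been
processed. -/
noncomputable def bitPoly {q : ℕ} (P Q : ℕ → ℂ[X]) (J : ℕ) (u : Bits q) : ℂ[X] :=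
  ∏ k : Fin q, if (k : ℕ) < J then (if u k then Q k else P k) else (if u k then 0 else 1)

theorem bitPoly_zero {q : ℕ} (P Q : ℕ → ℂ[X]) (u : Bits q) :
    bitPoly P Q 0 u = if u = zeroBits q then 1 else 0 := by
  split_ifs with h
  · subst h
    simp [bitPoly, zeroBits]
  · obtain ⟨k, hk⟩ := Function.ne_iff.1 h
    refine Finset.prod_eq_zero (Finset.mem_univ k) ?_
    have : u k = true := by simpa [zeroBits] using hk
    simp [this]

theorem bitPoly_eq_zero {q : ℕ} (P Q : ℕ → ℂ[X]) {J : ℕ} {u : Bits q} {k : Fin q} (hk : J ≤ k)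
    (hu : u k = true) : bitPoly P Q J u = 0 :=
  Finset.prod_eq_zero (Finset.mem_univ k) (by simp [Nat.not_lt.2 hk, hu])

theorem bitPoly_succ {q : ℕ} (P Q : ℕ → ℂ[X]) {J : ℕ} (hJ : J < q) (u : Bits q) :
    bitPoly P Q (J + 1) u = (if u ⟨J, hJ⟩ then Q J else P J) *
      bitPoly P Q J (Function.update u ⟨J, hJ⟩ false) := by
  rw [bitPoly, bitPoly, ← Finset.mul_prod_erase _ _ (Finset.mem_univ (⟨J, hJ⟩ : Fin q)),
    ← Finset.mul_prod_erase _ _ (Finset.mem_univ (⟨J, hJ⟩ : Fin q))]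
  simp only [Nat.lt_succ_self, if_true, lt_irrefl, Function.update_self, Bool.false_eq_true, if_false,
    one_mul]
  congr 1
  refine Finset.prod_congr rfl fun k hk => ?_
  have hk' := Finset.ne_of_mem_erase hk
  have hne : (k : ℕ) ≠ J := fun e => hk' (Fin.ext e)
  rw [Function.update_of_ne hk']
  have : (k : ℕ) < J + 1 ↔ (k : ℕ) < J := by omega
  simp only [this]

/-- Polynomials of one operator compose by multiplication. Hence the comparisons can share the walk
register without resetting it: the branch with outcomes u carries the product of the chosen P k and
Q k, applied to s. -/
theorem exists_bitsCircuit {K N : ℕ} {P : ℕ → ℂ[X]} (hP : ∀ k, (P k).natDegree ≤ N)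
    (h1 : ∀ k, ∀ z : ℂ, ‖z‖ = 1 → ‖(P k).eval z‖ < 1) :
    ∃ Q : ℕ → ℂ[X], (∀ k, ∀ z : ℂ, ‖z‖ = 1 → ‖(P k).eval z‖ ^ 2 + ‖(Q k).eval z‖ ^ 2 = 1) ∧
      ∀ d q, K ≤ q → ∃ C : List (Instr d (q + walkQubits d)), (∀ g ∈ C, g.LoadFree) ∧
        (∀ T, circuitTime T C ≤ (K * (N + 1) + 1) * (4 * T + 10 * dataQubits d + 19)) ∧
        ∀ R S u, slice (circuitEnd R S C (Pi.single (zeroBits _) 1)) u =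
          aeval (circuitEnd R S (walkCircuit d)) (bitPoly P Q K u) (walkState R S) := by
  choose Q hPQ hC using fun k => exists_qspCircuit (hP k) (h1 k)
  refine ⟨Q, hPQ, fun d q => ?_⟩
  induction K with
  | zero =>
    intro _
    refine ⟨(prepCircuit d).map (Instr.relabel (Fin.natAddEmb q)),
      loadFree_relabel _ loadFree_prepCircuit, fun T => ?_, fun R S u => ?_⟩
    · rw [circuitTime_relabel, circuitTime_prepCircuit]
      omega
    · rw [slice_relabel, slice_single_zero, bitPoly_zero]
      split_ifs
      · rw [map_one]
        rfl
      · rw [map_zero, map_zero]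
        rfl
  | succ J ih =>
    intro hJ
    obtain ⟨C, hCl, hCt, hCs⟩ := ih (Nat.le_of_succ_le hJ)
    obtain ⟨D, hDl, hDt, hDs⟩ := hC J d q ⟨J, hJ⟩
    refine ⟨C ++ D, loadFree_append hCl hDl, fun T => ?_, fun R S u => ?_⟩
    · rw [circuitTime_append, hDt]
      have e : ((J + 1) * (N + 1) + 1) * (4 * T + 10 * dataQubits d + 19) =
        (J * (N + 1) + 1) * (4 * T + 10 * dataQubits d + 19) +
          N * (4 * T + 10 * dataQubits d + 19) + (4 * T + 10 * dataQubits d + 19) := by ring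
      have := hCt T
      omega
    · rw [circuitEnd_append, hDs R S _ (fun u hu => by
        rw [hCs, bitPoly_eq_zero P Q le_rfl hu, map_zero, LinearMap.zero_apply]), hCs, bitPoly_succ P Q hJ,
        map_mul, Module.End.mul_apply]

/-- The probability of the outcomes `u`, at an eigenvalue of the walk. -/
theorem sum_norm_bitPoly {K b : ℕ} {P Q : ℕ → ℂ[X]} {z : ℂ}
    {A : ℕ → Finset Bool} {κ : ℝ}
    (hκ : κ ≤ 1) (hA : ∀ k, 1 - κ ≤ ∑ a ∈ A k, ‖(if a then Q k else P k).eval z‖ ^ 2) :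
    1 - K * κ ≤ ∑ u ∈ Fintype.piFinset (fun k : Fin (K + b) => if (k : ℕ) < K then A k else {false}),
      ‖(bitPoly P Q K u).eval z‖ ^ 2 := by
  obtain ⟨f, hf⟩ : ∃ f : Fin (K + b) → Bool → ℝ, ∀ k a, f k a =
      ‖(if (k : ℕ) < K then (if a then Q k else P k) else (if a then 0 else 1) : ℂ[X]).eval z‖ ^ 2 :=
    ⟨_, fun _ _ => rfl⟩
  have h1 : ∀ u : Bits (K + b), ‖(bitPoly P Q K u).eval z‖ ^ 2 = ∏ k, f k (u k) := by
    intro u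
    rw [bitPoly, eval_prod, norm_prod, ← Finset.prod_pow]
    exact Finset.prod_congr rfl fun k _ => (hf k (u k)).symm
  simp only [h1]
  -- At a fixed eigenvalue the outcomes are independent: the b idle qubits contribute 1, each
  -- comparison at least 1 - κ, and Bernoulli's inequality bounds the product.
  rw [← Finset.prod_univ_sum, Fin.prod_univ_add]
  have h2 : ∀ t : Fin b, ¬ K + (t : ℕ) < K := fun t => by omega
  simp only [hf, Fin.val_castAdd, Fin.val_natAdd, Fin.is_lt, if_true, h2, if_false, Finset.sum_singleton,
    Bool.false_eq_true, eval_one, norm_one, one_pow, Finset.prod_const_one, mul_one]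
  calc 1 - K * κ ≤ (1 - κ) ^ K := by
        have := one_add_mul_le_pow (a := -κ) (by linarith) K
        calc 1 - K * κ = 1 + K * -κ := by ring
          _ ≤ _ := this
          _ = _ := by ring
    _ = ∏ _k : Fin K, (1 - κ) := by simp
    _ ≤ _ := Finset.prod_le_prod (fun _ _ => by linarith) fun k _ => hA k

end Bits

/-! ### Projection of a state -/

/-- The squared distance is (1 - ‖v‖)² + ‖w‖² = 2 - 2‖v‖, and ‖v‖ ≥ ‖v‖² ≥ 1 - Δ. -/
theorem norm_sub_normalized_le {E : Type*} [NormedAddCommGroup E] [InnerProductSpace ℂ E] {v w : E}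
    (h0 : inner ℂ v w = 0) (h1 : ‖v‖ ^ 2 + ‖w‖ ^ 2 = 1) {Δ : ℝ} (hΔ : Δ < 1)
    (hv : 1 - Δ ≤ ‖v‖ ^ 2) :
    ‖(((‖v‖⁻¹ : ℝ) : ℂ) • v)‖ = 1 ∧ ‖v + w - ((‖v‖⁻¹ : ℝ) : ℂ) • v‖ ≤ Real.sqrt (2 * Δ) := by
  have hpos : 0 < ‖v‖ := by
    rcases (norm_nonneg v).lt_or_eq with h | h
    · exact h
    · rw [← h] at hv
      norm_num at hv
      linarith
  have hle : ‖v‖ ≤ 1 := by nlinarith [sq_nonneg ‖w‖]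
  have hn : ‖(((‖v‖⁻¹ : ℝ) : ℂ) • v)‖ = 1 := by
    rw [norm_smul, Complex.norm_real, Real.norm_eq_abs, abs_of_pos (inv_pos.2 hpos),
      inv_mul_cancel₀ hpos.ne']
  refine ⟨hn, ?_⟩
  have e : v + w - ((‖v‖⁻¹ : ℝ) : ℂ) • v = ((1 - ‖v‖⁻¹ : ℝ) : ℂ) • v + w := by
    push_cast
    rw [sub_smul, one_smul]
    abel
  refine Real.le_sqrt_of_sq_le ?_
  rw [e, norm_add_sq (𝕜 := ℂ), inner_smul_left, h0, mul_zero, norm_smul, Complex.norm_real,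
    Real.norm_eq_abs, mul_pow, sq_abs]
  have h2 : (1 - ‖v‖⁻¹) ^ 2 * ‖v‖ ^ 2 = (‖v‖ - 1) ^ 2 := by
    field_simp
  rw [h2]
  simp only [map_zero, mul_zero, add_zero]
  nlinarith

theorem inner_toLp {ι : Type*} [Fintype ι] (v w : ι → ℂ) :
    inner ℂ (WithLp.toLp 2 v : EuclideanSpace ℂ ι) (WithLp.toLp 2 w) = star v ⬝ᵥ w := by
  rw [EuclideanSpace.inner_toLp_toLp, dotProduct_comm]

/-- A state of two registers whose first register is likely to be found in `G` is close, after any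
circuit, to a state that comes from `G`. -/
theorem exists_close_state {d q r : ℕ} {R S : Matrix.unitaryGroup (Bits (dataQubits d)) ℂ}
    (C : List (Instr d (q + r))) {ψ : Bits (q + r) → ℂ} (hψ : star ψ ⬝ᵥ ψ = 1)
    (G : Finset (Bits q)) {Δ : ℝ} (hΔ : Δ < 1)
    (hG : 1 - Δ ≤ ∑ u ∈ G, (star (slice ψ u) ⬝ᵥ slice ψ u).re) :
    ∃ (ψ' : Bits (q + r) → ℂ) (a : ℂ),
      (∀ u, slice ψ' u = if u ∈ G then slice ψ u else 0) ∧
      ‖(WithLp.toLp 2 (a • circuitEnd R S C ψ') : EuclideanSpace ℂ (Bits (q + r)))‖ = 1 ∧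
      ‖(WithLp.toLp 2 (circuitEnd R S C ψ) - WithLp.toLp 2 (a • circuitEnd R S C ψ') :
        EuclideanSpace ℂ (Bits (q + r)))‖ ≤ Real.sqrt (2 * Δ) := by
  classical
  have hdot : ∀ φ χ : Bits (q + r) → ℂ,
      star φ ⬝ᵥ χ = ∑ u : Bits q, star (slice φ u) ⬝ᵥ slice χ u := by
    intro φ χ
    simp only [dotProduct]
    rw [← Fintype.sum_prod_type', ← Equiv.sum_comp (Fin.appendEquiv q r)]
    rfl
  -- The projection is made before the circuit, which as an isometry keeps the two parts orthogonal.
  set ψ₁ : Bits (q + r) → ℂ := fun z => if (z ∘ Fin.castAdd r) ∈ G then ψ z else 0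
  set ψ₀ : Bits (q + r) → ℂ := fun z => if (z ∘ Fin.castAdd r) ∈ G then 0 else ψ z
  have hl : ∀ (u : Bits q) (h : Bits r), Fin.append u h ∘ Fin.castAdd r = u := fun u h =>
    funext fun t => Fin.append_left u h t
  have hs1 : ∀ u, slice ψ₁ u = if u ∈ G then slice ψ u else 0 := by
    intro u
    funext h
    simp only [slice, ψ₁, hl]
    split_ifs <;> rfl
  have hs0 : ∀ u, slice ψ₀ u = if u ∈ G then 0 else slice ψ u := by
    intro u
    funext h
    simp only [slice, ψ₀, hl]
    split_ifs <;> rfl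
  have hadd : ψ = ψ₁ + ψ₀ := by
    funext z
    simp only [ψ₁, ψ₀, Pi.add_apply]
    split_ifs <;> simp
  set v : EuclideanSpace ℂ (Bits (q + r)) := WithLp.toLp 2 (circuitEnd R S C ψ₁)
  set w : EuclideanSpace ℂ (Bits (q + r)) := WithLp.toLp 2 (circuitEnd R S C ψ₀)
  have h0 : inner ℂ v w = 0 := by
    rw [inner_toLp, circuitEnd_isometry, hdot]
    refine Finset.sum_eq_zero fun u _ => ?_
    rw [hs1, hs0]
    split_ifs <;> simp
  have hvw : v + w = WithLp.toLp 2 (circuitEnd R S C ψ) := by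
    rw [hadd, map_add]
    rfl
  have h1 : ‖v‖ ^ 2 + ‖w‖ ^ 2 = 1 := by
    have h2 := norm_add_sq (𝕜 := ℂ) v w
    rw [h0] at h2
    have h3 : ‖v + w‖ ^ 2 = 1 := by
      rw [hvw, norm_sq_eq_re_inner (𝕜 := ℂ), inner_toLp, circuitEnd_isometry, hψ]
      simp
    rw [h3] at h2
    simp only [map_zero, mul_zero, add_zero] at h2
    exact h2.symm
  have hv : 1 - Δ ≤ ‖v‖ ^ 2 := by
    rw [norm_sq_eq_re_inner (𝕜 := ℂ), inner_toLp, circuitEnd_isometry, hdot]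
    refine hG.trans_eq ?_
    rw [← Complex.re_sum]
    show _ = Complex.re _
    congr 1
    rw [← Finset.sum_filter_add_sum_filter_not Finset.univ (· ∈ G)]
    rw [Finset.sum_eq_zero (s := Finset.univ.filter fun u => u ∉ G), add_zero]
    · refine Finset.sum_congr (by ext; simp) fun u hu => ?_
      have hu' : u ∈ G := by simpa using hu
      rw [hs1, if_pos hu']
    · intro u hu
      rw [hs1, if_neg (Finset.mem_filter.1 hu).2]
      simp
  obtain ⟨h2, h3⟩ := norm_sub_normalized_le h0 h1 hΔ hv
  refine ⟨ψ₁, ((‖v‖⁻¹ : ℝ) : ℂ), hs1, h2, ?_⟩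
  rw [hvw] at h3
  exact h3

/-! ### Tables of functions of the inner product -/

section Threshold
open Polynomial ComplexConjugate

/-- The outcomes of the comparison of `ρ` with `t` that are correct up to `η`. -/
noncomputable def comparisons (η ρ t : ℝ) : Finset Bool :=
  if ρ < t - η then {false} else if t + η ≤ ρ then {true} else Finset.univ

theorem mem_comparisons_true {η ρ t : ℝ} (h : true ∈ comparisons η ρ t) : t - η ≤ ρ := by
  by_contra h'
  rw [comparisons, if_pos (not_le.1 h')] at h
  simp at h

theorem mem_comparisons_false {η ρ t : ℝ} (hη : 0 < η) (h : false ∈ comparisons η ρ t) :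
    ρ < t + η := by
  by_contra h'
  rw [comparisons, if_neg (by linarith), if_pos (not_lt.1 h')] at h
  simp at h

/-- Correct comparisons with equidistant thresholds form a thermometer code. -/
theorem exists_thermometer {η ρ : ℝ} (hη : 0 < η) (hρ : ρ ∈ Set.Icc (-1 : ℝ) 1) {K : ℕ}
    (hK : 2 ≤ η * K) {a : Bits K}
    (ha : ∀ k : Fin K, a k ∈ comparisons η ρ (-1 - η + 2 * η * (k : ℕ))) :
    ∃ j < K, (∀ k : Fin K, a k = decide ((k : ℕ) < j + 1)) ∧ |min 1 (-1 + 2 * η * j) - ρ| ≤ 2 * η := by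
  classical
  -- j is the first negative comparison, or K if there is none. The undecided bands [t_k - η, t_k +
  -- η) are adjacent and disjoint, so ρ lies in at most one of them and no positive answer can
  -- follow a negative one.
  have hex : ∃ k : ℕ, ∀ h : k < K, a ⟨k, h⟩ = false := ⟨K, fun h => (lt_irrefl K h).elim⟩
  set j := Nat.find hex with hj
  have hjs : ∀ h : j < K, a ⟨j, h⟩ = false := Nat.find_spec hex
  have hlt : ∀ k, k < j → ∃ h : k < K, a ⟨k, h⟩ = true := fun k hk => by
    have := Nat.find_min hex hk
    push Not at this
    obtain ⟨h, h'⟩ := this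
    exact ⟨h, by simpa using h'⟩
  have hjK : j ≤ K := Nat.find_le fun h => (lt_irrefl K h).elim
  have hf : ∀ h : j < K, ρ < -1 - η + 2 * η * j + η := fun h => by
    have := ha ⟨j, h⟩
    rw [hjs h] at this
    exact mem_comparisons_false hη this
  have hup : ρ < -1 + 2 * η * j := by
    rcases hjK.lt_or_eq with h | h
    · linarith [hf h]
    · rw [h]
      nlinarith [hρ.2]
  -- The band of threshold 0 ends at -1, so the first comparison is always positive and the code of
  -- grid point i has i + 1 ones.
  have hj1 : j ≠ 0 := by
    intro h
    rw [h] at hup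
    norm_num at hup
    linarith [hρ.1]
  obtain ⟨i, hi⟩ := Nat.exists_eq_succ_of_ne_zero hj1
  obtain ⟨hiK, hit⟩ := hlt i (by omega)
  have hlow : -1 - η + 2 * η * i - η ≤ ρ := by
    have := ha ⟨i, hiK⟩
    rw [hit] at this
    exact mem_comparisons_true this
  refine ⟨i, hiK, fun k => ?_, ?_⟩
  · rcases lt_or_ge (k : ℕ) j with h | h
    · obtain ⟨h1, h2⟩ := hlt k h
      have : (k : ℕ) < i + 1 := by omega
      simpa [this] using h2
    · have h3 : ¬ (k : ℕ) < i + 1 := by omega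
      rw [decide_eq_false h3]
      rcases h.eq_or_lt with h4 | h4
      · have := hjs (h4 ▸ k.2)
        rw [← this]
        congr 1
        exact Fin.ext h4.symm
      · by_contra h5
        have h6 : a k = true := by simpa using h5
        have h7 := ha k
        rw [h6] at h7
        have h8 := mem_comparisons_true h7
        have h9 : ((j : ℝ) + 1) ≤ (k : ℕ) := by exact_mod_cast h4
        nlinarith
  · have h10 : (j : ℝ) = i + 1 := by rw [hi]; push_cast; ring
    rw [h10] at hup
    rw [abs_le]
    rcases le_total 1 (-1 + 2 * η * i) with h | h
    · rw [min_eq_left h]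
      constructor <;> linarith [hρ.2]
    · rw [min_eq_right h]
      constructor <;> linarith

/-- Polynomials that compare the inner product with given thresholds. -/
theorem exists_threshold_polynomials {η κ : ℝ} (hη : 0 < η) (hη1 : η ≤ 1) (hκ : 0 < κ) (hκ1 : κ ≤ 1)
    (t : ℕ → ℝ) :
    ∃ (N : ℕ) (P : ℕ → ℂ[X]), (∀ k, (P k).natDegree ≤ N) ∧
      (∀ k, ∀ z : ℂ, ‖z‖ = 1 → ‖(P k).eval z‖ < 1) ∧
      ∀ Q : ℕ → ℂ[X], (∀ k, ∀ z : ℂ, ‖z‖ = 1 → ‖(P k).eval z‖ ^ 2 + ‖(Q k).eval z‖ ^ 2 = 1) →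
        ∀ (θ : ℝ) (k : ℕ), 1 - κ ≤ ∑ a ∈ comparisons η (Real.cos θ) (t k),
          ‖(if a then Q k else P k).eval (Complex.exp (θ * Complex.I))‖ ^ 2 := by
  -- The amplitude error is 3δ = κ/2: an amplitude at least 1 - κ/2 has square at least 1 - κ, and
  -- one of size at most κ/2 has square at most κ. Inside the undecided band both answers count,
  -- with total weight 1.
  have hδ : 0 < κ / 6 := by positivity
  have hδ1 : κ / 6 < 1 := by linarith
  obtain ⟨M, hM, -⟩ := exists_filter_degree hη hη1 hδ hδ1.le
  choose P p hdeg hPp hp1 hp using fun k => exists_filter_polynomial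
    (K := fun x => if x < t k then 1 else 0) (fun x => by split_ifs <;> simp) hη hη1 hδ hδ1 hM
  have hPn : ∀ k (θ : ℝ), ‖(P k).eval (Complex.exp (θ * Complex.I))‖ = |p k θ| := fun k θ => by
    rw [hPp, norm_mul, norm_pow, Complex.norm_exp_ofReal_mul_I, one_pow, one_mul,
      Complex.norm_real, Real.norm_eq_abs]
  refine ⟨2 * M, P, hdeg, fun k z hz => ?_, fun Q hQ θ k => ?_⟩
  · have hz' : z = Complex.exp (Complex.arg z * Complex.I) := by
      have := Complex.norm_mul_exp_arg_mul_I z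
      rw [hz, Complex.ofReal_one, one_mul] at this
      exact this.symm
    rw [hz', hPn]
    exact (hp1 k _).trans_lt (by linarith)
  · have hq := hQ k _ (Complex.norm_exp_ofReal_mul_I θ)
    rw [hPn, sq_abs] at hq
    rw [comparisons]
    split_ifs with h1 h2
    · have h3 := (hp k θ 1 1 (by norm_num) le_rfl fun x _ hx => by
        have : x < t k := by linarith [(abs_le.1 hx).2]
        simp [this]).1
      rw [Finset.sum_singleton, if_neg (by simp), hPn, sq_abs]
      nlinarith
    · have h3 := hp k θ 0 0 (by norm_num) (by norm_num) fun x _ hx => by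
        have : ¬ x < t k := by linarith [(abs_le.1 hx).1]
        simp [this]
      rw [Finset.sum_singleton, if_pos rfl]
      nlinarith [h3.1, h3.2]
    · rw [Fintype.sum_bool, if_pos rfl, if_neg (by simp), hPn, sq_abs]
      linarith

/-- K comparisons with error Δ/K each are jointly correct with weight at least 1 - Δ at both
eigenvalues, hence for their mean. Correct outcomes form a thermometer code, which picks the table
entry. K and the degrees depend on η and Δ only, so N is uniform in d and in the table. -/
theorem exists_table_circuit {η Δ : ℝ} (hη : 0 < η) (hη1 : η ≤ 1) (hΔ : 0 < Δ) (hΔ1 : Δ < 1) :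
    ∃ N : ℕ, ∀ (d b : ℕ) (v : ℕ → Bits b), ∃ (q : ℕ) (C : List (Instr d q)) (out : Fin b ↪ Fin q),
      (∀ g ∈ C, g.LoadFree) ∧
      (∀ T, circuitTime T C ≤ N * (4 * T + 10 * dataQubits d + 19 + b)) ∧
      ∀ R S (ρ : ℝ), ρ ∈ Set.Icc (-1 : ℝ) 1 →
        ∑ y, conj (R.1 y (zeroBits _)) * S.1 y (zeroBits _) = (ρ : ℂ) →
        ∃ φ : EuclideanSpace ℂ (Bits q), ‖φ‖ = 1 ∧
          ‖WithLp.toLp 2 (circuitEnd R S C (Pi.single (zeroBits q) 1)) - φ‖ ≤ Real.sqrt (2 * Δ) ∧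
          ∀ z, φ z ≠ 0 → ∃ j : ℕ, |min 1 (-1 + 2 * η * j) - ρ| ≤ 2 * η ∧ z ∘ out = v j := by
  obtain ⟨K, hK⟩ := exists_nat_ge (2 / η)
  have hK2 : 2 ≤ η * K := by rwa [div_le_iff₀' hη] at hK
  have hK0 : (0 : ℝ) < K := by
    by_contra h
    nlinarith [not_lt.1 h]
  have hK1 : (1 : ℝ) ≤ K := by
    have : 0 < K := by exact_mod_cast hK0
    exact_mod_cast this
  have hκ1 : Δ / K ≤ 1 := by rw [div_le_one hK0]; linarith
  obtain ⟨N, P, hdeg, hP1, hP⟩ := exists_threshold_polynomials hη hη1 (div_pos hΔ hK0) hκ1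
    fun k => -1 - η + 2 * η * k
  obtain ⟨Q, hPQ, hC⟩ := exists_bitsCircuit (K := K) hdeg hP1
  refine ⟨K * (N + 1) + 1 + K, fun d b v => ?_⟩
  obtain ⟨C, hCl, hCt, hCs⟩ := hC d (K + b) (Nat.le_add_right K b)
  -- Writing starts from the cleared register, and grid point j has j + 1 ones in its code: hence
  -- the shift by one.
  set v' : ℕ → Bits b := fun j => if j = 0 then zeroBits b else v (j - 1)
  refine ⟨_, C ++ tableCircuit v' K le_rfl,
    ⟨fun t => Fin.castAdd _ (Fin.natAdd K t), fun s t h =>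
      Fin.natAdd_injective _ _ (Fin.castAdd_injective _ _ h)⟩,
    loadFree_append hCl (loadFree_tableCircuit _ _ _), fun T => ?_, fun R S ρ hρ hRS => ?_⟩
  · rw [circuitTime_append]
    have h1 := hCt T
    have h2 := circuitTime_tableCircuit (d := d) (r := walkQubits d) T v' K le_rfl
    calc _ ≤ (K * (N + 1) + 1) * (4 * T + 10 * dataQubits d + 19) + K * b := Nat.add_le_add h1 h2
      _ ≤ (K * (N + 1) + 1) * (4 * T + 10 * dataQubits d + 19 + b) +
          K * (4 * T + 10 * dataQubits d + 19 + b) :=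
        Nat.add_le_add (Nat.mul_le_mul_left _ (Nat.le_add_right _ _))
          (Nat.mul_le_mul_left _ (Nat.le_add_left _ _))
      _ = _ := by ring
  · set θ := Real.arccos ρ
    have hθ : Real.cos θ = ρ := Real.cos_arccos hρ.1 hρ.2
    set ψ := circuitEnd R S C (Pi.single (zeroBits (K + b + walkQubits d)) 1)
    set A : ℕ → Finset Bool := fun k => comparisons η ρ (-1 - η + 2 * η * k)
    set G := Fintype.piFinset fun k : Fin (K + b) => if (k : ℕ) < K then A k else {false}
    have hG : 1 - Δ ≤ ∑ u ∈ G, (star (slice ψ u) ⬝ᵥ slice ψ u).re := by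
      have h1 : ∀ u, (star (slice ψ u) ⬝ᵥ slice ψ u).re =
          (‖(bitPoly P Q K u).eval (Complex.exp (θ * Complex.I))‖ ^ 2 +
            ‖(bitPoly P Q K u).eval (Complex.exp ((-θ : ℝ) * Complex.I))‖ ^ 2) / 2 := by
        intro u
        rw [hCs, inner_aeval_walk (θ := θ) (s' := walkState' R S) (circuitEnd_isometry _)
          (by rw [hθ]; exact circuitEnd_walkCircuit_walkState hRS) circuitEnd_walkCircuit_walkState'
          walkState_inner_self (by rw [hθ]; exact walkState_inner_walkState' hRS),
          Complex.conj_mul', Complex.conj_mul']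
        norm_cast
      have h2 : ∀ τ : ℝ, Real.cos τ = ρ → 1 - K * (Δ / K) ≤
          ∑ u ∈ G, ‖(bitPoly P Q K u).eval (Complex.exp (τ * Complex.I))‖ ^ 2 := by
        intro τ hτ
        refine sum_norm_bitPoly hκ1 fun k => ?_
        have := hP Q hPQ τ k
        rwa [hτ] at this
      simp only [h1, ← Finset.sum_div, Finset.sum_add_distrib]
      have h3 := h2 θ hθ
      have h4 := h2 (-θ) (by rw [Real.cos_neg, hθ])
      rw [mul_div_cancel₀ _ hK0.ne'] at h3 h4
      linarith
    have hψ : star ψ ⬝ᵥ ψ = 1 := by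
      rw [circuitEnd_isometry]
      simp
    obtain ⟨ψ', c, hψ', hφ1, hφ2⟩ := exists_close_state (R := R) (S := S) (tableCircuit v' K le_rfl) hψ G hΔ1 hG
    refine ⟨_, hφ1, by rw [circuitEnd_append]; exact hφ2, fun z hz => ?_⟩
    have hGa : ∀ (a : Bits K) (y : Bits b), Fin.append a y ∈ G → (∀ k : Fin K, a k ∈ A k) ∧ y = zeroBits b := by
      intro a y h
      rw [Fintype.mem_piFinset] at h
      constructor
      · intro k
        have := h (Fin.castAdd b k)
        rwa [Fin.append_left, Fin.val_castAdd, if_pos k.2] at this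
      · funext t
        have := h (Fin.natAdd K t)
        rw [Fin.append_right, Fin.val_natAdd, if_neg (by omega), Finset.mem_singleton] at this
        exact this
    set a : Bits K := fun k => z (Fin.castAdd _ (Fin.castAdd b k))
    set y : Bits b := fun t => z (Fin.castAdd _ (Fin.natAdd K t))
    have hzs : slice (circuitEnd R S (tableCircuit v' K le_rfl) ψ') (Fin.append a y) ≠ 0 := by
      intro h
      refine hz ?_
      have h1 := congrFun h (fun t => z (Fin.natAdd _ t))
      have h2 : Fin.append (Fin.append a y) (fun t => z (Fin.natAdd (K + b) t)) = z := by
        funext s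
        refine Fin.addCases (fun s => ?_) (fun s => ?_) s
        · rw [Fin.append_left]
          refine Fin.addCases (fun s => ?_) (fun s => ?_) s
          · rw [Fin.append_left]
          · rw [Fin.append_right]
        · rw [Fin.append_right]
      rw [slice, h2] at h1
      show c * _ = 0
      rw [h1]
      exact mul_zero c
    have haA : ∀ k : Fin K, a k ∈ A k := by
      by_contra h
      refine hzs (slice_tableCircuit_eq_zero v' K le_rfl (fun y' => ?_) y)
      rw [hψ', if_neg fun h' => h (hGa a y' h').1]
    obtain ⟨j, hjK, hj, hjρ⟩ := exists_thermometer hη hρ hK2 haA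
    have hy := tableCircuit_support (v := v') (by simp [v']) K le_rfl hj
      (fun y' hy' => by rw [hψ', if_neg fun h' => hy' (hGa a y' h').2]) hzs
    refine ⟨j, hjρ, ?_⟩
    rw [min_eq_left (by omega)] at hy
    have hyv : y = v j := by simpa [v'] using hy
    exact hyv

end Threshold

/-! ### Kernel values in a register -/

/-- The estimate L + 1 ≤ 2^L turns the kernel bound into a power of two; the added 1 leaves space
for rounding. -/
theorem IsNormalizedActivation.abs_kernelHat_mul_le {σ : ℝ → ℝ} (hσ : IsNormalizedActivation σ) {a : ℕ}
    (ha : 1 + ∫ u, deriv σ u ^ 2 ∂(gaussianReal 0 1) ≤ 2 ^ a) (p L : ℕ) {ρ : ℝ}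
    (hρ : ρ ∈ Set.Icc (-1 : ℝ) 1) :
    |kernelHat σ L ρ| * 2 ^ p + 1 ≤ 2 ^ (p + 1 + (a + 1) * L) := by
  have hμ : 0 ≤ ∫ u, deriv σ u ^ 2 ∂(gaussianReal 0 1) := integral_nonneg fun u => sq_nonneg _
  have h1 := hσ.abs_kernelHat_le hρ L
  have h2 : ((L : ℝ) + 1) ≤ 2 ^ L := by exact_mod_cast Nat.lt_two_pow_self (n := L)
  have h3 : |kernelHat σ L ρ| ≤ 2 ^ ((a + 1) * L) := by
    refine h1.trans ?_
    calc ((L : ℝ) + 1) * (1 + ∫ u, deriv σ u ^ 2 ∂(gaussianReal 0 1)) ^ L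
        ≤ 2 ^ L * (2 ^ a) ^ L := by gcongr
      _ = 2 ^ ((a + 1) * L) := by rw [← pow_mul, ← pow_add]; congr 1; ring
  have h4 : (1 : ℝ) ≤ 2 ^ ((a + 1) * L) * 2 ^ p := by
    rw [← pow_add]
    exact one_le_pow₀ one_le_two
  calc |kernelHat σ L ρ| * 2 ^ p + 1 ≤ 2 ^ ((a + 1) * L) * 2 ^ p + 2 ^ ((a + 1) * L) * 2 ^ p := by
        gcongr
    _ = 2 ^ (p + 1 + (a + 1) * L) := by rw [pow_add, pow_succ]; ring

/-- The table holds kernel values at the grid points -1 + 2ηj, capped at 1 and rounded to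
2^{-(p+1)}. They are independent of the data and so are built into the circuit; its cost depends on
L only through the O(L) output bits. -/
theorem exists_kernel_register {σ : ℝ → ℝ} (hσ : IsNormalizedActivation σ) {T : ℕ → ℕ → ℕ}
    (hT : ∃ A c : ℕ, ∀ n d : ℕ, 1 ≤ n → 1 ≤ d → (T n d : ℝ) ≤ A * (1 + Real.log (n * d)) ^ c)
    (Λ : ℝ) (p : ℕ) {η Δ : ℝ} (hη : 0 < η) (hη1 : η ≤ 1) (hΔ : 0 < Δ) (hΔ1 : Δ < 1) :
    ∃ A c : ℕ, ∀ (n d L : ℕ) [NeZero n] [NeZero d], (L : ℝ) ≤ Λ * (1 + Real.log n) →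
      ∃ (q m : ℕ) (C : List (Instr d q)) (out : Fin (m + 1) ↪ Fin q),
        (circuitTime (T n d) C : ℝ) ≤ A * (1 + Real.log (n * d)) ^ c ∧
        ∀ (x : Fin n → EuclideanSpace ℝ (Fin d)) (xs : EuclideanSpace ℝ (Fin d)),
          (∀ i, ‖x i‖ = 1) → ‖xs‖ = 1 → ∀ Q : QuantumAccess x xs,
            WritesValues Q C p out Δ fun i v =>
              ∃ ρ ∈ Set.Icc (-1 : ℝ) 1, |ρ - inner ℝ xs (x i)| ≤ 2 * η ∧
                |v - kernelHat σ L ρ| ≤ 1 / 2 ^ (p + 1) := by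
  obtain ⟨A, c, hT⟩ := hT
  obtain ⟨N, hN⟩ := exists_table_circuit hη hη1 hΔ hΔ1
  obtain ⟨a, ha⟩ := pow_unbounded_of_one_lt (1 + ∫ u, deriv σ u ^ 2 ∂(gaussianReal 0 1)) one_lt_two
  obtain ⟨l, hl⟩ := exists_nat_ge Λ
  refine ⟨N * (4 * A + 39 + (p + 2 + (a + 1) * l)), c + 1, fun n d L _ _ hL => ?_⟩
  set m := p + 1 + (a + 1) * L with hm
  have hmem : ∀ j : ℕ, min 1 (-1 + 2 * η * (j : ℝ)) ∈ Set.Icc (-1 : ℝ) 1 := fun j =>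
    ⟨le_min (by norm_num) (by have : 0 ≤ 2 * η * (j : ℝ) := by positivity
                              linarith), min_le_left _ _⟩
  choose v hv using fun j : ℕ => exists_fixedPoint_close p m (hσ.abs_kernelHat_mul_le ha.le p L (hmem j))
  obtain ⟨q, C, out, hCl, hCt, hC⟩ := hN d (m + 1) v
  refine ⟨q, m, C, out, ?_, fun x xs hx hxs Q => ?_⟩
  · have h1 : (circuitTime (T n d) C : ℝ) ≤ N * (4 * T n d + 10 * dataQubits d + 19 + (m + 1)) := by
      exact_mod_cast hCt (T n d)
    have h2 := walk_time_le hT n d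
    have h3 := one_le_one_add_log n d
    have hn1 : (1 : ℝ) ≤ n := Nat.one_le_cast.2 NeZero.one_le
    have hd1 : (1 : ℝ) ≤ d := Nat.one_le_cast.2 NeZero.one_le
    have h4 : Real.log n ≤ Real.log (n * d) := Real.log_le_log (by linarith) (by nlinarith)
    have h5 : (L : ℝ) ≤ l * (1 + Real.log (n * d)) := by
      have := Real.log_nonneg hn1
      calc (L : ℝ) ≤ Λ * (1 + Real.log n) := hL
        _ ≤ l * (1 + Real.log n) := by gcongr
        _ ≤ l * (1 + Real.log (n * d)) := by gcongr
    set y := 1 + Real.log (n * d)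
    have h6 : y ≤ y ^ (c + 1) := le_self_pow₀ h3 (Nat.succ_ne_zero c)
    have h7 : (m : ℝ) + 1 ≤ (p + 2 + (a + 1) * l) * y ^ (c + 1) := by
      calc (m : ℝ) + 1 = (p + 2) * 1 + (a + 1) * L := by rw [hm]; push_cast; ring
        _ ≤ (p + 2) * y + (a + 1) * (l * y) := by gcongr
        _ = (p + 2 + (a + 1) * l) * y := by ring
        _ ≤ _ := by gcongr
    refine h1.trans ?_
    push_cast
    calc (N : ℝ) * (4 * T n d + 10 * dataQubits d + 19 + (m + 1))
        ≤ N * ((4 * A + 39) * y ^ (c + 1) + (p + 2 + (a + 1) * l) * y ^ (c + 1)) := by gcongr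
      _ = _ := by ring
  · have hin : ∀ i, inner ℝ xs (x i) ∈ Set.Icc (-1 : ℝ) 1 := fun i => by
      have := abs_real_inner_le_norm xs (x i)
      rw [hx, hxs, one_mul] at this
      exact abs_le.1 this
    choose φ hφ1 hφ2 hφ using fun i => hC (Q.row i) Q.test (inner ℝ xs (x i)) (hin i)
      (Q.sum_row_test (hx i) hxs)
    refine ⟨_, φ, run_uniformState Q hCl, fun i => ⟨hφ1 i, hφ2 i, fun z hz => ?_⟩⟩
    obtain ⟨j, hj, hjv⟩ := hφ i z hz
    refine ⟨_, hmem j, hj, ?_⟩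
    rw [hjv]
    exact hv j

theorem WritesValues.mono {n d q : ℕ} [NeZero n] {x : Fin n → EuclideanSpace ℝ (Fin d)}
    {xs : EuclideanSpace ℝ (Fin d)} {Q : QuantumAccess x xs} {C : List (Instr d q)} {p m : ℕ}
    {out : Fin (m + 1) ↪ Fin q} {Δ : ℝ} {good good' : Fin n → ℝ → Prop}
    (h : WritesValues Q C p out Δ good) (hgood : ∀ i v, good i v → good' i v) :
    WritesValues Q C p out Δ good' := by
  obtain ⟨ψ, φ, h1, h2⟩ := h
  exact ⟨ψ, φ, h1, fun i => ⟨(h2 i).1, (h2 i).2.1, fun z hz => hgood _ _ ((h2 i).2.2 z hz)⟩⟩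

/-- Heine–Cantor. The modulus depends on L, so it serves the statement for fixed depth. -/
theorem IsNormalizedActivation.exists_modulus {σ : ℝ → ℝ} (hσ : IsNormalizedActivation σ) (L : ℕ)
    {δ : ℝ} (hδ : 0 < δ) : ∃ η : ℝ, 0 < η ∧ η ≤ 1 ∧ ∀ ρ ∈ Set.Icc (-1 : ℝ) 1, ∀ τ ∈ Set.Icc (-1 : ℝ) 1,
      |ρ - τ| ≤ 2 * η → |kernelHat σ L ρ - kernelHat σ L τ| ≤ δ := by
  have h := isCompact_Icc.uniformContinuousOn_of_continuous (hσ.continuousOn_kernelHat L)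
  obtain ⟨ε, hε, h⟩ := Metric.uniformContinuousOn_iff_le.1 h δ hδ
  refine ⟨min 1 (ε / 2), by positivity, min_le_left _ _, fun ρ hρ τ hτ hρτ => ?_⟩
  refine h ρ hρ τ hτ ?_
  rw [Real.dist_eq]
  linarith [min_le_right 1 (ε / 2)]

theorem mainTheorem6 (σ : ℝ → ℝ) (hσ : IsNormalizedActivation σ)
    -- a QRAM query takes polylogarithmic time
    (T : ℕ → ℕ → ℕ)
    (hT : ∃ A c : ℕ, ∀ n d : ℕ, 1 ≤ n → 1 ≤ d → (T n d : ℝ) ≤ A * (1 + Real.log (n * d)) ^ c)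
    -- the depth is at most logarithmic in the number of training examples
    (Λ : ℝ) :
    -- kernel values in a register, depth `L = O(log n)`
    (∀ (p : ℕ) (ε Δ : ℝ), 0 < ε → 0 < Δ → Δ < 1 / 2 →
      ∃ A c : ℕ, ∀ (n d L : ℕ) [NeZero n] [NeZero d], (L : ℝ) ≤ Λ * (1 + Real.log n) →
        ∃ (q m : ℕ) (C : List (Instr d q)) (out : Fin (m + 1) ↪ Fin q),
          (circuitTime (T n d) C : ℝ) ≤ A * (1 + Real.log (n * d)) ^ c ∧
          ∀ (x : Fin n → EuclideanSpace ℝ (Fin d)) (xs : EuclideanSpace ℝ (Fin d)),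
            (∀ i, ‖x i‖ = 1) → ‖xs‖ = 1 → ∀ Q : QuantumAccess x xs,
              WritesValues Q C p out Δ fun i v =>
                ∃ ρ ∈ Set.Icc (-1 : ℝ) 1, |ρ - inner ℝ xs (x i)| ≤ ε ∧
                  |v - kernelHat σ L ρ| ≤ 1 / 2 ^ p) ∧
    -- kernel values in a register, fixed depth
    (∀ (L p : ℕ) (Δ : ℝ), 0 < Δ → Δ < 1 / 2 →
      ∃ A c : ℕ, ∀ (n d : ℕ) [NeZero n] [NeZero d],
        ∃ (q m : ℕ) (C : List (Instr d q)) (out : Fin (m + 1) ↪ Fin q),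
          (circuitTime (T n d) C : ℝ) ≤ A * (1 + Real.log (n * d)) ^ c ∧
          ∀ (x : Fin n → EuclideanSpace ℝ (Fin d)) (xs : EuclideanSpace ℝ (Fin d)),
            (∀ i, ‖x i‖ = 1) → ‖xs‖ = 1 → ∀ Q : QuantumAccess x xs,
              WritesValues Q C p out Δ fun i v => |v - ntk σ L xs (x i)| ≤ 1 / 2 ^ p) ∧
    -- kernel values in the amplitudes
    (∃ A c : ℕ, ∀ (n d L : ℕ) [NeZero n] [NeZero d] (δhat ε Δ p : ℝ),
      (L : ℝ) ≤ Λ * (1 + Real.log n) → 0 ≤ δhat → δhat < 1 → 0 < ε → ε ≤ 1 →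
      0 < Δ → Δ < 1 / 2 → 0 < p → p ≤ 1 →
        ∃ (q : ℕ) (C : List (Instr d q)),
          let X : ℝ := (1 + Real.log (n * d)) ^ c * Real.log (1 / Δ) / ε
          let B : ℝ := A * X * (1 + Real.log (2 + X / p)) ^ c
          (circuitTime (T n d) (Instr.load false :: C) : ℝ) ≤ B ∧
          ∀ (x : Fin n → EuclideanSpace ℝ (Fin d)) (xs : EuclideanSpace ℝ (Fin d)),
            (∀ i, ‖x i‖ = 1) → ‖xs‖ = 1 → ∀ Q : QuantumAccess x xs,
              ∃ ρ : Fin n → ℝ, (∀ i, ρ i ∈ Set.Icc (-1 : ℝ) 1) ∧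
                (∀ i, |ρ i - inner ℝ xs (x i)| ≤ ε) ∧
                let k : Fin n → ℝ := fun i => clippedKernel σ L δhat (ρ i)
                let P : ℝ := ∑ i, k i ^ 2
                let out := run Q C (uniformState n q)
                (∀ i, ‖(Real.sqrt n : ℂ) * accepted out i - (k i : ℂ)‖ ^ 2 ≤ 2 * Δ * p) ∧
                (p ≤ P / n →
                  1 - 2 * Δ ≤ ‖inner ℂ (kernelState k) (postSelected out)‖ ^ 2 ∧
                  expectedTime (T n d) Q (Instr.load false :: C) ≤
                    ENNReal.ofReal (B * (n / P)))) := by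
  refine ⟨fun p ε Δ hε hΔ hΔ2 => ?_, fun L p Δ hΔ hΔ2 => ?_, ?_⟩
  · obtain ⟨A, c, h⟩ := exists_kernel_register hσ hT Λ p (η := min 1 (ε / 2)) (by positivity)
      (min_le_left _ _) hΔ (by linarith)
    refine ⟨A, c, fun n d L _ _ hL => ?_⟩
    obtain ⟨q, m, C, out, ht, hC⟩ := h n d L hL
    refine ⟨q, m, C, out, ht, fun x xs hx hxs Q => (hC x xs hx hxs Q).mono ?_⟩
    rintro i v ⟨ρ, hρ, hρε, hv⟩
    refine ⟨ρ, hρ, by linarith [min_le_right 1 (ε / 2)], hv.trans ?_⟩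
    exact one_div_le_one_div_of_le (by positivity) (pow_le_pow_right₀ one_le_two (Nat.le_succ p))
  · have hδ : (0 : ℝ) < 1 / 2 ^ (p + 1) := by positivity
    obtain ⟨η, hη, hη1, hmod⟩ := hσ.exists_modulus L hδ
    -- A fixed depth L is at most L (1 + log n), so L itself serves as the constant Λ.
    obtain ⟨A, c, h⟩ := exists_kernel_register hσ hT L p hη hη1 hΔ (by linarith)
    refine ⟨A, c, fun n d _ _ => ?_⟩
    have hL : (L : ℝ) ≤ L * (1 + Real.log n) :=
      le_mul_of_one_le_right (Nat.cast_nonneg L) (by linarith [Real.log_natCast_nonneg n])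
    obtain ⟨q, m, C, out, ht, hC⟩ := h n d L hL
    refine ⟨q, m, C, out, ht, fun x xs hx hxs Q => (hC x xs hx hxs Q).mono ?_⟩
    rintro i v ⟨ρ, hρ, hρη, hv⟩
    have hin : inner ℝ xs (x i) ∈ Set.Icc (-1 : ℝ) 1 := by
      have := abs_real_inner_le_norm xs (x i)
      rw [hx, hxs, one_mul] at this
      exact abs_le.1 this
    -- Half of the tolerance is for rounding, half for passing from the grid point to the true inner
    -- product.
    have h2 : (1 : ℝ) / 2 ^ p = 1 / 2 ^ (p + 1) + 1 / 2 ^ (p + 1) := by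
      rw [pow_succ]
      field_simp
      norm_num
    rw [h2]
    exact (abs_sub_le _ _ _).trans (add_le_add hv (hmod ρ hρ _ hin hρη))
  · obtain ⟨A, c, h⟩ := exists_amplitude_encoding σ hσ T hT
    exact ⟨A, c, fun n d L _ _ δhat ε Δ p _ _ _ hε hε1 hΔ hΔ2 hp hp1 =>
      h n d L δhat ε Δ p hε hε1 hΔ hΔ2 hp hp1⟩
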